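/- Let $\Omega\subset\mathbb P^3=\mathbb P(\mathbb R^4)$ be a nonempty properly convex open set (its closure lies in an affine chart in which $\Omega$ is convex) that is strictly convex (no nontrivial segment in $\partial\Omega$) and has $C^1$ boundary. Let $d_\Omega$ be its Hilbert distance and $\mathrm{Aut}(\Omega)$ the group of all $g\in \mathrm{SL}_4(\mathbb R)$ with $g\Omega=\Omega$. An element $\gamma\in\mathrm{Aut}(\Omega)$ is parabolic if $\inf_{x\in\Omega}d_\Omega(x,\gamma x)=0$ and the infimum is not attained. An infinite discrete subgroup $\mathcal P$ of $\mathrm{Aut}(\Omega)$ is parabolic, with fixed point $p\in\partial\Omega$, if it has a finite index subgroup all of whose nontrivial elements are parabolic and fix $p$. (1) Let $\mathcal P\subset \mathrm{Aut}(\Omega)$ be a parabolic subgroup with fixed point $p$. Then $\mathcal P$ fixes $p$, and $\mathcal P$ preserves an ellipsoid $\mathcal E\subset\mathbb P^3$ tangent to $\Omega$ at $p$ (that is, $p\in\partial\mathcal E$, and $\mathcal E$ and $\Omega$ have the same tangent hyperplane at $p$). Moreover $\mathcal P$ is conjugate in $\mathrm{SL}_4(\mathbb R)$ to a subgroup of $\mathrm{SO}(3,1)$,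 and $\mathcal P$ has a finite index subgroup isomorphic to $\mathbb Z$ or $\mathbb Z^2$. (2) Let $\Gamma$ be a discrete subgroup of $\mathrm{Aut}(\Omega)$ with limit set $\Lambda_\Gamma=\overline{\Gamma x}\smallsetminus\Gamma x$ (for any $x\in\Omega$). A point $x\in\Lambda_\Gamma$ is a conical limit point if there are $\gamma_k\in\Gamma$, $x_0,x_1\in\Omega$ and $C>0$ with $\gamma_kx_0\to x$ and $d_\Omega(\gamma_kx_0,[x_1,x[)\le C$ for all $k$. It is a bounded parabolic point if $\mathrm{Stab}_\Gamma(x)$ acts cocompactly on $\Lambda_\Gamma\smallsetminus\{x\}$. It is a uniformly bounded parabolic point if $\mathrm{Stab}_\Gamma(x)$ acts cocompactly on the closure, in the affine space $\mathbb A_x$ of the projective lines through $x$ that meet $\Omega$, of the set of lines joining $x$ to the points other than $x$ of the convex hull of $\Lambda_\Gamma\smallsetminus\{x\}$ (taken in an affine chart containing $\overline\Omega$). Here an action on a space $S$ is cocompact if the translates of some compact subset of $S$ cover $S$. The action of $\Gamma$ on $\partial\Omega$ (resp. on $\Omega$) is called geometrically finite if every point of $\Lambda_\Gamma$ is a conical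 limit point or a bounded (resp. uniformly bounded) parabolic point. Then the action of $\Gamma$ on $\Omega$ is geometrically finite if and only if its action on $\partial\Omega$ is. -/

import Mathlib

open Filter Topology Set
open scoped LinearAlgebra.Projectivization Pointwise

noncomputable section

namespace HilbertGeometry

/-- The vector space `ℝ^{n+1}` whose projectivization is `ℙⁿ`. -/
abbrev Vec (n : ℕ) : Type := Fin (n + 1) → ℝ

/-- The real projective space `ℙⁿ`. -/
abbrev PSpace (n : ℕ) : Type := ℙ ℝ (Vec n)

/-- The group `SL_{n+1}(ℝ)`; it acts on `Vec n` and on `PSpace n` by Mathlib's instances. -/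
abbrev SL (n : ℕ) : Type := Matrix.SpecialLinearGroup (Fin (n + 1)) ℝ

/-- A projectivization carries the quotient topology of `V ∖ {0}`. -/
instance projectivizationTopology (V : Type*) [AddCommGroup V] [Module ℝ V]
    [TopologicalSpace V] : TopologicalSpace (ℙ ℝ V) :=
  inferInstanceAs (TopologicalSpace (Quotient (projectivizationSetoid ℝ V)))

variable {n : ℕ}

/-- All nonzero vectors representing a point of `A` (the two-sided cone over `A`). -/
def cone (A : Set (PSpace n)) : Set (Vec n) :=
  {v | ∃ hv : v ≠ 0, Projectivization.mk ℝ v hv ∈ A}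

/-! ### Convex sets and their boundary -/

/-- The hyperplane `ker f` misses the closure of `Ω`: the affine chart `{f ≠ 0}` (identified with
the affine hyperplane `{f = 1}`) contains the closure of `Ω`. -/
def IsAdapted (Ω : Set (PSpace n)) (f : Vec n →ₗ[ℝ] ℝ) : Prop :=
  ∀ v ∈ cone (closure Ω), f v ≠ 0

/-- Nonempty properly convex open sets of `ℙⁿ`: some affine chart contains the closure of `Ω`,
and `Ω` is convex in this chart. -/
structure IsProperlyConvex (Ω : Set (PSpace n)) : Prop where
  isOpen : IsOpen Ω
  nonempty : Ω.Nonempty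
  convex : ∃ f : Vec n →ₗ[ℝ] ℝ, IsAdapted Ω f ∧ Convex ℝ (cone Ω ∩ {v | f v = 1})

/-- The boundary contains no nontrivial projective segment. -/
def IsStrictlyConvex (Ω : Set (PSpace n)) : Prop :=
  ¬ ∃ u w : Vec n, LinearIndependent ℝ ![u, w] ∧
    ∀ t ∈ Icc (0 : ℝ) 1, (1 - t) • u + t • w ∈ cone (frontier Ω)

/-- The boundary is a hypersurface of class `C¹`: the cone over it is, near each of its points,
the zero set of a `C¹` function with nonzero differential. -/
def HasC1Boundary (Ω : Set (PSpace n)) : Prop :=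
  ∀ v ∈ cone (frontier Ω), ∃ (U : Set (Vec n)) (F : Vec n → ℝ),
    IsOpen U ∧ v ∈ U ∧ ContDiffOn ℝ 1 F U ∧ fderiv ℝ F v ≠ 0 ∧
      ∀ w ∈ U, (w ∈ cone (frontier Ω) ↔ F w = 0)

/-- `Aut(Ω)`: the elements `g` of `SL_{n+1}(ℝ)` with `g Ω = Ω`. -/
def Aut (Ω : Set (PSpace n)) : Subgroup (SL n) := MulAction.stabilizer (SL n) Ω

/-! ### The Hilbert distance -/

/-- The cross-ratio `[p : x : y : q]`, for `x ≠ y` in `Ω`, where `p, q` are the boundary points of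
the line `(xy)`, in the order `p, x, y, q`. With `p = [a]`, `q = [b]`, the chord `]p, q[` is
`{[a + u b] : u > 0}`; if `x = [a + s b]` and `y = [a + t b]`, the cross-ratio is `t / s`.
The set below has exactly one element. -/
def crossRatios (Ω : Set (PSpace n)) (x y : PSpace n) : Set ℝ :=
  {r | ∃ a ∈ cone (frontier Ω), ∃ b ∈ cone (frontier Ω),
    (∀ u : ℝ, 0 < u → a + u • b ∈ cone Ω) ∧
    ∃ s t : ℝ, 0 < s ∧ s < t ∧ a + s • b ∈ cone {x} ∧ a + t • b ∈ cone {y} ∧ r = t / s}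

open Classical in
/-- The Hilbert distance `d_Ω(x, y) = ½ ln [p : x : y : q]` of two points of `Ω`. -/
def hilbertDist (Ω : Set (PSpace n)) (x y : PSpace n) : ℝ :=
  if x = y then 0 else (1 / 2) * Real.log (sSup (crossRatios Ω x y))

/-- The translation distance `τ(γ) = inf_{x ∈ Ω} d_Ω(x, γ x)`. -/
def translationDist (Ω : Set (PSpace n)) (γ : SL n) : ℝ :=
  sInf ((fun x => hilbertDist Ω x (γ • x)) '' Ω)

/-- `γ` is a parabolic automorphism of `Ω`: `τ(γ) = 0` and the infimum is not attained. -/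
def IsParabolic (Ω : Set (PSpace n)) (γ : SL n) : Prop :=
  γ ∈ Aut Ω ∧ translationDist Ω γ = 0 ∧
    ∀ x ∈ Ω, hilbertDist Ω x (γ • x) ≠ translationDist Ω γ

/-- `P` is an (infinite, discrete) parabolic subgroup of `Aut(Ω)` with fixed point `p ∈ ∂Ω`: it has
a finite index subgroup all of whose nontrivial elements are parabolic and fix `p`. -/
structure IsParabolicSubgroup (Ω : Set (PSpace n)) (P : Subgroup (SL n)) (p : PSpace n) :
    Prop where
  le_aut : P ≤ Aut Ω
  discrete : DiscreteTopology P
  infinite : Infinite P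
  mem_frontier : p ∈ frontier Ω
  exists_finiteIndex : ∃ H : Subgroup P, H.FiniteIndex ∧
    ∀ γ ∈ H, γ ≠ 1 → IsParabolic Ω (γ : SL n) ∧ (γ : SL n) • p = p

/-! ### Ellipsoids and `SO(n,1)` -/

/-- The unit ball `{[x₀ : ⋯ : xₙ] : x₁² + ⋯ + xₙ² < x₀²}`. -/
def unitBall (n : ℕ) : Set (PSpace n) :=
  {y | ∃ v ∈ cone {y}, ∑ i : Fin n, v i.succ ^ 2 < v 0 ^ 2}

/-- Ellipsoids: the projective images of the unit ball. (Rescaling, and composing with a reflection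
of the ball, one may take the projective transformation in `SL_{n+1}(ℝ)`.) -/
def IsEllipsoid (E : Set (PSpace n)) : Prop := ∃ g : SL n, E = g • unitBall n

/-- `ker f` is a tangent (supporting) hyperplane of the open convex set `Ω` at `p ∈ ∂Ω`. -/
def IsTangentHyperplane (Ω : Set (PSpace n)) (p : PSpace n) (f : Vec n →ₗ[ℝ] ℝ) : Prop :=
  p ∈ frontier Ω ∧ f ≠ 0 ∧ (∀ v ∈ cone {p}, f v = 0) ∧ ∀ v ∈ cone Ω, f v ≠ 0

/-- `E` and `Ω` are tangent at `p`: `p` is a boundary point of both and they have the same tangent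
hyperplane there. -/
def AreTangentAt (E Ω : Set (PSpace n)) (p : PSpace n) : Prop :=
  ∃ f : Vec n →ₗ[ℝ] ℝ, IsTangentHyperplane E p f ∧ IsTangentHyperplane Ω p f

/-- The matrix `diag(-1, 1, …, 1)`. -/
def lorentzMatrix (n : ℕ) : Matrix (Fin (n + 1)) (Fin (n + 1)) ℝ :=
  Matrix.diagonal (Fin.cons (-1) fun _ => 1)

/-- The group `SO(n,1)` of the `g ∈ SL_{n+1}(ℝ)` that preserve `-x₀² + x₁² + ⋯ + xₙ²`. -/
def SOn1 (n : ℕ) : Subgroup (SL n) where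
  carrier := {g | g.1.transpose * lorentzMatrix n * g.1 = lorentzMatrix n}
  one_mem' := by simp
  mul_mem' := by
    intro a b ha hb
    simp only [Set.mem_ofPred_eq, Matrix.SpecialLinearGroup.coe_mul, Matrix.transpose_mul] at *
    calc _ = b.1.transpose * (a.1.transpose * lorentzMatrix n * a.1) * b.1 := by
            simp only [Matrix.mul_assoc]
      _ = _ := by rw [ha, hb]
  inv_mem' := by
    intro a ha
    simp only [Set.mem_ofPred_eq] at *
    have h : a.1 * (a⁻¹).1 = 1 := by
      rw [← Matrix.SpecialLinearGroup.coe_mul, mul_inv_cancel, Matrix.SpecialLinearGroup.coe_one]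
    have h' : (a⁻¹).1.transpose * a.1.transpose = 1 := by
      rw [← Matrix.transpose_mul, h, Matrix.transpose_one]
    calc (a⁻¹).1.transpose * lorentzMatrix n * (a⁻¹).1
        = (a⁻¹).1.transpose * (a.1.transpose * lorentzMatrix n * a.1) * (a⁻¹).1 := by rw [ha]
      _ = ((a⁻¹).1.transpose * a.1.transpose) * lorentzMatrix n * (a.1 * (a⁻¹).1) := by
            simp only [Matrix.mul_assoc]
      _ = _ := by rw [h, h', one_mul, mul_one]

/-- `P` is virtually `ℤ` or virtually `ℤ²`. -/
def IsVirtuallyZOrZ2 (P : Subgroup (SL n)) : Prop :=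
  ∃ H : Subgroup P, H.FiniteIndex ∧
    (Nonempty (H ≃* Multiplicative ℤ) ∨ Nonempty (H ≃* Multiplicative (ℤ × ℤ)))

/-! ### Limit set and geometric finiteness -/

/-- The limit set `Λ_Γ`, the set of the points of `closure (Γ x) ∖ Γ x`, `x ∈ Ω`. (For discrete `Γ`
and strictly convex `Ω` this does not depend on `x`.) -/
def limitSet (Ω : Set (PSpace n)) (Γ : Subgroup (SL n)) : Set (PSpace n) :=
  ⋃ x ∈ Ω, closure (MulAction.orbit Γ x) \ MulAction.orbit Γ x

/-- The stabilizer of `x` in `Γ`. -/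
def stab (Γ : Subgroup (SL n)) (x : PSpace n) : Subgroup (SL n) :=
  Γ ⊓ MulAction.stabilizer (SL n) x

/-- The half-line `[x₁, x[` of `Ω`, for `x₁ ∈ Ω` and `x ∈ ∂Ω`. -/
def halfLine (Ω : Set (PSpace n)) (x₁ x : PSpace n) : Set (PSpace n) :=
  {y | ∃ u ∈ cone {x₁}, ∃ w ∈ cone {x}, (∀ s : ℝ, 0 ≤ s → u + s • w ∈ cone Ω) ∧
    ∃ s : ℝ, 0 ≤ s ∧ u + s • w ∈ cone {y}}

/-- Conical limit points: some sequence `γₖ x₀` converges to `x` at bounded Hilbert distance from a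
half-line `[x₁, x[`. -/
def IsConicalLimitPoint (Ω : Set (PSpace n)) (Γ : Subgroup (SL n)) (x : PSpace n) : Prop :=
  x ∈ limitSet Ω Γ ∧ ∃ γ : ℕ → SL n, (∀ k, γ k ∈ Γ) ∧ ∃ x₀ ∈ Ω, ∃ x₁ ∈ Ω, ∃ C : ℝ, 0 < C ∧
    Tendsto (fun k => γ k • x₀) atTop (𝓝 x) ∧
    ∀ k, ∃ y ∈ halfLine Ω x₁ x, hilbertDist Ω (γ k • x₀) y ≤ C

/-- Bounded parabolic points: `Stab_Γ(x)` acts cocompactly on `Λ_Γ ∖ {x}`. -/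
def IsBoundedParabolicPoint (Ω : Set (PSpace n)) (Γ : Subgroup (SL n)) (x : PSpace n) : Prop :=
  x ∈ limitSet Ω Γ ∧ ∃ K ⊆ limitSet Ω Γ \ {x}, IsCompact K ∧
    ∀ y ∈ limitSet Ω Γ \ {x}, ∃ γ ∈ stab Γ x, ∃ k ∈ K, y = γ • k

/-- The convex hull of a subset `A` of the closure of `Ω`, taken in an affine chart containing the
closure of `Ω` (it does not depend on the chart). -/
def hull (Ω A : Set (PSpace n)) : Set (PSpace n) :=
  {y | ∃ f : Vec n →ₗ[ℝ] ℝ, IsAdapted Ω f ∧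
    ∃ v ∈ convexHull ℝ (cone A ∩ {v | f v = 1}), v ∈ cone {y}}

/-- The projective space `ℙ(ℝ^{n+1} / x)` of the projective lines through `x`. -/
abbrev LinesThrough (x : PSpace n) : Type := ℙ ℝ (Vec n ⧸ x.submodule)

/-- `ℓ` is the line through `x` and `[v] ≠ x`. -/
def IsLineTo (x : PSpace n) (v : Vec n) (ℓ : LinesThrough x) : Prop :=
  ∃ h : x.submodule.mkQ v ≠ 0, ℓ = Projectivization.mk ℝ (x.submodule.mkQ v) h

/-- `𝒟_x(A)`: the lines through `x` that meet `A ∖ {x}`. -/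
def dirs (x : PSpace n) (A : Set (PSpace n)) : Set (LinesThrough x) :=
  {ℓ | ∃ v ∈ cone A, IsLineTo x v ℓ}

/-- The closure of `𝒟_x(C(Λ_Γ ∖ {x}))` in the affine space `𝔸_x = 𝒟_x(Ω)` of the lines through `x`
that are not contained in the tangent hyperplane of `Ω` at `x`. -/
def limitDirs (Ω : Set (PSpace n)) (Γ : Subgroup (SL n)) (x : PSpace n) :
    Set (LinesThrough x) :=
  closure (dirs x (hull Ω (limitSet Ω Γ \ {x}))) ∩ dirs x Ω

/-- Uniformly bounded parabolic points: `Stab_Γ(x)` acts cocompactly on `limitDirs Ω Γ x`. An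
element `γ` of `Stab_Γ(x)` sends the line through `x` and `[v]` to the line through `x` and
`[γ v]`. -/
def IsUniformlyBoundedParabolicPoint (Ω : Set (PSpace n)) (Γ : Subgroup (SL n)) (x : PSpace n) :
    Prop :=
  x ∈ limitSet Ω Γ ∧ ∃ K ⊆ limitDirs Ω Γ x, IsCompact K ∧
    ∀ ℓ ∈ limitDirs Ω Γ x, ∃ γ ∈ stab Γ x, ∃ k ∈ K, ∃ v : Vec n,
      IsLineTo x v k ∧ IsLineTo x (γ • v) ℓ

/-- The action of `Γ` on `∂Ω` is geometrically finite. -/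
def GeomFiniteOnBoundary (Ω : Set (PSpace n)) (Γ : Subgroup (SL n)) : Prop :=
  ∀ x ∈ limitSet Ω Γ, IsConicalLimitPoint Ω Γ x ∨ IsBoundedParabolicPoint Ω Γ x

/-- The action of `Γ` on `Ω` is geometrically finite. -/
def GeomFiniteOnDomain (Ω : Set (PSpace n)) (Γ : Subgroup (SL n)) : Prop :=
  ∀ x ∈ limitSet Ω Γ, IsConicalLimitPoint Ω Γ x ∨ IsUniformlyBoundedParabolicPoint Ω Γ x

end HilbertGeometry

end

noncomputable section

namespace HilbertGeometry

/-! Fix a boundary point `x`, one of the two convex cones `C` over `Ω`, a vector `p` of its closure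
above `x`, and the supporting form `f` at `p`. The lines through `x` outside the tangent hyperplane
form an affine plane, and the slice of `C` by `f = 1` lies over it in the direction of `p`. Because
the boundary is `C¹`, the supporting form is unique, and the slice meets every such line: it is the
region above a graph over the whole plane (`exists_add_smul_mem_of_support_pos`). Because `Ω` is
strictly convex, the height of this graph grows faster than every linear function
(`exists_add_mul_support_nonneg`). The study of automorphisms fixing `x` rests on these two
properties, recorded in `IsCusp`.

An automorphism fixing `x`, rescaled so as to preserve `f`, multiplies `p` by some `a > 0` and acts
on the plane by an affine map `y ↦ A y + c`. The key lemma is `IsCuspAut.of_fixes_no_line`: if this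
affine map has no fixed point, then `a = 1` and `A = 1`. Indeed some linear coordinate of the plane
is then translated by a nonzero amount, and unless `a`, `A` are trivial some orbit of the map or of
its inverse has a height contradicting superlinear growth. If the affine map has a fixed point and
`a = 1`, a vector of the slice is fixed and superlinearity bounds the powers of `A`, so `A` is `1`,
`-1` or elliptic (`linPart_of_unipotent`). If `a ≠ 1`, there is a second fixed point on a line
through `x`, and the iterates of the map or of its inverse push points of `Ω` to `x` along that
line.

Part (1). A parabolic element fixes no line of the plane: otherwise it would fix a point of `Ω`, or
displace all points by at least `|log a| / 2` (`apply_ne_of_isParabolic`). The finite index subgroup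
therefore acts faithfully by translations. The height function recovers a unipotent matrix
continuously from its translation, so the translations form a discrete subgroup of the plane,
isomorphic to `ℤ` or `ℤ²`. Along an orbit the height is a quadratic polynomial; commutation makes
its quadratic part symmetric and superlinearity makes it positive definite. This gives an invariant
Lorentzian form for which `p` is isotropic with orthogonal `ker f`. Averaging over cosets makes it
invariant under the whole group, and a Lorentz basis then gives both the ellipsoid and the
conjugation.

Part (2). If the stabilizer of `x` contains an element with `a ≠ 1`, then `x` is conical. Otherwise
the stabilizer acts on the plane with linear parts `1`, `-1` or elliptic, and for such groups a set
covered by translates of a ball has a closed convex hull covered by translates of a compact set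
(`IsEllipticAffineGroup.coversHull`). So bounded implies uniformly bounded. The converse holds
because the plane parametrizes the boundary without `x` continuously and the limit set is closed. -/

variable {n : ℕ}

/-! ### Topology of projective spaces -/

section ProjectiveTopology

variable {V : Type*} [AddCommGroup V] [Module ℝ V] [TopologicalSpace V]

/-- The quotient map `V ∖ {0} → ℙ(V)`. -/
def projMk (v : {v : V // v ≠ 0}) : ℙ ℝ V := Projectivization.mk ℝ v.1 v.2

theorem continuous_projMk : Continuous (projMk (V := V)) :=
  continuous_quotient_mk'

theorem isOpen_iff_projMk {A : Set (ℙ ℝ V)} : IsOpen A ↔ IsOpen (projMk ⁻¹' A) :=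
  Iff.rfl

/-- The saturation of an open set is the union of its images under homotheties. Openness is what
allows closures in projective space to be computed on cones. -/
theorem isOpenMap_projMk [ContinuousConstSMul ℝ V] : IsOpenMap (projMk (V := V)) := by
  intro U hU
  rw [isOpen_iff_projMk]
  have : projMk ⁻¹' (projMk '' U) =
      ⋃ a : ℝˣ, (fun v : {v : V // v ≠ 0} =>
        (⟨a • v.1, (smul_ne_zero_iff_ne a).2 v.2⟩ : {v : V // v ≠ 0})) ⁻¹' U := by
    ext v
    simp only [mem_preimage, mem_image, mem_iUnion]
    constructor
    · rintro ⟨w, hw, h⟩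
      obtain ⟨a, ha⟩ := (Projectivization.mk_eq_mk_iff ℝ _ _ w.2 v.2).1 h
      refine ⟨a, ?_⟩
      convert hw using 1
      exact Subtype.ext ha
    · rintro ⟨a, ha⟩
      exact ⟨_, ha, (Projectivization.mk_eq_mk_iff ℝ _ _ _ v.2).2 ⟨a, rfl⟩⟩
  rw [this]
  refine isOpen_iUnion fun a => hU.preimage ?_
  refine Continuous.subtype_mk ?_ _
  exact (continuous_const_smul (a : ℝ)).comp continuous_subtype_val

theorem tendsto_mk {α : Type*} {l : Filter α} {u : α → V} {v : V} (hu : ∀ k, u k ≠ 0) (hv : v ≠ 0)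
    (h : Tendsto u l (𝓝 v)) :
    Tendsto (fun k => Projectivization.mk ℝ (u k) (hu k)) l (𝓝 (Projectivization.mk ℝ v hv)) := by
  have h1 : Tendsto (fun k => (⟨u k, hu k⟩ : {v : V // v ≠ 0})) l (𝓝 ⟨v, hv⟩) :=
    tendsto_subtype_rng.2 h
  exact ((continuous_projMk (V := V)).tendsto ⟨v, hv⟩).comp h1

theorem continuous_mk_comp {X : Type*} [TopologicalSpace X] {u : X → V} (hu : Continuous u)
    (h0 : ∀ x, u x ≠ 0) : Continuous fun x => Projectivization.mk ℝ (u x) (h0 x) :=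
  (continuous_projMk (V := V)).comp (hu.subtype_mk h0)

end ProjectiveTopology

/-! ### The cone over a set of points of projective space -/

theorem mk_mem_of_mem_cone {A : Set (PSpace n)} {v : Vec n} (h : v ∈ cone A) :
    Projectivization.mk ℝ v h.1 ∈ A := h.2

theorem mem_cone_iff {A : Set (PSpace n)} {v : Vec n} (hv : v ≠ 0) :
    v ∈ cone A ↔ Projectivization.mk ℝ v hv ∈ A :=
  ⟨fun h => h.2, fun h => ⟨hv, h⟩⟩

theorem cone_mono {A B : Set (PSpace n)} (h : A ⊆ B) : cone A ⊆ cone B :=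
  fun _ hv => ⟨hv.1, h hv.2⟩

theorem smul_mem_cone_iff {A : Set (PSpace n)} {v : Vec n} {r : ℝ} (hr : r ≠ 0) :
    r • v ∈ cone A ↔ v ∈ cone A := by
  have key : ∀ (r : ℝ) (v : Vec n), r ≠ 0 → v ∈ cone A → r • v ∈ cone A := by
    rintro r v hr ⟨hv, h⟩
    refine ⟨smul_ne_zero hr hv, ?_⟩
    rwa [(Projectivization.mk_eq_mk_iff' ℝ _ _ (smul_ne_zero hr hv) hv).2 ⟨r, rfl⟩]
  refine ⟨fun h => ?_, key r v hr⟩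
  simpa [smul_smul, inv_mul_cancel₀ hr] using key r⁻¹ _ (inv_ne_zero hr) h

theorem neg_mem_cone_iff {A : Set (PSpace n)} {v : Vec n} : -v ∈ cone A ↔ v ∈ cone A := by
  simpa using smul_mem_cone_iff (A := A) (v := v) (r := -1) (by norm_num)

theorem mem_cone_singleton_mk {v w : Vec n} (hw : w ≠ 0) :
    v ∈ cone {Projectivization.mk ℝ w hw} ↔ ∃ r : ℝ, r ≠ 0 ∧ v = r • w := by
  constructor
  · rintro ⟨hv, h⟩
    obtain ⟨a, ha⟩ := (Projectivization.mk_eq_mk_iff ℝ _ _ hv hw).1 h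
    exact ⟨a, a.ne_zero, ha.symm⟩
  · rintro ⟨r, hr, rfl⟩
    rw [smul_mem_cone_iff hr]
    exact ⟨hw, rfl⟩

theorem mem_iff_cone {A : Set (PSpace n)} {x : PSpace n} {v : Vec n} (h : v ∈ cone {x}) :
    x ∈ A ↔ v ∈ cone A := by
  obtain ⟨hv, hx⟩ := h
  rw [mem_singleton_iff] at hx
  rw [mem_cone_iff hv, hx]

theorem rep_mem_cone (x : PSpace n) : x.rep ∈ cone {x} :=
  ⟨x.rep_nonzero, by simp⟩

theorem eq_mk_of_mem_cone {x : PSpace n} {v : Vec n} (h : v ∈ cone {x}) :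
    x = Projectivization.mk ℝ v h.1 := by
  obtain ⟨hv, hx⟩ := h
  exact hx.symm

theorem eq_of_mem_cone {x y : PSpace n} {v : Vec n} (h : v ∈ cone {x}) (h' : v ∈ cone {y}) :
    x = y := by
  rw [eq_mk_of_mem_cone h, eq_mk_of_mem_cone h']

theorem cone_eq_image (A : Set (PSpace n)) : cone A = Subtype.val '' (projMk ⁻¹' A) := by
  ext v
  constructor
  · rintro ⟨hv, h⟩
    exact ⟨⟨v, hv⟩, h, rfl⟩
  · rintro ⟨w, hw, rfl⟩
    exact ⟨w.2, hw⟩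

theorem isOpen_iff_cone {A : Set (PSpace n)} : IsOpen A ↔ IsOpen (cone A) := by
  rw [isOpen_iff_projMk, cone_eq_image]
  exact (isOpen_ne.isOpenEmbedding_subtypeVal).isOpen_iff_image_isOpen

theorem mem_cone_closure {A : Set (PSpace n)} {v : Vec n} (hv : v ≠ 0) :
    v ∈ cone (closure A) ↔ v ∈ closure (cone A) := by
  rw [mem_cone_iff hv]
  have h1 : projMk ⁻¹' (closure A) = closure (projMk ⁻¹' A) :=
    isOpenMap_projMk.preimage_closure_eq_closure_preimage continuous_projMk A
  have h2 : (⟨v, hv⟩ : {v : Vec n // v ≠ 0}) ∈ projMk ⁻¹' (closure A) ↔ v ∈ closure (cone A) := by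
    rw [h1, cone_eq_image, closure_subtype]
  exact h2

theorem mem_cone_frontier {A : Set (PSpace n)} (hA : IsOpen A) {v : Vec n} (hv : v ≠ 0) :
    v ∈ cone (frontier A) ↔ v ∈ closure (cone A) ∧ v ∉ cone A := by
  rw [hA.frontier_eq, ← mem_cone_closure hv, mem_cone_iff hv, mem_cone_iff hv, mem_cone_iff hv]
  rfl

theorem smul_mem_cone_smul {A : Set (PSpace n)} {g : SL n} {v : Vec n} :
    g • v ∈ cone (g • A) ↔ v ∈ cone A := by
  constructor
  · rintro ⟨hv, h⟩
    have hv' : v ≠ 0 := (smul_ne_zero_iff_ne g).1 hv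
    refine ⟨hv', ?_⟩
    rw [← Set.smul_mem_smul_set_iff (a := g)]
    exact h
  · rintro ⟨hv, h⟩
    exact ⟨(smul_ne_zero_iff_ne g).2 hv, Set.smul_mem_smul_set h⟩

theorem smul_mem_cone_singleton {x : PSpace n} {g : SL n} {v : Vec n} (h : v ∈ cone {x}) :
    g • v ∈ cone {g • x} := by
  have := (smul_mem_cone_smul (A := {x}) (g := g)).2 h
  rwa [Set.smul_set_singleton] at this

theorem SL_smul_eq (g : SL n) (v : Vec n) : g • v = g.1.mulVec v := rfl

theorem mem_Aut_iff {Ω : Set (PSpace n)} {g : SL n} : g ∈ Aut Ω ↔ g • Ω = Ω := Iff.rfl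

theorem smul_mem_cone_of_mem_Aut {Ω : Set (PSpace n)} {g : SL n} (hg : g ∈ Aut Ω) {v : Vec n} :
    g • v ∈ cone Ω ↔ v ∈ cone Ω := by
  conv_lhs => rw [← mem_Aut_iff.1 hg]
  exact smul_mem_cone_smul

theorem continuous_smul_pspace (g : SL n) : Continuous fun x : PSpace n => g • x := by
  have hq : IsQuotientMap (projMk (V := Vec n)) := isQuotientMap_quotient_mk'
  rw [hq.continuous_iff]
  exact continuous_mk_comp (u := fun v : {v : Vec n // v ≠ 0} => g • v.1)
    ((LinearMap.continuous_of_finiteDimensional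
      (DistribSMul.toLinearMap ℝ (Vec n) g)).comp continuous_subtype_val)
    fun v => (smul_ne_zero_iff_ne g).2 v.2


/-! ### Open convex cones -/

/-- Open convex cones of `ℝ^{n+1}`. -/
structure IsOpenConvexCone (C : Set (Vec n)) : Prop where
  isOpen : IsOpen C
  smul_mem : ∀ v ∈ C, ∀ r : ℝ, 0 < r → r • v ∈ C
  add_mem : ∀ u ∈ C, ∀ v ∈ C, u + v ∈ C

namespace IsOpenConvexCone

variable {C : Set (Vec n)}

theorem convex (hC : IsOpenConvexCone C) : Convex ℝ C := by
  rw [convex_iff_forall_pos]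
  intro x hx y hy a b ha hb _
  exact hC.add_mem _ (hC.smul_mem _ hx _ ha) _ (hC.smul_mem _ hy _ hb)

theorem exists_add_smul_mem (hC : IsOpenConvexCone C) {v : Vec n} (hv : v ∈ C) (w : Vec n) :
    ∃ ε : ℝ, 0 < ε ∧ v + ε • w ∈ C := by
  have h : Tendsto (fun ε : ℝ => v + ε • w) (𝓝[>] 0) (𝓝 v) := by
    have : Continuous fun ε : ℝ => v + ε • w := by fun_prop
    simpa using (this.tendsto 0).mono_left nhdsWithin_le_nhds
  obtain ⟨ε, h1, h2⟩ :=
    ((h.eventually (hC.isOpen.mem_nhds hv)).and self_mem_nhdsWithin).exists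
  exact ⟨ε, h2, h1⟩

theorem add_closure_mem (hC : IsOpenConvexCone C) {u v : Vec n} (hu : u ∈ C)
    (hv : v ∈ closure C) : u + v ∈ C := by
  have ho : IsOpen ((fun w => u + (v - w)) ⁻¹' C) :=
    hC.isOpen.preimage (by fun_prop)
  obtain ⟨w, hw, hw'⟩ := mem_closure_iff.1 hv _ ho (by simpa using hu)
  have := hC.add_mem _ hw _ hw'
  rwa [show u + (v - w) + w = u + v by abel] at this

theorem closure_smul_mem (hC : IsOpenConvexCone C) {v : Vec n} (hv : v ∈ closure C) {r : ℝ}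
    (hr : 0 < r) : r • v ∈ closure C := by
  refine map_mem_closure (continuous_const_smul r) hv fun w hw => hC.smul_mem _ hw _ hr

theorem closure_add_mem (hC : IsOpenConvexCone C) {u v : Vec n} (hu : u ∈ closure C)
    (hv : v ∈ closure C) : u + v ∈ closure C :=
  map_mem_closure₂ continuous_add hu hv fun a ha b hb => hC.add_mem a ha b hb

/-- A nonnegative form vanishing at a point of the open cone is nonnegative in every direction `w`
and `-w`, hence zero. -/
theorem functional_pos (hC : IsOpenConvexCone C) {f : Vec n →ₗ[ℝ] ℝ} (hf : f ≠ 0)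
    (h : ∀ v ∈ C, 0 ≤ f v) : ∀ v ∈ C, 0 < f v := by
  intro v hv
  refine lt_of_le_of_ne (h v hv) fun h0 => hf ?_
  ext1 i
  refine LinearMap.ext fun r => ?_
  have key : ∀ w, 0 ≤ f w := by
    intro w
    obtain ⟨ε, hε, hm⟩ := hC.exists_add_smul_mem hv w
    have := h _ hm
    rw [map_add, ← h0, map_smul, smul_eq_mul, zero_add] at this
    exact nonneg_of_mul_nonneg_right this hε
  have h1 := key (LinearMap.single ℝ (fun _ => ℝ) i r)
  have h2 := key (-(LinearMap.single ℝ (fun _ => ℝ) i r))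
  rw [map_neg] at h2
  simp only [LinearMap.comp_apply, LinearMap.zero_apply]
  linarith

theorem functional_nonneg_closure {f : Vec n →ₗ[ℝ] ℝ}
    (h : ∀ v ∈ C, 0 ≤ f v) {v : Vec n} (hv : v ∈ closure C) : 0 ≤ f v :=
  closure_minimal (t := {v | 0 ≤ f v}) h
    (isClosed_le continuous_const (LinearMap.continuous_of_finiteDimensional f)) hv

theorem exists_functional (hC : IsOpenConvexCone C) (hne : C.Nonempty) {v : Vec n} (hv : v ∉ C) :
    ∃ f : Vec n →ₗ[ℝ] ℝ, (∀ u ∈ C, 0 < f u) ∧ f v ≤ 0 := by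
  obtain ⟨f, hf⟩ := geometric_hahn_banach_open_point hC.convex hC.isOpen hv
  have h1 : ∀ u ∈ C, f u ≤ 0 := by
    intro u hu
    by_contra! hlt
    -- A form bounded above on a cone is nonpositive there: this multiple of `u` would exceed the
    -- bound `f v`.
    have h2 := hf _ (hC.smul_mem u hu ((|f v| + 1) / f u) (by positivity))
    rw [map_smul, smul_eq_mul, div_mul_cancel₀ _ hlt.ne'] at h2
    linarith [le_abs_self (f v)]
  have h2 : 0 ≤ f v := by
    obtain ⟨u, hu⟩ := hne
    by_contra! hlt
    have h4 := h1 u hu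
    have h5 : (f : Vec n → ℝ) u < 0 := (hf u hu).trans hlt
    have h3 := hf _ (hC.smul_mem u hu (f v / f u) (div_pos_of_neg_of_neg hlt h5))
    rw [map_smul, smul_eq_mul, div_mul_cancel₀ _ h5.ne] at h3
    exact lt_irrefl _ h3
  have h0 : (-f : Vec n →L[ℝ] ℝ).toLinearMap ≠ 0 := by
    intro h
    obtain ⟨u, hu⟩ := hne
    have h3 := hf u hu
    have : ∀ w, f w = 0 := fun w => by
      have := LinearMap.congr_fun h w
      simpa using this
    rw [this, this] at h3
    exact lt_irrefl _ h3
  refine ⟨(-f : Vec n →L[ℝ] ℝ).toLinearMap, hC.functional_pos h0 ?_, ?_⟩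
  · intro u hu
    simpa using h1 u hu
  · simpa using h2

end IsOpenConvexCone

/-! ### The cone over a properly convex set -/

/-- `C` is one of the two convex cones over `Ω`, and `k` is a linear form which is positive on its
closure. -/
structure IsConeOver (C : Set (Vec n)) (k : Vec n →ₗ[ℝ] ℝ) (Ω : Set (PSpace n)) : Prop
    extends IsOpenConvexCone C where
  nonempty : C.Nonempty
  pos : ∀ v ∈ closure C, v ≠ 0 → 0 < k v
  mem_cone : ∀ v, v ∈ cone Ω ↔ v ∈ C ∨ -v ∈ C

theorem IsAdapted.exists_isConeOver {Ω : Set (PSpace n)} (hΩ : IsProperlyConvex Ω)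
    {k : Vec n →ₗ[ℝ] ℝ} (hk : IsAdapted Ω k) (hconv : Convex ℝ (cone Ω ∩ {v | k v = 1})) :
    IsConeOver {v | v ∈ cone Ω ∧ 0 < k v} k Ω := by
  have hkc : Continuous k := LinearMap.continuous_of_finiteDimensional k
  have hne : ∀ v ∈ cone Ω, k v ≠ 0 := fun v hv => hk v (cone_mono subset_closure hv)
  have hmem : ∀ v, v ∈ cone Ω ↔ (v ∈ cone Ω ∧ 0 < k v) ∨ (-v ∈ cone Ω ∧ 0 < k (-v)) := by
    intro v
    rw [neg_mem_cone_iff, map_neg]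
    constructor
    · intro hv
      rcases lt_or_gt_of_ne (hne v hv) with h | h
      · exact Or.inr ⟨hv, by linarith⟩
      · exact Or.inl ⟨hv, h⟩
    · rintro (h | h) <;> exact h.1
  refine ⟨⟨?_, ?_, ?_⟩, ?_, ?_, hmem⟩
  · exact (isOpen_iff_cone.1 hΩ.isOpen).inter (isOpen_lt continuous_const hkc)
  · rintro v ⟨hv, hv'⟩ r hr
    refine ⟨(smul_mem_cone_iff hr.ne').2 hv, ?_⟩
    rw [map_smul, smul_eq_mul]
    positivity
  · rintro u ⟨hu, hu'⟩ v ⟨hv, hv'⟩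
    have hpos : 0 < k (u + v) := by rw [map_add]; positivity
    refine ⟨?_, hpos⟩
    have hsl : ∀ w ∈ cone Ω, 0 < k w → (k w)⁻¹ • w ∈ cone Ω ∩ {v | k v = 1} := by
      intro w hw hw'
      refine ⟨(smul_mem_cone_iff (inv_ne_zero hw'.ne')).2 hw, ?_⟩
      simp [hw'.ne']
    have h := hconv (hsl u hu hu') (hsl v hv hv') (a := k u / k (u + v)) (b := k v / k (u + v))
      (by positivity) (by positivity) (by rw [← add_div, map_add, div_self]; rw [map_add] at hpos
                                          exact hpos.ne')
    -- Up to scaling, a sum of two vectors is a convex combination of their representatives in the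
    -- slice `k = 1`.
    have h2 : (k u / k (u + v)) • (k u)⁻¹ • u + (k v / k (u + v)) • (k v)⁻¹ • v
        = (k (u + v))⁻¹ • (u + v) := by
      rw [smul_smul, smul_smul, smul_add]
      congr 2 <;> field_simp
    rw [h2] at h
    exact (smul_mem_cone_iff (inv_ne_zero hpos.ne')).1 h.1
  · obtain ⟨x, hx⟩ := hΩ.nonempty
    have h1 : x.rep ∈ cone Ω := (mem_iff_cone (rep_mem_cone x)).1 hx
    rcases (hmem _).1 h1 with h | h
    · exact ⟨_, h⟩
    · exact ⟨_, h⟩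
  · intro v hv hv0
    have h1 : 0 ≤ k v := closure_minimal (t := {v | 0 ≤ k v}) (fun w hw => hw.2.le)
      (isClosed_le continuous_const hkc) hv
    refine lt_of_le_of_ne h1 (Ne.symm (hk v ?_))
    rw [mem_cone_closure hv0]
    exact closure_mono (fun w hw => hw.1) hv

theorem IsProperlyConvex.exists_isConeOver {Ω : Set (PSpace n)} (hΩ : IsProperlyConvex Ω) :
    ∃ C k, IsConeOver C k Ω := by
  obtain ⟨k, hk, hconv⟩ := hΩ.convex
  exact ⟨_, k, hk.exists_isConeOver hΩ hconv⟩

namespace IsConeOver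

variable {C : Set (Vec n)} {k : Vec n →ₗ[ℝ] ℝ} {Ω : Set (PSpace n)}

theorem zero_notMem (hC : IsConeOver C k Ω) : (0 : Vec n) ∉ C := fun h =>
  ((hC.mem_cone 0).2 (Or.inl h)).1 rfl

theorem ne_zero (hC : IsConeOver C k Ω) {v : Vec n} (hv : v ∈ C) : v ≠ 0 := fun h =>
  hC.zero_notMem (h ▸ hv)

theorem k_pos (hC : IsConeOver C k Ω) {v : Vec n} (hv : v ∈ C) : 0 < k v :=
  hC.pos v (subset_closure hv) (hC.ne_zero hv)

theorem mem_of_mem_cone (hC : IsConeOver C k Ω) {v : Vec n} (hv : v ∈ cone Ω) (h : 0 < k v) :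
    v ∈ C := by
  rcases (hC.mem_cone v).1 hv with h1 | h1
  · exact h1
  · have := hC.k_pos h1
    rw [map_neg] at this
    linarith

theorem neg_notMem_closure (hC : IsConeOver C k Ω) {v : Vec n} (hv0 : v ≠ 0)
    (hv : v ∈ closure C) : -v ∉ closure C := fun h => by
  have h1 := hC.pos v hv hv0
  have h2 := hC.pos _ h (neg_ne_zero.2 hv0)
  rw [map_neg] at h2
  linarith

theorem mem_closure_cone (hC : IsConeOver C k Ω) {v : Vec n} :
    v ∈ closure (cone Ω) ↔ v ∈ closure C ∨ -v ∈ closure C := by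
  have h : cone Ω = C ∪ -C := by
    ext v
    exact hC.mem_cone v
  rw [h, closure_union, ← neg_closure]
  rfl

theorem isOpen_domain (hC : IsConeOver C k Ω) : IsOpen Ω := by
  rw [isOpen_iff_cone]
  have h : cone Ω = C ∪ -C := by
    ext v
    exact hC.mem_cone v
  rw [h]
  exact hC.isOpen.union hC.isOpen.neg

theorem mem_cone_frontier_iff (hC : IsConeOver C k Ω) {v : Vec n} (hv0 : v ≠ 0) :
    v ∈ cone (frontier Ω) ↔ (v ∈ closure C ∧ v ∉ C) ∨ (-v ∈ closure C ∧ -v ∉ C) := by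
  rw [mem_cone_frontier hC.isOpen_domain hv0, hC.mem_closure_cone, hC.mem_cone]
  constructor
  · rintro ⟨h | h, h2⟩
    · exact Or.inl ⟨h, fun h3 => h2 (Or.inl h3)⟩
    · exact Or.inr ⟨h, fun h3 => h2 (Or.inr h3)⟩
  · rintro (⟨h, h2⟩ | ⟨h, h2⟩)
    · refine ⟨Or.inl h, ?_⟩
      rintro (h3 | h3)
      · exact h2 h3
      · exact hC.neg_notMem_closure hv0 h (subset_closure h3)
    · refine ⟨Or.inr h, ?_⟩
      rintro (h3 | h3)
      · exact hC.neg_notMem_closure hv0 (subset_closure h3) h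
      · exact h2 h3

theorem mem_frontier_of_pos (hC : IsConeOver C k Ω) {v : Vec n} (hv : v ∈ cone (frontier Ω))
    (h : 0 < k v) : v ∈ closure C ∧ v ∉ C := by
  rcases (hC.mem_cone_frontier_iff hv.1).1 hv with h1 | h1
  · exact h1
  · have := hC.pos _ h1.1 (neg_ne_zero.2 hv.1)
    rw [map_neg] at this
    linarith

/-- A boundary point of `Ω` is represented by a boundary point of the cone. -/
theorem exists_rep_frontier (hC : IsConeOver C k Ω) {x : PSpace n} (hx : x ∈ frontier Ω) :
    ∃ v ∈ cone {x}, v ∈ closure C ∧ v ∉ C := by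
  have h := (mem_iff_cone (rep_mem_cone x)).1 hx
  rcases (hC.mem_cone_frontier_iff h.1).1 h with h1 | h1
  · exact ⟨_, rep_mem_cone x, h1⟩
  · exact ⟨_, neg_mem_cone_iff.2 (rep_mem_cone x), h1⟩

theorem exists_rep (hC : IsConeOver C k Ω) {x : PSpace n} (hx : x ∈ Ω) :
    ∃ v ∈ cone {x}, v ∈ C := by
  have h := (mem_iff_cone (rep_mem_cone x)).1 hx
  rcases (hC.mem_cone _).1 h with h1 | h1
  · exact ⟨_, rep_mem_cone x, h1⟩
  · exact ⟨_, neg_mem_cone_iff.2 (rep_mem_cone x), h1⟩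

theorem exists_support (hC : IsConeOver C k Ω) {v : Vec n} (hv : v ∈ closure C) (hv' : v ∉ C) :
    ∃ f : Vec n →ₗ[ℝ] ℝ, (∀ u ∈ C, 0 < f u) ∧ f v = 0 := by
  obtain ⟨f, hf, hfv⟩ := hC.exists_functional hC.nonempty hv'
  exact ⟨f, hf, le_antisymm hfv
    (IsOpenConvexCone.functional_nonneg_closure (fun u hu => (hf u hu).le) hv)⟩

/-- A supporting hyperplane meets the closed cone in boundary points only, so two independent
vectors in it would span a boundary segment. -/
theorem support_dependent (hC : IsConeOver C k Ω) (hs : IsStrictlyConvex Ω)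
    {f : Vec n →ₗ[ℝ] ℝ} (hf : ∀ u ∈ C, 0 < f u) {u v : Vec n} (hu : u ∈ closure C)
    (hv : v ∈ closure C) (hfu : f u = 0) (hfv : f v = 0) :
    ¬ LinearIndependent ℝ ![u, v] := by
  intro hli
  refine hs ⟨u, v, hli, fun t ht => ?_⟩
  have hne : (1 - t) • u + t • v ≠ 0 := by
    intro h0
    have := LinearIndependent.pair_iff.1 hli _ _ h0
    linarith [this.1, this.2]
  rw [hC.mem_cone_frontier_iff hne]
  left
  constructor
  · rcases ht.1.eq_or_lt with h | h
    · simpa [← h] using hu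
    · rcases ht.2.eq_or_lt with h' | h'
      · simpa [h'] using hv
      · exact hC.closure_add_mem (hC.closure_smul_mem hu (by linarith)) (hC.closure_smul_mem hv h)
  · intro hmem
    have := hf _ hmem
    simp [hfu, hfv] at this

/-- In the supporting hyperplane at `v`, the closed cone reduces to the half-line of `v`. -/
theorem support_eq_smul (hC : IsConeOver C k Ω) (hs : IsStrictlyConvex Ω)
    {f : Vec n →ₗ[ℝ] ℝ} (hf : ∀ u ∈ C, 0 < f u) {u v : Vec n} (hu : u ∈ closure C)
    (hv : v ∈ closure C) (hfu : f u = 0) (hfv : f v = 0) (hv0 : v ≠ 0) :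
    ∃ r : ℝ, 0 ≤ r ∧ u = r • v := by
  have h := hC.support_dependent hs hf hv hu hfv hfu
  rw [LinearIndependent.pair_iff' hv0] at h
  push Not at h
  obtain ⟨a, rfl⟩ := h
  refine ⟨a, ?_, rfl⟩
  by_contra! ha
  have h1 := hC.closure_smul_mem hu (r := -a⁻¹) (by simpa using ha)
  rw [smul_smul, neg_mul, inv_mul_cancel₀ ha.ne, neg_one_smul] at h1
  exact hC.neg_notMem_closure hv0 hv h1

/-- An automorphism of `Ω` preserves the cone `C` up to sign. -/
theorem exists_sign (hC : IsConeOver C k Ω) {g : SL n} (hg : g ∈ Aut Ω) :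
    ∃ ε : ℝ, (ε = 1 ∨ ε = -1) ∧ ∀ v, v ∈ C ↔ ε • (g • v) ∈ C := by
  have hgc : Continuous fun v : Vec n => k (g • v) :=
    (LinearMap.continuous_of_finiteDimensional
      (k ∘ₗ DistribSMul.toLinearMap ℝ (Vec n) g))
  have hmem : ∀ v ∈ C, g • v ∈ cone Ω := fun v hv =>
    (smul_mem_cone_of_mem_Aut hg).2 ((hC.mem_cone v).2 (Or.inl hv))
  have hne : ∀ v ∈ C, k (g • v) ≠ 0 := by
    intro v hv h0
    rcases (hC.mem_cone _).1 (hmem v hv) with h | h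
    · exact (hC.k_pos h).ne' h0
    · have := hC.k_pos h
      rw [map_neg, h0] at this
      simp at this
  -- The form `k ∘ g` has no zero on the connected set `C`, so its sign is constant; this sign is
  -- `ε`.
  have hpc : IsPreconnected C := hC.convex.isPreconnected
  have hinv : ∀ (ε : ℝ), ε = 1 ∨ ε = -1 → (∀ v ∈ C, ε • (g • v) ∈ C) →
      ∀ v, v ∈ C ↔ ε • (g • v) ∈ C := by
    intro ε hε h v
    refine ⟨h v, fun hv => ?_⟩
    have h1 : g • v ∈ cone Ω := by
      have := (hC.mem_cone _).2 (Or.inl hv)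
      rwa [smul_mem_cone_iff] at this
      rcases hε with rfl | rfl <;> norm_num
    rcases (hC.mem_cone v).1 ((smul_mem_cone_of_mem_Aut hg).1 h1) with h2 | h2
    · exact h2
    · have h3 := h _ h2
      rw [smul_neg, smul_neg] at h3
      exact absurd (subset_closure h3)
        (hC.neg_notMem_closure (hC.ne_zero hv) (subset_closure hv))
  obtain ⟨v₀, hv₀⟩ := hC.nonempty
  rcases lt_or_gt_of_ne (hne v₀ hv₀) with h | h
  · refine ⟨-1, Or.inr rfl, hinv _ (Or.inr rfl) fun v hv => ?_⟩
    rw [neg_one_smul]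
    refine hC.mem_of_mem_cone (neg_mem_cone_iff.2 (hmem v hv)) ?_
    rw [map_neg]
    by_contra! h2
    obtain ⟨w, hw, hw0⟩ := hpc.intermediate_value hv₀ hv hgc.continuousOn
      (show (0 : ℝ) ∈ Icc _ _ from ⟨h.le, by linarith⟩)
    exact hne w hw hw0
  · refine ⟨1, Or.inl rfl, hinv _ (Or.inl rfl) fun v hv => ?_⟩
    rw [one_smul]
    refine hC.mem_of_mem_cone (hmem v hv) ?_
    by_contra! h2
    obtain ⟨w, hw, hw0⟩ := hpc.intermediate_value hv hv₀ hgc.continuousOn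
      (show (0 : ℝ) ∈ Icc _ _ from ⟨h2, h.le⟩)
    exact hne w hw hw0

end IsConeOver


/-! ### Uniqueness of the supporting hyperplane, and the cone seen from a boundary point -/

theorem eventually_pos_of_hasDerivAt {φ : ℝ → ℝ} {d : ℝ} (h : HasDerivAt φ d 0) (h0 : φ 0 = 0)
    (hd : 0 < d) : ∀ᶠ s in 𝓝[>] (0 : ℝ), 0 < φ s := by
  have h1 := h.tendsto_slope_zero_right
  filter_upwards [h1.eventually (lt_mem_nhds hd), self_mem_nhdsWithin] with s hs hs'
  simp only [zero_add, h0, sub_zero, smul_eq_mul] at hs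
  exact pos_of_mul_pos_right hs (inv_pos.2 hs').le

namespace IsConeOver

variable {C : Set (Vec n)} {k : Vec n →ₗ[ℝ] ℝ} {Ω : Set (PSpace n)}

/-- A supporting form vanishes on the tangent space `ker dF`. If `dF w = 0` and `f w < 0`, move from
`v` by a small multiple of `w + θ u` with `|θ| ≤ ε`: `F` changes sign between `θ = -ε` and `θ = ε`,
so it vanishes in between at a boundary point where `f` is negative, which is absurd. -/
theorem support_eq_zero_of_fderiv (hC : IsConeOver C k Ω) {v : Vec n} (hv : v ∈ closure C)
    (hv0 : v ≠ 0) {U : Set (Vec n)} {F : Vec n → ℝ} (hU : IsOpen U) (hvU : v ∈ U)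
    (hF : ContDiffOn ℝ 1 F U) (hFd : fderiv ℝ F v ≠ 0) (hFv : F v = 0)
    (hUF : ∀ w ∈ U, F w = 0 → w ∈ cone (frontier Ω))
    {f : Vec n →ₗ[ℝ] ℝ} (hf : ∀ u ∈ C, 0 < f u) (hfv : f v = 0)
    {u w : Vec n} (hu : fderiv ℝ F v u = 1) (hw : fderiv ℝ F v w = 0) : f w = 0 := by
  wlog hlt : f w < 0 generalizing w
  · by_contra hne
    have h1 : 0 < f w := lt_of_le_of_ne (not_lt.1 hlt) (Ne.symm hne)
    refine hne ?_
    have := this (w := -w) (by rw [map_neg, hw, neg_zero]) (by rw [map_neg]; linarith)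
    simpa using this
  exfalso
  have hd : HasFDerivAt F (fderiv ℝ F v) v := by
    by_contra h
    exact hFd (fderiv_zero_of_not_differentiableAt fun h' => h h'.hasFDerivAt)
  -- `ε` is small enough for `f` to stay negative on the whole segment of directions `w + θ u`.
  obtain ⟨ε, hε, hneg⟩ : ∃ ε : ℝ, 0 < ε ∧ ∀ θ ∈ Icc (-ε) ε, f w + θ * f u < 0 := by
    refine ⟨-f w / (2 * (|f u| + 1)), by have := abs_nonneg (f u); apply div_pos <;> linarith, ?_⟩
    intro θ hθ
    have h1 : |θ * f u| ≤ -f w / (2 * (|f u| + 1)) * |f u| := by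
      rw [abs_mul]
      exact mul_le_mul_of_nonneg_right (abs_le.2 hθ) (abs_nonneg _)
    have h2 : -f w / (2 * (|f u| + 1)) * |f u| ≤ -f w / 2 := by
      rw [div_mul_eq_mul_div, div_le_div_iff₀ (by positivity) (by norm_num)]
      nlinarith [abs_nonneg (f u)]
    linarith [le_abs_self (θ * f u)]
  have hline : ∀ z, HasDerivAt (fun s : ℝ => F (v + s • z)) (fderiv ℝ F v z) 0 := by
    intro z
    have h1 : HasDerivAt (fun s : ℝ => v + s • z) z 0 := by
      simpa using ((hasDerivAt_id (0 : ℝ)).smul_const z).const_add v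
    have h2 : HasFDerivAt F (fderiv ℝ F v) (v + (0 : ℝ) • z) := by simpa using hd
    exact h2.comp_hasDerivAt (0 : ℝ) h1
  have hp := eventually_pos_of_hasDerivAt (hline (w + ε • u)) (by simpa using hFv)
    (by simpa [hw, hu] using hε)
  have hm := eventually_pos_of_hasDerivAt (φ := fun s => -F (v + s • (w - ε • u)))
    (hline (w - ε • u)).neg (by simpa using hFv) (by simpa [hw, hu] using hε)
  have hkc : Continuous k := LinearMap.continuous_of_finiteDimensional k
  have hU' : IsOpen (U ∩ {w | 0 < k w}) := hU.inter (isOpen_lt continuous_const hkc)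
  obtain ⟨δ, hδ, hball⟩ := Metric.isOpen_iff.1 hU' v ⟨hvU, hC.pos v hv hv0⟩
  have hsmall : ∀ᶠ s in 𝓝[>] (0 : ℝ), s * (‖w‖ + ε * ‖u‖) < δ := by
    have : Tendsto (fun s : ℝ => s * (‖w‖ + ε * ‖u‖)) (𝓝[>] 0) (𝓝 (0 * (‖w‖ + ε * ‖u‖))) :=
      (tendsto_id.mono_left nhdsWithin_le_nhds).mul_const _
    rw [zero_mul] at this
    exact this.eventually (gt_mem_nhds hδ)
  obtain ⟨s, ⟨hs1, hs2⟩, hs3, hs0⟩ :=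
    ((hp.and hm).and (hsmall.and self_mem_nhdsWithin)).exists
  replace hs0 : 0 < s := hs0
  have hin : ∀ θ ∈ Icc (-ε) ε, v + s • (w + θ • u) ∈ U ∩ {w | 0 < k w} := by
    intro θ hθ
    refine hball ?_
    rw [mem_ball_iff_norm, add_sub_cancel_left, norm_smul, Real.norm_of_nonneg hs0.le]
    refine lt_of_le_of_lt (mul_le_mul_of_nonneg_left ?_ hs0.le) hs3
    refine (norm_add_le _ _).trans ?_
    rw [norm_smul]
    gcongr
    exact abs_le.2 hθ
  have hcont : ContinuousOn (fun θ : ℝ => F (v + s • (w + θ • u))) (Icc (-ε) ε) := by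
    refine hF.continuousOn.comp (by fun_prop) fun θ hθ => (hin θ hθ).1
  have hIVT := intermediate_value_Icc (by linarith : -ε ≤ ε) hcont
  obtain ⟨θ, hθ, h0⟩ := hIVT (show (0 : ℝ) ∈ Icc _ _ from
    ⟨by rw [neg_smul, ← sub_eq_add_neg]; linarith, hs1.le⟩)
  have h1 := hUF _ (hin θ hθ).1 h0
  have h2 := (hC.mem_frontier_of_pos h1 (hin θ hθ).2).1
  have h3 := IsOpenConvexCone.functional_nonneg_closure (fun u hu => (hf u hu).le) h2
  rw [map_add, hfv, map_smul, map_add, map_smul, smul_eq_mul, smul_eq_mul, zero_add] at h3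
  have := mul_neg_of_pos_of_neg hs0 (hneg θ hθ)
  linarith

/-- At each of its points, a `C¹` boundary has a single supporting hyperplane. -/
theorem support_unique (hC : IsConeOver C k Ω) (hC1 : HasC1Boundary Ω) {v : Vec n}
    (hv : v ∈ closure C) (hv' : v ∉ C) (hv0 : v ≠ 0)
    {f₁ f₂ : Vec n →ₗ[ℝ] ℝ} (hf₁ : ∀ u ∈ C, 0 < f₁ u) (hf₁v : f₁ v = 0)
    (hf₂ : ∀ u ∈ C, 0 < f₂ u) (hf₂v : f₂ v = 0) : ∃ c : ℝ, 0 < c ∧ ∀ w, f₂ w = c * f₁ w := by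
  have hvf : v ∈ cone (frontier Ω) := (hC.mem_cone_frontier_iff hv0).2 (Or.inl ⟨hv, hv'⟩)
  obtain ⟨U, F, hU, hvU, hF, hFd, hUF⟩ := hC1 v hvf
  obtain ⟨u, hu⟩ : ∃ u, fderiv ℝ F v u = 1 := by
    obtain ⟨u, hu⟩ : ∃ u, fderiv ℝ F v u ≠ 0 := by
      by_contra! h
      exact hFd (ContinuousLinearMap.ext h)
    exact ⟨(fderiv ℝ F v u)⁻¹ • u, by simp [hu]⟩
  -- The vector `w - dF(w) u` lies in `ker dF`, so every supporting form at `v` is a multiple of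
  -- `dF`.
  have key : ∀ f : Vec n →ₗ[ℝ] ℝ, (∀ u ∈ C, 0 < f u) → f v = 0 →
      ∀ w, f w = fderiv ℝ F v w * f u := by
    intro f hf hfv w
    have h := hC.support_eq_zero_of_fderiv hv hv0 hU hvU hF hFd ((hUF v hvU).1 hvf)
      (fun w hw h => (hUF w hw).2 h) hf hfv (w := w - (fderiv ℝ F v w) • u) hu (by simp [hu])
    rw [map_sub, map_smul, smul_eq_mul] at h
    linarith
  have h1 := key f₁ hf₁ hf₁v
  have h2 := key f₂ hf₂ hf₂v
  obtain ⟨z, hz⟩ := hC.nonempty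
  have h1z := hf₁ z hz
  have h2z := hf₂ z hz
  refine ⟨f₂ z / f₁ z, by positivity, fun w => ?_⟩
  have hne : fderiv ℝ F v z * f₁ u ≠ 0 := by rw [← h1]; exact h1z.ne'
  rw [h1 z, h2 z, h1 w, h2 w]
  field_simp [left_ne_zero_of_mul hne, right_ne_zero_of_mul hne]

/-- Every projective line through the boundary point `p` that is not tangent meets the domain. -/
theorem exists_add_smul_mem_of_support_pos (hC : IsConeOver C k Ω) (hC1 : HasC1Boundary Ω)
    {p : Vec n} (hp : p ∈ closure C) (hp' : p ∉ C) (hp0 : p ≠ 0)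
    {f : Vec n →ₗ[ℝ] ℝ} (hf : ∀ u ∈ C, 0 < f u) (hfp : f p = 0) {v : Vec n} (hv : 0 < f v) :
    ∃ τ : ℝ, v + τ • p ∈ C := by
  -- `D` is the sum of `C` and the line of `p`. A form separating a vector from `D` must vanish at
  -- `p`, so it is another supporting form at `p`, hence a positive multiple of `f`.
  set D : Set (Vec n) := {v | ∃ τ : ℝ, v + τ • p ∈ C} with hD
  have hDC : IsOpenConvexCone D := by
    refine ⟨?_, ?_, ?_⟩
    · have : D = ⋃ τ : ℝ, (fun v => v + τ • p) ⁻¹' C := by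
        ext v
        simp [hD]
      rw [this]
      exact isOpen_iUnion fun τ => hC.isOpen.preimage (by fun_prop)
    · rintro v ⟨τ, h⟩ r hr
      refine ⟨r * τ, ?_⟩
      rw [mul_smul, ← smul_add]
      exact hC.smul_mem _ h r hr
    · rintro u ⟨τ, h⟩ v ⟨σ, h'⟩
      refine ⟨τ + σ, ?_⟩
      have := hC.add_mem _ h _ h'
      rwa [show u + v + (τ + σ) • p = u + τ • p + (v + σ • p) by rw [add_smul]; abel]
  by_contra hcon
  obtain ⟨z, hz⟩ := hC.nonempty
  have hsub : ∀ u ∈ C, ∀ τ : ℝ, u + τ • p ∈ D := fun u hu τ => ⟨-τ, by simpa using hu⟩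
  obtain ⟨h, hh, hhv⟩ := hDC.exists_functional ⟨z, by simpa using hsub z hz 0⟩ hcon
  have hhp : h p = 0 := by
    by_contra hne
    have := hh _ (hsub z hz (-(h z) / h p))
    rw [map_add, map_smul, smul_eq_mul, div_mul_cancel₀ _ hne] at this
    linarith
  obtain ⟨c, hc, hcf⟩ := hC.support_unique hC1 hp hp' hp0 hf hfp
    (fun u hu => by simpa using hh _ (hsub u hu 0)) hhp
  rw [hcf] at hhv
  have := mul_pos hc hv
  linarith

/-- A linear form that is positive at `p` becomes nonnegative on the cone after adding a multiple
of the supporting form at `p`. -/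
theorem exists_add_mul_support_nonneg (hC : IsConeOver C k Ω) (hs : IsStrictlyConvex Ω)
    {p : Vec n} (hp : p ∈ closure C) (hp0 : p ≠ 0)
    {f : Vec n →ₗ[ℝ] ℝ} (hf : ∀ u ∈ C, 0 < f u) (hfp : f p = 0)
    (θ : Vec n →ₗ[ℝ] ℝ) (hθ : 0 < θ p) : ∃ c : ℝ, ∀ v ∈ closure C, 0 ≤ θ v + c * f v := by
  have hθc : Continuous θ := LinearMap.continuous_of_finiteDimensional θ
  have hfc : Continuous f := LinearMap.continuous_of_finiteDimensional f
  have hf0 : ∀ v ∈ closure C, 0 ≤ f v := fun v hv =>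
    IsOpenConvexCone.functional_nonneg_closure (fun u hu => (hf u hu).le) hv
  have hK : IsCompact (closure C ∩ Metric.sphere (0 : Vec n) 1) :=
    (isCompact_sphere 0 1).inter_left isClosed_closure
  -- Where `θ ≤ 0` on the unit sphere of the closed cone, `f` does not vanish, since its zeros are
  -- positive multiples of `p`; compactness bounds it below.
  have hK0 : IsCompact ((closure C ∩ Metric.sphere (0 : Vec n) 1) ∩ {v | θ v ≤ 0}) :=
    hK.inter_right (isClosed_le hθc continuous_const)
  have hpos : ∀ v ∈ (closure C ∩ Metric.sphere (0 : Vec n) 1) ∩ {v | θ v ≤ 0}, 0 < f v := by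
    rintro v ⟨⟨hv, hv1⟩, hv2⟩
    refine lt_of_le_of_ne (hf0 v hv) fun h0 => ?_
    obtain ⟨r, hr, rfl⟩ := hC.support_eq_smul hs hf hv hp h0.symm hfp hp0
    have hr0 : r ≠ 0 := by
      rintro rfl
      simp at hv1
    have : 0 < r * θ p := mul_pos (lt_of_le_of_ne hr hr0.symm) hθ
    simp only [mem_ofPred_eq, map_smul, smul_eq_mul] at hv2
    linarith
  obtain ⟨δ, hδ, hδK⟩ := hK0.exists_forall_le' (f := f) hfc.continuousOn hpos
  obtain ⟨B, hB⟩ : ∃ B, ∀ v ∈ closure C ∩ Metric.sphere (0 : Vec n) 1, B ≤ θ v := by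
    obtain ⟨B, hB⟩ := (hK.image hθc).isBounded.bddBelow
    exact ⟨B, fun v hv => hB (mem_image_of_mem θ hv)⟩
  have key : ∀ v ∈ closure C ∩ Metric.sphere (0 : Vec n) 1, 0 ≤ θ v + (|B| / δ) * f v := by
    intro v hv
    rcases le_or_gt (θ v) 0 with h | h
    · have h1 := hδK v ⟨hv, h⟩
      have h2 : |B| ≤ |B| / δ * f v := by
        rw [div_mul_eq_mul_div, le_div_iff₀ hδ]
        exact mul_le_mul_of_nonneg_left h1 (abs_nonneg _)
      have h3 := hB v hv
      linarith [neg_abs_le B]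
    · have := hf0 v hv.1
      positivity
  refine ⟨|B| / δ, fun v hv => ?_⟩
  rcases eq_or_ne v 0 with rfl | hv0
  · simp
  · have hn : 0 < ‖v‖ := norm_pos_iff.2 hv0
    have h1 := key (‖v‖⁻¹ • v) ⟨hC.closure_smul_mem hv (inv_pos.2 hn), by
      simp [norm_smul, hn.ne']⟩
    rw [map_smul, map_smul, smul_eq_mul, smul_eq_mul] at h1
    have h2 : 0 ≤ ‖v‖⁻¹ * (θ v + |B| / δ * f v) := by linarith
    exact nonneg_of_mul_nonneg_right h2 (inv_pos.2 hn)

end IsConeOver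


/-! ### Orbits of triangular affine maps -/

theorem exists_quadratic_lt (A B C K : ℝ) (hC : C < 0) : ∃ n : ℕ, A + B * n + C * n ^ 2 < K := by
  obtain ⟨n, hn⟩ := exists_nat_gt ((|A - K| + |B|) / (-C) + 1)
  refine ⟨n, ?_⟩
  have h1 : (1 : ℝ) < n := by
    have : 0 ≤ (|A - K| + |B|) / (-C) :=
      div_nonneg (by positivity) (by linarith)
    linarith
  have h2 : |A - K| + |B| < -C * n := by
    have h3 : (|A - K| + |B|) / (-C) < n := by linarith
    rw [div_lt_iff₀ (by linarith)] at h3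
    linarith
  have h3 : (|A - K| + |B|) * n ≤ -C * n * n := by nlinarith
  have h4 : |A - K| ≤ |A - K| * n := le_mul_of_one_le_right (abs_nonneg _) h1.le
  have h5 : B * n ≤ |B| * n := by gcongr; exact le_abs_self B
  have h6 : (|A - K| + |B|) * n < -C * n * n := by nlinarith
  nlinarith [le_abs_self (A - K)]

theorem exists_cubic_lt (A B C D K : ℝ) (hD : D < 0) :
    ∃ n : ℕ, A + B * n + C * n ^ 2 + D * n ^ 3 < K := by
  obtain ⟨n, hn⟩ := exists_nat_gt ((|A - K| + |B| + |C|) / (-D) + 1)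
  refine ⟨n, ?_⟩
  have h1 : (1 : ℝ) < n := by
    have : 0 ≤ (|A - K| + |B| + |C|) / (-D) :=
      div_nonneg (by positivity) (by linarith)
    linarith
  have h2 : |A - K| + |B| + |C| < -D * n := by
    have h3 : (|A - K| + |B| + |C|) / (-D) < n := by linarith
    rw [div_lt_iff₀ (by linarith)] at h3
    linarith
  have hn2 : (n : ℝ) ≤ n ^ 2 := by nlinarith
  have h3 : (|A - K| + |B| + |C|) * n ^ 2 < -D * n * n ^ 2 := by gcongr
  have h4 : |A - K| * 1 ≤ |A - K| * n ^ 2 := by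
    gcongr
    linarith
  have h5 : B * n ≤ |B| * n ^ 2 := by
    have : B * n ≤ |B| * n := by gcongr; exact le_abs_self B
    have : |B| * n ≤ |B| * n ^ 2 := by gcongr
    linarith
  have h6 : C * n ^ 2 ≤ |C| * n ^ 2 := by gcongr; exact le_abs_self C
  nlinarith [le_abs_self (A - K)]

theorem exists_quadratic_sub_pow_lt (A B C K : ℝ) {ν : ℝ} (hν : 1 < ν) :
    ∃ n : ℕ, A + B * n + C * n ^ 2 - ν ^ n < K := by
  have h0 := tendsto_pow_const_div_const_pow_of_one_lt 0 hν
  have h1 := tendsto_pow_const_div_const_pow_of_one_lt 1 hν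
  have h2 := tendsto_pow_const_div_const_pow_of_one_lt 2 hν
  have h := ((h0.const_mul (A - K)).add (h1.const_mul B)).add (h2.const_mul C)
  simp only [mul_zero, add_zero] at h
  obtain ⟨n, hn⟩ := (h.eventually (gt_mem_nhds one_pos)).exists
  refine ⟨n, ?_⟩
  have hp : 0 < ν ^ n := by positivity
  have : ((A - K) * (n : ℝ) ^ 0 + B * n ^ 1 + C * n ^ 2) / ν ^ n < 1 := by
    calc _ = (A - K) * ((n : ℝ) ^ 0 / ν ^ n) + B * ((n : ℝ) ^ 1 / ν ^ n)
          + C * ((n : ℝ) ^ 2 / ν ^ n) := by ring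
      _ < 1 := hn
  rw [div_lt_one hp] at this
  simp only [pow_zero, pow_one, mul_one] at this
  linarith

/-- Every orbit of `(t, w, y) ↦ (a t + α w + δ y + c, w + β, ν y + s w + b)` above a given point
`(w₀, y₀)` is, for a suitable `t₀`, such that `t` grows faster than every linear function. -/
def SuperlinearOrbits (a α δ c β ν s b : ℝ) : Prop :=
  ∀ w₀ y₀ : ℝ, ∃ t w y : ℕ → ℝ, w 0 = w₀ ∧ y 0 = y₀ ∧ (∀ n, w (n + 1) = w n + β) ∧
    (∀ n, y (n + 1) = ν * y n + s * w n + b) ∧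
    (∀ n, t (n + 1) = a * t n + α * w n + δ * y n + c) ∧
    ∀ M₁ M₂ : ℝ, ∃ K, ∀ n, K ≤ t n - M₁ * w n - M₂ * y n

namespace SuperlinearOrbits

variable {a α δ c β ν s b : ℝ}

theorem arith_progression {w : ℕ → ℝ} (h : ∀ n, w (n + 1) = w n + β) (n : ℕ) :
    w n = w 0 + n * β := by
  induction n with
  | zero => simp
  | succ k ih => rw [h, ih]; push_cast; ring

theorem geom_progression {z : ℕ → ℝ} (h : ∀ n, z (n + 1) = a * z n) (n : ℕ) :
    z n = a ^ n * z 0 := by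
  induction n with
  | zero => simp
  | succ k ih => rw [h, ih]; ring

/-- If `a < 1`, some affine combination of `t, w, y` is multiplied by `a` at each step and stays
bounded along a suitable orbit. Then `t` is at most affine in `w, y` while `w` tends to infinity
linearly, against superlinear growth. -/
theorem not_lt_one_left (H : SuperlinearOrbits a α δ c β ν s b) (ha : 0 < a) (hβ : β ≠ 0) :
    ¬ a < 1 := by
  intro ha1
  have fin : ∀ (t w y : ℕ → ℝ) (m k κ : ℝ), (∀ n, w (n + 1) = w n + β) →
      (∀ n, t (n + 1) + m * w (n + 1) + k * y (n + 1) + κ = a * (t n + m * w n + k * y n + κ)) →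
      (∀ M₁ M₂ : ℝ, ∃ K, ∀ n, K ≤ t n - M₁ * w n - M₂ * y n) → False := by
    intro t w y m k κ hw ht hK
    -- The slope is shifted by `β` because `-β w n` decreases like `-n β ^ 2`, whatever the sign of
    -- `β`.
    obtain ⟨K, hK⟩ := hK (-m + β) (-k)
    have h1 := geom_progression (z := fun n => t n + m * w n + k * y n + κ) ht
    have h2 := arith_progression hw
    have hβ2 : 0 < β ^ 2 := by positivity
    set Z := t 0 + m * w 0 + k * y 0 + κ with hZ
    obtain ⟨n, hn⟩ := exists_nat_gt ((|Z| - κ - β * w 0 - K) / β ^ 2)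
    rw [div_lt_iff₀ hβ2] at hn
    have h3 := hK n
    have h4 : t n + m * w n + k * y n + κ ≤ |Z| := by
      rw [h1 n]
      calc a ^ n * Z ≤ a ^ n * |Z| := by gcongr; exact le_abs_self Z
        _ ≤ 1 * |Z| := by gcongr; exact pow_le_one₀ ha.le ha1.le
        _ = |Z| := one_mul _
    have h5 : β * w n = β * w 0 + n * β ^ 2 := by rw [h2 n]; ring
    nlinarith
  have ha' : (1 - a) ≠ 0 := by linarith
  rcases eq_or_ne ν 1 with rfl | hν
  · obtain ⟨t, w, y, -, -, hw, hy, ht, hK⟩ := H 0 0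
    -- The constants `k`, `m`, `κ` solve the triangular system that makes `t + m w + k y + κ` an
    -- eigenfunction for `a`.
    set k := -δ / (1 - a) with hk
    set m := (-α - k * s) / (1 - a) with hm
    set κ := (-c - m * β - k * b) / (1 - a) with hκ
    have ek : k * (1 - a) = -δ := div_mul_cancel₀ _ ha'
    have em : m * (1 - a) = -α - k * s := div_mul_cancel₀ _ ha'
    have eκ : κ * (1 - a) = -c - m * β - k * b := div_mul_cancel₀ _ ha'
    refine fin t w y m k κ hw (fun n => ?_) hK
    rw [ht, hw, hy]
    linear_combination (y n) * ek + (w n) * em + eκ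
  · have hν' : ν - 1 ≠ 0 := sub_ne_zero.2 hν
    set σ := s / (ν - 1) with hσ
    set γ := (b + σ * β) / (ν - 1) with hγ
    have eσ : σ * (ν - 1) = s := div_mul_cancel₀ _ hν'
    have eγ : γ * (ν - 1) = b + σ * β := div_mul_cancel₀ _ hν'
    -- The combination `y + σ w + γ` is multiplied by `ν`; starting at `y = -γ`, `w = 0` keeps it
    -- zero, so `y` is an affine function of `w` on this orbit.
    obtain ⟨t, w, y, hw0, hy0, hw, hy, ht, hK⟩ := H 0 (-γ)
    have hz : ∀ n, y n = -σ * w n - γ := by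
      intro n
      have := geom_progression (a := ν) (z := fun n => y n + σ * w n + γ) (fun n => by
        rw [hw, hy]
        linear_combination (-w n) * eσ - eγ) n
      simp only [hw0, hy0] at this
      linarith
    set m := -(α - δ * σ) / (1 - a) with hm
    set κ := (-(c - δ * γ) - m * β) / (1 - a) with hκ
    have em : m * (1 - a) = -(α - δ * σ) := div_mul_cancel₀ _ ha'
    have eκ : κ * (1 - a) = -(c - δ * γ) - m * β := div_mul_cancel₀ _ ha'
    refine fin t w y m 0 κ hw (fun n => ?_) hK
    rw [ht, hw, hz]
    linear_combination (w n) * em + eκ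

/-- If `ν > 1`, both `y` and `t` are multiples of `ν ^ n` up to polynomials in `n`. Subtracting a
suitable multiple of `y` from `t` leaves `-ν ^ n` plus a quadratic polynomial, which is not bounded
below. -/
theorem not_one_lt (H : SuperlinearOrbits 1 α δ c β ν s b) : ¬ 1 < ν := by
  intro hν
  have hν' : ν - 1 ≠ 0 := by linarith
  set σ := s / (ν - 1) with hσ
  set γ := (b + σ * β) / (ν - 1) with hγ
  set ρ := δ / (ν - 1) with hρ
  have eσ : σ * (ν - 1) = s := div_mul_cancel₀ _ hν'
  have eγ : γ * (ν - 1) = b + σ * β := div_mul_cancel₀ _ hν'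
  have eρ : ρ * (ν - 1) = δ := div_mul_cancel₀ _ hν'
  obtain ⟨t, w, y, hw0, hy0, hw, hy, ht, hK⟩ := H 0 (1 - γ)
  have hwn := arith_progression hw
  have hz : ∀ n, y n = ν ^ n - σ * w n - γ := by
    intro n
    have := geom_progression (a := ν) (z := fun n => y n + σ * w n + γ) (fun n => by
      rw [hw, hy]
      linear_combination (-w n) * eσ - eγ) n
    simp only [hw0, hy0] at this
    linear_combination this
  have htn : ∀ n : ℕ, t n = t 0 - ρ + ρ * ν ^ n + (α - δ * σ) * β * (n * (n - 1) / 2)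
      + (c - δ * γ) * n := by
    intro n
    induction n with
    | zero => simp
    | succ k ih =>
      rw [ht, ih, hz, hwn, hw0]
      push_cast
      linear_combination (-(ν ^ k)) * eρ
  obtain ⟨K, hK⟩ := hK 0 (ρ + 1)
  obtain ⟨n, hn⟩ := exists_quadratic_sub_pow_lt (t 0 - ρ + (ρ + 1) * γ)
    (-((α - δ * σ) * β) / 2 + (c - δ * γ) + (ρ + 1) * σ * β) ((α - δ * σ) * β / 2) K hν
  have := hK n
  rw [htn, hz, hwn, hw0] at this
  linarith

theorem closed_form {t w y : ℕ → ℝ} (hw0 : w 0 = 0) (hy0 : y 0 = 0)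
    (hw : ∀ n, w (n + 1) = w n + β) (hy : ∀ n, y (n + 1) = 1 * y n + s * w n + b)
    (ht : ∀ n, t (n + 1) = 1 * t n + α * w n + δ * y n + c) (n : ℕ) :
    w n = n * β ∧ y n = n * b + s * β * (n * (n - 1) / 2) ∧
      t n = t 0 + n * c + (α * β + δ * b) * (n * (n - 1) / 2)
        + δ * s * β * (n * (n - 1) * (n - 2) / 6) := by
  induction n with
  | zero => simp [hw0, hy0]
  | succ k ih =>
    obtain ⟨h1, h2, h3⟩ := ih
    rw [hw, hy, ht, h3, h2, h1]
    push_cast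
    refine ⟨by ring, by ring, by ring⟩

/-- The height along the orbit is a polynomial in `n` with cubic coefficient `δ s β / 6`, and it is
bounded below. -/
theorem cubic_nonneg (H : SuperlinearOrbits 1 α δ c β 1 s b) : 0 ≤ δ * s * β := by
  by_contra! hneg
  obtain ⟨t, w, y, hw0, hy0, hw, hy, ht, hK⟩ := H 0 0
  obtain ⟨K, hK⟩ := hK 0 0
  have hcl := closed_form hw0 hy0 hw hy ht
  obtain ⟨n, hn⟩ := exists_cubic_lt (t 0) (c - (α * β + δ * b) / 2 + δ * s * β / 3)
    ((α * β + δ * b) / 2 - δ * s * β / 2) (δ * s * β / 6) K (by linarith)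
  have := hK n
  rw [(hcl n).2.2] at this
  linarith

/-- Without cubic term, `t` and `y` are both quadratic when `s ≠ 0`, so a multiple of `y` outgrows
`t`. The constant `M` is chosen to leave the leading coefficient `-1 / 2`. -/
theorem eq_zero_of_cubic (H : SuperlinearOrbits 1 α δ c β 1 s b) (hβ : β ≠ 0)
    (h0 : δ * s * β = 0) : s = 0 := by
  by_contra hs
  obtain ⟨t, w, y, hw0, hy0, hw, hy, ht, hK⟩ := H 0 0
  have hcl := closed_form hw0 hy0 hw hy ht
  set M := (α * β + δ * b + 1) / (s * β) with hM
  have eM : M * (s * β) = α * β + δ * b + 1 := div_mul_cancel₀ _ (mul_ne_zero hs hβ)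
  obtain ⟨K, hK⟩ := hK 0 M
  obtain ⟨n, hn⟩ := exists_quadratic_lt (t 0) (c + 1 / 2 - M * b) (-1 / 2) K (by norm_num)
  have := hK n
  rw [(hcl n).2.2, (hcl n).2.1, h0] at this
  have e2 : M * (n * b + s * β * (n * (n - 1) / 2))
      = M * n * b + (α * β + δ * b + 1) * (n * (n - 1) / 2) := by rw [← eM]; ring
  rw [e2] at this
  linarith

end SuperlinearOrbits

/-! ### Cusps -/

/-- The properties of the cone `C` over a strictly convex domain with `C¹` boundary, seen from the
boundary point `p` where the supporting form is `f`. -/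
structure IsCusp (C : Set (Vec n)) (p : Vec n) (f : Vec n →ₗ[ℝ] ℝ) : Prop where
  pos : ∀ v ∈ C, 0 < f v
  map_p : f p = 0
  full : ∀ v, 0 < f v → ∃ τ : ℝ, v + τ • p ∈ C
  superlinear : ∀ θ : Vec n →ₗ[ℝ] ℝ, 0 < θ p → ∃ c : ℝ, ∀ v ∈ C, 0 ≤ θ v + c * f v

/-- In the coordinates `t, w, y, f`, the linear map `T` is triangular, with diagonal
`a, ν, 1, 1`. -/
structure IsTriangular (T : Vec n ≃ₗ[ℝ] Vec n) (t w y f : Vec n →ₗ[ℝ] ℝ)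
    (a α δ c β ν s b : ℝ) : Prop where
  map_f : ∀ v, f (T v) = f v
  map_w : ∀ v, w (T v) = w v + β * f v
  map_y : ∀ v, y (T v) = ν * y v + s * w v + b * f v
  map_t : ∀ v, t (T v) = a * t v + α * w v + δ * y v + c * f v

theorem IsTriangular.symm {T : Vec n ≃ₗ[ℝ] Vec n} {t w y f : Vec n →ₗ[ℝ] ℝ}
    {a α δ c β ν s b : ℝ} (h : IsTriangular T t w y f a α δ c β ν s b) (ha : a ≠ 0) (hν : ν ≠ 0) :
    IsTriangular T.symm t w y f a⁻¹ (-a⁻¹ * (α - δ * ν⁻¹ * s)) (-a⁻¹ * δ * ν⁻¹)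
      (-a⁻¹ * (c - α * β + δ * ν⁻¹ * (s * β - b))) (-β) ν⁻¹ (-ν⁻¹ * s) (ν⁻¹ * (s * β - b)) := by
  have e : ∀ v, T (T.symm v) = v := T.apply_symm_apply
  have hf : ∀ v, f (T.symm v) = f v := fun v => by rw [← h.map_f, e]
  have hw : ∀ v, w (T.symm v) = w v + -β * f v := fun v => by
    have := h.map_w (T.symm v)
    rw [e, hf] at this
    linarith
  have hy : ∀ v, y (T.symm v) = ν⁻¹ * y v + -ν⁻¹ * s * w v + ν⁻¹ * (s * β - b) * f v := fun v => by
    have := h.map_y (T.symm v)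
    rw [e, hf, hw] at this
    rw [this]
    field_simp
    ring
  refine ⟨hf, hw, hy, fun v => ?_⟩
  have := h.map_t (T.symm v)
  rw [e, hf, hw, hy] at this
  rw [this]
  field_simp
  ring

/-- By `full`, any point of the plane lifts to a vector of `C` with `f = 1`. Its orbit stays in `C`,
and `superlinear` bounds the height from below. -/
theorem IsCusp.superlinearOrbits {C : Set (Vec n)} {p : Vec n} {f : Vec n →ₗ[ℝ] ℝ}
    (hC : IsCusp C p f) {T : Vec n ≃ₗ[ℝ] Vec n} {t w y : Vec n →ₗ[ℝ] ℝ}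
    {a α δ c β ν s b : ℝ} (h : IsTriangular T t w y f a α δ c β ν s b)
    (hT : ∀ v ∈ C, T v ∈ C) (ht : 0 < t p) (hw : w p = 0) (hy : y p = 0)
    (hcoord : ∀ w₀ y₀ : ℝ, ∃ v, f v = 1 ∧ w v = w₀ ∧ y v = y₀) :
    SuperlinearOrbits a α δ c β ν s b := by
  intro w₀ y₀
  obtain ⟨v, hfv, hwv, hyv⟩ := hcoord w₀ y₀
  obtain ⟨τ, hτ⟩ := hC.full v (by rw [hfv]; exact one_pos)
  set u : ℕ → Vec n := fun n => T^[n] (v + τ • p) with hu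
  have hu1 : ∀ n, u (n + 1) = T (u n) := fun n => Function.iterate_succ_apply' _ _ _
  have hf : ∀ n, f (u n) = 1 := by
    intro n
    induction n with
    | zero => simp [hu, hC.map_p, hfv]
    | succ k ih => rw [hu1, h.map_f, ih]
  have hmem : ∀ n, u n ∈ C := by
    intro n
    induction n with
    | zero => exact hτ
    | succ k ih => rw [hu1]; exact hT _ ih
  refine ⟨fun n => t (u n), fun n => w (u n), fun n => y (u n), ?_, ?_, ?_, ?_, ?_, ?_⟩
  · simp [hu, hw, hwv]
  · simp [hu, hy, hyv]
  · intro n; simp only [hu1, h.map_w, hf, mul_one]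
  · intro n; simp only [hu1, h.map_y, hf, mul_one]
  · intro n; simp only [hu1, h.map_t, hf, mul_one]
  · intro M₁ M₂
    obtain ⟨c, hc⟩ := hC.superlinear (t - M₁ • w - M₂ • y) (by simp [hw, hy, ht])
    refine ⟨-c, fun n => ?_⟩
    have := hc _ (hmem n)
    simp only [LinearMap.sub_apply, LinearMap.smul_apply, smul_eq_mul, hf, mul_one] at this
    linarith

/-- A triangular automorphism of a cusp that translates the coordinate `w` is unipotent and acts on
the coordinates `w`, `y` as a translation. -/
theorem IsCusp.triangular {C : Set (Vec n)} {p : Vec n} {f : Vec n →ₗ[ℝ] ℝ}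
    (hC : IsCusp C p f) {T : Vec n ≃ₗ[ℝ] Vec n} {t w y : Vec n →ₗ[ℝ] ℝ}
    {a α δ c β ν s b : ℝ} (h : IsTriangular T t w y f a α δ c β ν s b)
    (hT : ∀ v ∈ C, T v ∈ C) (hT' : ∀ v ∈ C, T.symm v ∈ C)
    (ht : 0 < t p) (hw : w p = 0) (hy : y p = 0)
    (hcoord : ∀ w₀ y₀ : ℝ, ∃ v, f v = 1 ∧ w v = w₀ ∧ y v = y₀)
    (ha : 0 < a) (hν : 0 < ν) (hβ : β ≠ 0) : a = 1 ∧ ν = 1 ∧ s = 0 := by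
  have h1 := hC.superlinearOrbits h hT ht hw hy hcoord
  have h2 := hC.superlinearOrbits (h.symm ha.ne' hν.ne') hT' ht hw hy hcoord
  have ha1 : a = 1 := by
    have h3 := h1.not_lt_one_left ha hβ
    have h4 := h2.not_lt_one_left (inv_pos.2 ha) (neg_ne_zero.2 hβ)
    refine le_antisymm ?_ (not_lt.1 h3)
    by_contra! hlt
    exact h4 (inv_lt_one_of_one_lt₀ hlt)
  subst ha1
  rw [inv_one] at h2
  have hν1 : ν = 1 := by
    have h3 := h1.not_one_lt
    have h4 := h2.not_one_lt
    refine le_antisymm (not_lt.1 h3) ?_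
    by_contra! hlt
    exact h4 ((one_lt_inv₀ hν).2 hlt)
  subst hν1
  rw [inv_one] at h2
  refine ⟨rfl, rfl, h1.eq_zero_of_cubic hβ (le_antisymm ?_ h1.cubic_nonneg)⟩
  -- For `a = ν = 1`, the inverse has `δ`, `s`, `β` all negated, so its cubic coefficient is
  -- opposite.
  have := h2.cubic_nonneg
  linarith


/-! ### Automorphisms of a cusp in `ℙ³` -/

/-- The Fredholm alternative in dimension two: an unsolvable system is detected by a vector of the
left kernel that is not orthogonal to the right-hand side. -/
theorem exists_left_eigenvector {N : Matrix (Fin 2) (Fin 2) ℝ} {b₁ b₂ : ℝ}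
    (h : ¬ ∃ x y : ℝ, N 0 0 * x + N 0 1 * y + b₁ = 0 ∧ N 1 0 * x + N 1 1 * y + b₂ = 0) :
    ∃ w₁ w₂ : ℝ, w₁ * N 0 0 + w₂ * N 1 0 = 0 ∧ w₁ * N 0 1 + w₂ * N 1 1 = 0 ∧
      w₁ * b₁ + w₂ * b₂ ≠ 0 := by
  by_contra! hcon
  have hdet : N 0 0 * N 1 1 - N 0 1 * N 1 0 = 0 := by
    by_contra hd
    refine h ⟨(N 0 1 * b₂ - N 1 1 * b₁) / (N 0 0 * N 1 1 - N 0 1 * N 1 0),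
      (N 1 0 * b₁ - N 0 0 * b₂) / (N 0 0 * N 1 1 - N 0 1 * N 1 0), ?_, ?_⟩
    all_goals
      rw [mul_div_assoc', mul_div_assoc', ← add_div, div_add' _ _ _ hd, div_eq_zero_iff]
      left
      ring
  have h1 := hcon (N 1 1) (-N 0 1) (by linarith) (by ring)
  have h2 := hcon (-N 1 0) (N 0 0) (by ring) (by linarith)
  by_cases e00 : N 0 0 = 0
  · by_cases e01 : N 0 1 = 0
    · by_cases e10 : N 1 0 = 0
      · by_cases e11 : N 1 1 = 0
        · have h3 := hcon b₁ b₂ (by simp [e00, e10]) (by simp [e01, e11])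
          have hb1 : b₁ = 0 := by nlinarith
          have hb2 : b₂ = 0 := by nlinarith
          exact h ⟨0, 0, by simp [hb1], by simp [hb2]⟩
        · refine h ⟨0, -b₂ / N 1 1, ?_, ?_⟩
          · have : b₁ = 0 := by simpa [e01, e11] using h1
            simp [e01, this]
          · field_simp
            ring
      · refine h ⟨-b₂ / N 1 0, 0, ?_, ?_⟩
        · have : b₁ = 0 := by simpa [e00, e10] using h2
          simp [e00, this]
        · field_simp
          ring
    · refine h ⟨0, -b₁ / N 0 1, ?_, ?_⟩
      · field_simp
        ring
      · field_simp
        linarith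
  · refine h ⟨-b₁ / N 0 0, 0, ?_, ?_⟩
    · field_simp
      ring
    · field_simp
      linarith

/-- For determinant `1`, squaring changes the trace `τ` into `τ ^ 2 - 2`. Starting from `|τ| > 2`,
iterated squaring makes the traces unbounded. -/
theorem abs_trace_le_two_of_bounded (B : ℝ) : ∀ A : Matrix (Fin 2) (Fin 2) ℝ, A.det = 1 →
    (∀ n : ℕ, |(A ^ n).trace| ≤ B) → |A.trace| ≤ 2 := by
  intro A hA hB
  by_contra! h
  have hsq : ∀ M : Matrix (Fin 2) (Fin 2) ℝ, M.det = 1 → (M ^ 2).trace = M.trace ^ 2 - 2 := by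
    intro M hM
    rw [Matrix.det_fin_two] at hM
    simp only [pow_two, Matrix.trace_fin_two, Matrix.mul_apply, Fin.sum_univ_two]
    linear_combination (-2) * hM
  have key : ∀ k : ℕ, 2 + (k : ℝ) * (|A.trace| - 2) ≤ |(A ^ 2 ^ k).trace| := by
    intro k
    induction k with
    | zero => simp [h.le]
    | succ k ih =>
      have h1 : (A ^ 2 ^ k).det = 1 := by rw [Matrix.det_pow, hA, one_pow]
      rw [pow_succ, pow_mul, hsq _ h1]
      have hmono : ∀ k : ℕ, |A.trace| ≤ |(A ^ 2 ^ k).trace| := by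
        intro k
        induction k with
        | zero => simp
        | succ k ih =>
          have h1 : (A ^ 2 ^ k).det = 1 := by rw [Matrix.det_pow, hA, one_pow]
          rw [pow_succ, pow_mul, hsq _ h1]
          refine le_trans ?_ (le_abs_self _)
          rw [← sq_abs (A ^ 2 ^ k).trace]
          nlinarith
      have h2 := hmono k
      refine le_trans ?_ (le_abs_self _)
      rw [← sq_abs (A ^ 2 ^ k).trace]
      push_cast
      nlinarith
  obtain ⟨k, hk⟩ := exists_nat_gt (B / (|A.trace| - 2))
  rw [div_lt_iff₀ (by linarith)] at hk
  linarith [key k, hB (2 ^ k)]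

/-- By Cayley–Hamilton `A - 1` has square zero, so `A ^ n = 1 + n (A - 1)` is bounded only if `A =
1`. -/
theorem eq_one_of_bounded {A : Matrix (Fin 2) (Fin 2) ℝ} (hA : A.det = 1) (ht : A.trace = 2)
    {B : ℝ} (hB : ∀ (n : ℕ) i j, |(A ^ n) i j| ≤ B) : A = 1 := by
  have hsq : (A - 1) * (A - 1) = 0 := by
    rw [Matrix.det_fin_two] at hA
    rw [Matrix.trace_fin_two] at ht
    ext i j
    fin_cases i <;> fin_cases j <;>
      simp [Matrix.mul_apply, Matrix.sub_apply]
    · linear_combination (A 0 0) * ht - hA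
    · linear_combination (A 0 1) * ht
    · linear_combination (A 1 0) * ht
    · linear_combination (A 1 1) * ht - hA
  have hpow : ∀ n : ℕ, A ^ n = 1 + (n : ℝ) • (A - 1) := by
    intro n
    induction n with
    | zero => simp
    | succ k ih =>
      have : A = 1 + (A - 1) := by abel
      rw [pow_succ, ih]
      conv_lhs => rw [this]
      rw [add_mul, mul_add, mul_add, one_mul, one_mul, smul_mul_assoc, smul_mul_assoc]
      rw [add_sub_cancel, hsq]
      push_cast
      rw [add_smul]
      simp
      abel
  have h0 : A - 1 = 0 := by
    ext i j
    by_contra hne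
    replace hne : (A - 1) i j ≠ 0 := hne
    have hpos : 0 < |(A - 1) i j| := abs_pos.2 hne
    obtain ⟨n, hn⟩ := exists_nat_gt ((B + 1) / |(A - 1) i j|)
    rw [div_lt_iff₀ hpos] at hn
    have h1 := hB n i j
    rw [hpow, Matrix.add_apply, Matrix.smul_apply, smul_eq_mul] at h1
    have h2 : |(n : ℝ) * (A - 1) i j| = n * |(A - 1) i j| := by
      rw [abs_mul, Nat.abs_cast]
    have h3 : |(1 : Matrix (Fin 2) (Fin 2) ℝ) i j| ≤ 1 := by
      fin_cases i <;> fin_cases j <;> simp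
    have h4 := abs_sub_abs_le_abs_add ((n : ℝ) * (A - 1) i j) ((1 : Matrix (Fin 2) (Fin 2) ℝ) i j)
    rw [add_comm ((n : ℝ) * (A - 1) i j)] at h4
    linarith
  exact sub_eq_zero.1 h0

/-- The linear automorphisms of a cusp, normalized so that they preserve the form `f`. -/
structure IsCuspAut (C : Set (Vec 3)) (p : Vec 3) (f : Vec 3 →ₗ[ℝ] ℝ) (T : Vec 3 ≃ₗ[ℝ] Vec 3) :
    Prop where
  map_mem : ∀ v ∈ C, T v ∈ C
  symm_mem : ∀ v ∈ C, T.symm v ∈ C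
  map_f : ∀ v, f (T v) = f v
  map_p : ∃ a : ℝ, 0 < a ∧ T p = a • p
  det_pos : 0 < LinearMap.det (T : Vec 3 →ₗ[ℝ] Vec 3)

namespace IsCuspAut

variable {C : Set (Vec 3)} {p : Vec 3} {f : Vec 3 →ₗ[ℝ] ℝ} {T S : Vec 3 ≃ₗ[ℝ] Vec 3}

theorem one : IsCuspAut C p f 1 :=
  ⟨fun _ h => h, fun _ h => h, fun _ => rfl, ⟨1, one_pos, by simp⟩, by
    rw [show ((1 : Vec 3 ≃ₗ[ℝ] Vec 3) : Vec 3 →ₗ[ℝ] Vec 3) = LinearMap.id from rfl]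
    simp⟩

theorem mul (hT : IsCuspAut C p f T) (hS : IsCuspAut C p f S) : IsCuspAut C p f (T * S) := by
  refine ⟨fun v hv => hT.map_mem _ (hS.map_mem _ hv), fun v hv => hS.symm_mem _ (hT.symm_mem _ hv),
    fun v => (hT.map_f _).trans (hS.map_f _), ?_, ?_⟩
  · obtain ⟨a, ha, h⟩ := hT.map_p
    obtain ⟨b, hb, h'⟩ := hS.map_p
    exact ⟨b * a, mul_pos hb ha, by rw [LinearEquiv.mul_apply, h', map_smul, h, mul_smul]⟩
  · rw [show ((T * S : Vec 3 ≃ₗ[ℝ] Vec 3) : Vec 3 →ₗ[ℝ] Vec 3) = T.toLinearMap ∘ₗ S.toLinearMap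
      from rfl, LinearMap.det_comp]
    exact mul_pos hT.det_pos hS.det_pos

theorem symm (hT : IsCuspAut C p f T) : IsCuspAut C p f T.symm := by
  refine ⟨hT.symm_mem, hT.map_mem, fun v => ?_, ?_, ?_⟩
  · rw [← hT.map_f, T.apply_symm_apply]
  · obtain ⟨a, ha, h⟩ := hT.map_p
    refine ⟨a⁻¹, inv_pos.2 ha, ?_⟩
    rw [LinearEquiv.symm_apply_eq, map_smul, h, smul_smul, inv_mul_cancel₀ ha.ne', one_smul]
  · have h : LinearMap.det T.symm.toLinearMap * LinearMap.det T.toLinearMap = 1 :=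
      LinearEquiv.det_symm_mul_det T
    exact pos_of_mul_pos_left (by rw [h]; exact one_pos) hT.det_pos.le

theorem inv (hT : IsCuspAut C p f T) : IsCuspAut C p f T⁻¹ := hT.symm

theorem pow (hT : IsCuspAut C p f T) (n : ℕ) : IsCuspAut C p f (T ^ n) := by
  induction n with
  | zero => exact one
  | succ k ih => rw [pow_succ]; exact ih.mul hT

end IsCuspAut

/-- The matrix of `T` in the basis `b`. -/
abbrev mat (b : Module.Basis (Fin 4) ℝ (Vec 3)) (T : Vec 3 ≃ₗ[ℝ] Vec 3) :
    Matrix (Fin 4) (Fin 4) ℝ :=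
  LinearMap.toMatrix b b (T : Vec 3 →ₗ[ℝ] Vec 3)

/-- The linear part of the action of `T` on the lines through the first vector of `b`. -/
def linPart (b : Module.Basis (Fin 4) ℝ (Vec 3)) (T : Vec 3 ≃ₗ[ℝ] Vec 3) :
    Matrix (Fin 2) (Fin 2) ℝ :=
  !![mat b T 1 1, mat b T 1 2; mat b T 2 1, mat b T 2 2]

/-- Bases adapted to a cusp: the first vector is `p` and the last coordinate is `f`. -/
structure IsCuspBasis (p : Vec 3) (f : Vec 3 →ₗ[ℝ] ℝ) (b : Module.Basis (Fin 4) ℝ (Vec 3)) :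
    Prop where
  zero : b 0 = p
  coord : ∀ v, b.repr v 3 = f v

theorem repr_apply_eq (b : Module.Basis (Fin 4) ℝ (Vec 3)) (T : Vec 3 ≃ₗ[ℝ] Vec 3) (v : Vec 3)
    (i : Fin 4) : b.repr (T v) i = mat b T i 0 * b.repr v 0 + mat b T i 1 * b.repr v 1
      + mat b T i 2 * b.repr v 2 + mat b T i 3 * b.repr v 3 := by
  have := congrFun (LinearMap.toMatrix_mulVec_repr b b (T : Vec 3 →ₗ[ℝ] Vec 3) v) i
  rw [LinearEquiv.coe_coe] at this
  rw [← this, Matrix.mulVec, dotProduct, Fin.sum_univ_four]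

namespace IsCuspAut

variable {C : Set (Vec 3)} {p : Vec 3} {f : Vec 3 →ₗ[ℝ] ℝ} {T S : Vec 3 ≃ₗ[ℝ] Vec 3}
  {b : Module.Basis (Fin 4) ℝ (Vec 3)}

theorem mat_zero (hT : IsCuspAut C p f T) (hb : IsCuspBasis p f b) :
    mat b T 1 0 = 0 ∧ mat b T 2 0 = 0 ∧ mat b T 3 0 = 0 ∧ 0 < mat b T 0 0 ∧
      T p = mat b T 0 0 • p := by
  obtain ⟨a, ha, h⟩ := hT.map_p
  have h1 : ∀ i, mat b T i 0 = b.repr (a • b 0) i := fun i => by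
    rw [mat, LinearMap.toMatrix_apply, LinearEquiv.coe_coe, hb.zero, h]
  have h2 : mat b T 0 0 = a := by rw [h1]; simp
  refine ⟨?_, ?_, ?_, by rw [h2]; exact ha, by rw [h2]; exact h⟩
  all_goals rw [h1]; simp

theorem mat_three (hT : IsCuspAut C p f T) (hb : IsCuspBasis p f b) :
    mat b T 3 1 = 0 ∧ mat b T 3 2 = 0 ∧ mat b T 3 3 = 1 := by
  have h1 : ∀ j, mat b T 3 j = b.repr (b j) 3 := fun i => by
    rw [mat, LinearMap.toMatrix_apply, LinearEquiv.coe_coe, hb.coord, hb.coord, hT.map_f]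
  refine ⟨?_, ?_, ?_⟩
  all_goals rw [h1]; simp

theorem repr_zero (hb : IsCuspBasis p f b) (v : Vec 3) :
    b.repr (T v) 0 = mat b T 0 0 * b.repr v 0 + mat b T 0 1 * b.repr v 1
      + mat b T 0 2 * b.repr v 2 + mat b T 0 3 * f v := by
  rw [repr_apply_eq, hb.coord]

theorem repr_one (hT : IsCuspAut C p f T) (hb : IsCuspBasis p f b) (v : Vec 3) :
    b.repr (T v) 1 = mat b T 1 1 * b.repr v 1 + mat b T 1 2 * b.repr v 2 + mat b T 1 3 * f v := by
  rw [repr_apply_eq, hb.coord, (hT.mat_zero hb).1]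
  ring

theorem repr_two (hT : IsCuspAut C p f T) (hb : IsCuspBasis p f b) (v : Vec 3) :
    b.repr (T v) 2 = mat b T 2 1 * b.repr v 1 + mat b T 2 2 * b.repr v 2 + mat b T 2 3 * f v := by
  rw [repr_apply_eq, hb.coord, (hT.mat_zero hb).2.1]
  ring

theorem mat_mul (b : Module.Basis (Fin 4) ℝ (Vec 3)) (T S : Vec 3 ≃ₗ[ℝ] Vec 3) :
    mat b (T * S) = mat b T * mat b S :=
  LinearMap.toMatrix_mul b T.toLinearMap S.toLinearMap

theorem linPart_mul (hT : IsCuspAut C p f T) (hS : IsCuspAut C p f S) (hb : IsCuspBasis p f b) :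
    linPart b (T * S) = linPart b T * linPart b S := by
  obtain ⟨h1, h2, -, -⟩ := hT.mat_zero hb
  obtain ⟨h3, h4, -⟩ := hS.mat_three hb
  unfold linPart
  rw [mat_mul]
  ext i j
  fin_cases i <;> fin_cases j <;>
    simp [Matrix.mul_apply, Fin.sum_univ_four, h1, h2, h3, h4]

theorem mat_one (b : Module.Basis (Fin 4) ℝ (Vec 3)) : mat b 1 = 1 :=
  LinearMap.toMatrix_one b

theorem linPart_one (b : Module.Basis (Fin 4) ℝ (Vec 3)) : linPart b 1 = 1 := by
  unfold linPart
  rw [mat_one]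
  ext i j
  fin_cases i <;> fin_cases j <;> simp

theorem linPart_pow (hT : IsCuspAut C p f T) (hb : IsCuspBasis p f b) (n : ℕ) :
    linPart b (T ^ n) = linPart b T ^ n := by
  induction n with
  | zero => simp [linPart_one]
  | succ k ih => rw [pow_succ, (hT.pow k).linPart_mul hT hb, ih, pow_succ]

theorem linPart_mul_symm (hT : IsCuspAut C p f T) (hb : IsCuspBasis p f b) :
    linPart b T * linPart b T.symm = 1 := by
  rw [← hT.linPart_mul hT.symm hb, ← linPart_one b]
  congr 1
  exact mul_inv_cancel T

/-- The matrix of `T` is block triangular with diagonal blocks `a`, `linPart b T` and `1`. -/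
theorem det_eq (hT : IsCuspAut C p f T) (hb : IsCuspBasis p f b) :
    LinearMap.det (T : Vec 3 →ₗ[ℝ] Vec 3) = mat b T 0 0 * (linPart b T).det := by
  obtain ⟨h1, h2, h3, -⟩ := hT.mat_zero hb
  obtain ⟨h4, h5, h6⟩ := hT.mat_three hb
  rw [← LinearMap.det_toMatrix b, Matrix.det_succ_column_zero, Fin.sum_univ_four]
  have e1 : LinearMap.toMatrix b b (T : Vec 3 →ₗ[ℝ] Vec 3) 1 0 = 0 := h1
  have e2 : LinearMap.toMatrix b b (T : Vec 3 →ₗ[ℝ] Vec 3) 2 0 = 0 := h2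
  have e3 : LinearMap.toMatrix b b (T : Vec 3 →ₗ[ℝ] Vec 3) 3 0 = 0 := h3
  rw [e1, e2, e3, Matrix.det_fin_three]
  have s1 : (1 : Fin 3).succ = (2 : Fin 4) := rfl
  have s2 : (2 : Fin 3).succ = (3 : Fin 4) := rfl
  simp only [Matrix.submatrix_apply, Fin.zero_succAbove, Fin.succ_zero_eq_one, s1, s2]
  unfold linPart
  change mat b T 3 1 = 0 at h4
  simp only [mat] at h4 h5 h6 ⊢
  rw [h4, h5, h6, Matrix.det_fin_two]
  simp

theorem linPart_det_pos (hT : IsCuspAut C p f T) (hb : IsCuspBasis p f b) :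
    0 < (linPart b T).det := by
  have h := hT.det_pos
  rw [hT.det_eq hb] at h
  exact pos_of_mul_pos_right h (hT.mat_zero hb).2.2.2.1.le

/-- If `T` fixes no line through `p`, then it is unipotent and acts on these lines by a
translation. -/
theorem of_fixes_no_line (hC : IsCusp C p f) (hT : IsCuspAut C p f T) (hb : IsCuspBasis p f b)
    (h : ∀ u, f u = 1 → ∀ κ : ℝ, T u ≠ u + κ • p) :
    mat b T 0 0 = 1 ∧ linPart b T = 1 := by
  -- A fixed point of the affine map of the plane would be a fixed line through `p`.
  have hA : ¬ ∃ x y : ℝ, (linPart b T - 1) 0 0 * x + (linPart b T - 1) 0 1 * y + mat b T 1 3 = 0 ∧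
      (linPart b T - 1) 1 0 * x + (linPart b T - 1) 1 1 * y + mat b T 2 3 = 0 := by
    rintro ⟨x, y, h1, h2⟩
    simp only [linPart, Matrix.sub_apply, Matrix.of_apply, Matrix.cons_val', Matrix.cons_val_zero,
      Matrix.cons_val_one, Matrix.cons_val_fin_one, Matrix.one_apply_eq, ne_eq, zero_ne_one,
      not_false_eq_true, Matrix.one_apply_ne, sub_zero, one_ne_zero] at h1 h2
    set u : Vec 3 := x • b 1 + y • b 2 + b 3 with hu
    have hfu : f u = 1 := by rw [← hb.coord]; simp [hu]
    refine h u hfu (b.repr (T u) 0) ?_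
    rw [← hb.zero]
    apply b.ext_elem
    intro i
    have e0 : b.repr u 0 = 0 := by simp [hu]
    have e1 : b.repr u 1 = x := by simp [hu]
    have e2 : b.repr u 2 = y := by simp [hu]
    rw [b.repr.map_add, b.repr.map_smul, Finsupp.add_apply, Finsupp.smul_apply, b.repr_self]
    fin_cases i
    · simp [e0]
    · simp only [Fin.mk_one, hT.repr_one hb, e1, e2, hfu]
      simp
      linarith
    · simp only [Fin.reduceFinMk, hT.repr_two hb, e1, e2, hfu]
      simp
      linarith
    · simp only [Fin.reduceFinMk, hb.coord, hT.map_f, hfu]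
      simp
  -- The form `w = w₁ x + w₂ z` is invariant under the linear part and is translated by a nonzero
  -- amount. With the orthogonal coordinate `y = -w₂ x + w₁ z`, `T` becomes triangular.
  obtain ⟨w₁, w₂, h1, h2, h3⟩ := exists_left_eigenvector hA
  simp only [linPart, Matrix.sub_apply, Matrix.of_apply, Matrix.cons_val', Matrix.cons_val_zero,
      Matrix.cons_val_one, Matrix.cons_val_fin_one, Matrix.one_apply_eq, ne_eq, zero_ne_one,
      not_false_eq_true, Matrix.one_apply_ne, sub_zero, one_ne_zero] at h1 h2
  have hdet := hT.linPart_det_pos hb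
  rw [Matrix.det_fin_two] at hdet
  simp only [linPart, Matrix.of_apply, Matrix.cons_val', Matrix.cons_val_zero,
      Matrix.cons_val_one, Matrix.cons_val_fin_one] at hdet
  set A₁ := mat b T 1 1
  set A₂ := mat b T 1 2
  set A₃ := mat b T 2 1
  set A₄ := mat b T 2 2
  have hD : 0 < w₁ ^ 2 + w₂ ^ 2 := by
    by_contra! hle
    have e1 : w₁ = 0 := by nlinarith [sq_nonneg w₁, sq_nonneg w₂]
    have e2 : w₂ = 0 := by nlinarith [sq_nonneg w₁, sq_nonneg w₂]
    simp [e1, e2] at h3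
  set D := w₁ ^ 2 + w₂ ^ 2 with hDdef
  set x : Vec 3 →ₗ[ℝ] ℝ := b.coord 1 with hx
  set z : Vec 3 →ₗ[ℝ] ℝ := b.coord 2 with hz
  set ν := ((-w₂ * A₁ + w₁ * A₃) * (-w₂) + (-w₂ * A₂ + w₁ * A₄) * w₁) / D with hν
  set s := ((-w₂ * A₁ + w₁ * A₃) * w₁ + (-w₂ * A₂ + w₁ * A₄) * w₂) / D with hs
  have eν : ν * D = (-w₂ * A₁ + w₁ * A₃) * (-w₂) + (-w₂ * A₂ + w₁ * A₄) * w₁ :=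
    div_mul_cancel₀ _ hD.ne'
  have es : s * D = (-w₂ * A₁ + w₁ * A₃) * w₁ + (-w₂ * A₂ + w₁ * A₄) * w₂ :=
    div_mul_cancel₀ _ hD.ne'
  have ey1 : -w₂ * A₁ + w₁ * A₃ = -ν * w₂ + s * w₁ := by
    refine mul_right_cancel₀ hD.ne' ?_
    linear_combination (-w₁) * es + w₂ * eν +
      (-w₂ * A₁ + w₁ * A₃) * hDdef
  have ey2 : -w₂ * A₂ + w₁ * A₄ = ν * w₁ + s * w₂ := by
    refine mul_right_cancel₀ hD.ne' ?_
    linear_combination (-w₂) * es - w₁ * eν +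
      (-w₂ * A₂ + w₁ * A₄) * hDdef
  -- The other eigenvalue of the linear part is `1`, so `ν` is its determinant, which is positive.
  have edet : A₁ * A₄ - A₂ * A₃ = ν := by
    refine mul_right_cancel₀ hD.ne' ?_
    rw [eν]
    linear_combination (A₁ * A₄ - A₂ * A₃) * hDdef + (w₁ * A₄ - w₂ * A₂) * h1
      - (w₁ * A₃ - w₂ * A₁) * h2
  have hνpos : 0 < ν := by rw [← edet]; exact hdet
  set w : Vec 3 →ₗ[ℝ] ℝ := w₁ • x + w₂ • z with hw
  set y : Vec 3 →ₗ[ℝ] ℝ := (-w₂) • x + w₁ • z with hy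
  set Δ := mat b T 0 1 with hΔ
  set E := mat b T 0 2 with hE
  have htri : IsTriangular T (b.coord 0) w y f (mat b T 0 0) ((Δ * w₁ + E * w₂) / D)
      ((-Δ * w₂ + E * w₁) / D) (mat b T 0 3) (w₁ * mat b T 1 3 + w₂ * mat b T 2 3) ν s
      (-w₂ * mat b T 1 3 + w₁ * mat b T 2 3) := by
    refine ⟨hT.map_f, fun v => ?_, fun v => ?_, fun v => ?_⟩
    · simp only [hw, hx, hz, LinearMap.add_apply, LinearMap.smul_apply, smul_eq_mul,
        Module.Basis.coord_apply, hT.repr_one hb, hT.repr_two hb]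
      linear_combination (b.repr v 1) * h1 + (b.repr v 2) * h2
    · simp only [hw, hy, hx, hz, LinearMap.add_apply, LinearMap.smul_apply, smul_eq_mul,
        Module.Basis.coord_apply, hT.repr_one hb, hT.repr_two hb]
      linear_combination (b.repr v 1) * ey1 + (b.repr v 2) * ey2
    · simp only [hw, hy, hx, hz, LinearMap.add_apply, LinearMap.smul_apply, smul_eq_mul,
        Module.Basis.coord_apply, repr_zero hb]
      field_simp
      rw [hDdef]
      ring
  have hp : ∀ i, i ≠ 0 → b.repr p i = 0 := by
    intro i hi
    rw [← hb.zero, b.repr_self, Finsupp.single_eq_of_ne hi]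
  obtain ⟨r1, r2, r3⟩ := hC.triangular htri hT.map_mem hT.symm_mem
    (by rw [Module.Basis.coord_apply, ← hb.zero]; simp)
    (by simp [hw, hx, hz, hp]) (by simp [hy, hx, hz, hp]) (fun w₀ y₀ => by
      refine ⟨((w₁ * w₀ - w₂ * y₀) / D) • b 1 + ((w₂ * w₀ + w₁ * y₀) / D) • b 2 + b 3, ?_, ?_, ?_⟩
      · rw [← hb.coord]; simp
      · simp [hw, hx, hz]
        field_simp
        rw [hDdef]
        ring
      · simp [hy, hx, hz]
        field_simp
        rw [hDdef]
        ring) (hT.mat_zero hb).2.2.2.1 hνpos h3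
  refine ⟨r1, ?_⟩
  rw [r2, r3] at ey1 ey2
  have c1 : A₁ = 1 := by
    have : (A₁ - 1) * D = 0 := by
      linear_combination w₁ * h1 - w₂ * ey1 + (A₁ - 1) * hDdef
    rcases mul_eq_zero.1 this with h | h
    · linarith
    · exact absurd h hD.ne'
  have c2 : A₂ = 0 := by
    have : A₂ * D = 0 := by
      linear_combination w₁ * h2 - w₂ * ey2 + A₂ * hDdef
    rcases mul_eq_zero.1 this with h | h
    · linarith
    · exact absurd h hD.ne'
  have c3 : A₃ = 0 := by
    have : A₃ * D = 0 := by
      linear_combination w₂ * h1 + w₁ * ey1 + A₃ * hDdef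
    rcases mul_eq_zero.1 this with h | h
    · linarith
    · exact absurd h hD.ne'
  have c4 : A₄ = 1 := by
    have : (A₄ - 1) * D = 0 := by
      linear_combination w₂ * h2 + w₁ * ey2 + (A₄ - 1) * hDdef
    rcases mul_eq_zero.1 this with h | h
    · linarith
    · exact absurd h hD.ne'
  ext i j
  fin_cases i <;> fin_cases j <;> simp [linPart, c1, c2, c3, c4, A₁, A₂, A₃, A₄]

end IsCuspAut


/-! ### Automorphisms of a cusp that fix a line through the cusp point -/

namespace IsCuspAut

variable {C : Set (Vec 3)} {p : Vec 3} {f : Vec 3 →ₗ[ℝ] ℝ} {T S : Vec 3 ≃ₗ[ℝ] Vec 3}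
  {b : Module.Basis (Fin 4) ℝ (Vec 3)}

/-- On an invariant line, `T` is a translation by `κ` preserving the trace of `C`, which is bounded
below in the direction of `p`; it cannot move points downwards. -/
theorem translation_nonneg (hC : IsCusp C p f) (hT : ∀ v ∈ C, T v ∈ C)
    (hb : IsCuspBasis p f b) (hp : T p = p) {u : Vec 3} (hu : f u = 1) {κ : ℝ}
    (h : T u = u + κ • p) : 0 ≤ κ := by
  have hbp : b.coord 0 p = 1 := by rw [← hb.zero, Module.Basis.coord_apply]; simp
  obtain ⟨c, hc⟩ := hC.superlinear (b.coord 0) (by rw [hbp]; exact one_pos)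
  obtain ⟨τ, hτ⟩ := hC.full u (by rw [hu]; exact one_pos)
  have horb : ∀ n : ℕ, u + (τ + n * κ) • p ∈ C := by
    intro n
    induction n with
    | zero => simpa using hτ
    | succ k ih =>
      have := hT _ ih
      rw [map_add, map_smul, hp, h, add_assoc, ← add_smul] at this
      convert this using 3
      push_cast
      ring
  by_contra! hneg
  obtain ⟨n, hn⟩ := exists_nat_gt ((b.coord 0 u + τ + c) / (-κ))
  rw [div_lt_iff₀ (by linarith)] at hn
  have := hc _ (horb n)
  rw [map_add, map_smul, hbp, map_add, map_smul, hC.map_p, hu] at this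
  simp only [smul_eq_mul] at this
  linarith

/-- A unipotent automorphism of a cusp fixes pointwise the lines that it fixes. -/
theorem fixed_of_fixes_line (hC : IsCusp C p f) (hT : IsCuspAut C p f T)
    (hb : IsCuspBasis p f b) (ha : mat b T 0 0 = 1) {u : Vec 3} (hu : f u = 1) {κ : ℝ}
    (h : T u = u + κ • p) : T u = u := by
  have hp : T p = p := by
    rw [(hT.mat_zero hb).2.2.2.2, ha, one_smul]
  have hp' : T.symm p = p := by rw [LinearEquiv.symm_apply_eq, hp]
  have h1 := translation_nonneg hC hT.map_mem hb hp hu h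
  have h2 := translation_nonneg (T := T.symm) (κ := -κ) hC hT.symm_mem hb hp' hu (by
    rw [LinearEquiv.symm_apply_eq, map_add, map_smul, hp, h]
    simp)
  have : κ = 0 := by linarith
  rw [h, this, zero_smul, add_zero]

/-- A non-unipotent automorphism of a cusp fixes a second point on each line that it fixes. -/
theorem exists_fixed_of_fixes_line (hT : IsCuspAut C p f T)
    (hb : IsCuspBasis p f b) (hfp : f p = 0) (ha : mat b T 0 0 ≠ 1) {u : Vec 3} (hu : f u = 1)
    {κ : ℝ} (h : T u = u + κ • p) : ∃ u', f u' = 1 ∧ T u' = u' := by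
  have hp : T p = mat b T 0 0 • p := (hT.mat_zero hb).2.2.2.2
  have ha' : 1 - mat b T 0 0 ≠ 0 := sub_ne_zero.2 ha.symm
  refine ⟨u + (κ / (1 - mat b T 0 0)) • p, by simp [hu, hfp], ?_⟩
  rw [map_add, map_smul, hp, h, add_assoc, smul_smul, ← add_smul]
  congr 2
  field_simp
  ring

theorem pow_apply_fixed {u : Vec 3} (h : T u = u) (n : ℕ) : (T ^ n) u = u := by
  induction n with
  | zero => rfl
  | succ k ih => rw [pow_succ', LinearEquiv.mul_apply, ih, h]

/-- Lift the point above `u + x` to a vector `u + x + τ p` of `C`. Its iterates are `u + T ^ n x + τ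
p`, on which `superlinear` bounds `θ` below. -/
theorem exists_le_of_fixed (hC : IsCusp C p f) (hT : IsCuspAut C p f T) (hp : T p = p)
    {u : Vec 3} (hu : f u = 1) (hfix : T u = u) (θ : Vec 3 →ₗ[ℝ] ℝ) (hθ : 0 < θ p) {x : Vec 3}
    (hx : f x = 0) : ∃ B, ∀ n : ℕ, B ≤ θ ((T ^ n) x) := by
  obtain ⟨c, hc⟩ := hC.superlinear θ hθ
  obtain ⟨τ, hτ⟩ := hC.full (u + x) (by rw [map_add, hu, hx]; norm_num)
  refine ⟨-(c + θ u + τ * θ p), fun n => ?_⟩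
  have := hc _ ((hT.pow n).map_mem _ hτ)
  rw [(hT.pow n).map_f, (T ^ n).map_add, (T ^ n).map_add, (T ^ n).map_smul, pow_apply_fixed hfix, pow_apply_fixed hp] at this
  simp only [map_add, map_smul, hu, hx, hC.map_p, smul_eq_mul] at this
  linarith

/-- The orbits of a unipotent automorphism that fixes a line are bounded. -/
theorem exists_abs_le_of_fixed (hC : IsCusp C p f) (hT : IsCuspAut C p f T)
    (hb : IsCuspBasis p f b) (hp : T p = p)
    {u : Vec 3} (hu : f u = 1) (hfix : T u = u) (ξ : Vec 3 →ₗ[ℝ] ℝ) (hξ : ξ p = 0) {x : Vec 3}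
    (hx : f x = 0) : ∃ B, ∀ n : ℕ, |ξ ((T ^ n) x)| ≤ B := by
  have hbp : b.coord 0 p = 1 := by rw [← hb.zero, Module.Basis.coord_apply]; simp
  have hx' : f (-x) = 0 := by rw [map_neg, hx, neg_zero]
  have h0 : 0 < b.coord 0 p := by rw [hbp]; exact one_pos
  have h1 : 0 < (b.coord 0 - ξ) p := by rw [LinearMap.sub_apply, hbp, hξ]; norm_num
  -- Lower bounds for `x` and `-x` give two-sided bounds for the height coordinate and for its
  -- difference with `ξ`, hence for `ξ`.
  obtain ⟨B₁, hB₁⟩ := hT.exists_le_of_fixed hC hp hu hfix (b.coord 0) h0 hx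
  obtain ⟨B₂, hB₂⟩ := hT.exists_le_of_fixed hC hp hu hfix (b.coord 0) h0 hx'
  obtain ⟨B₃, hB₃⟩ := hT.exists_le_of_fixed hC hp hu hfix _ h1 hx
  obtain ⟨B₄, hB₄⟩ := hT.exists_le_of_fixed hC hp hu hfix _ h1 hx'
  refine ⟨|B₁| + |B₂| + |B₃| + |B₄|, fun n => ?_⟩
  have k1 := hB₁ n
  have k2 := hB₂ n
  have k3 := hB₃ n
  have k4 := hB₄ n
  simp only [map_neg, LinearMap.sub_apply] at k1 k2 k3 k4
  rw [abs_le]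
  constructor <;>
  linarith [neg_abs_le B₁, neg_abs_le B₂, neg_abs_le B₃, neg_abs_le B₄, abs_nonneg B₁,
    abs_nonneg B₂, abs_nonneg B₃, abs_nonneg B₄]

theorem exists_linPart_pow_le (hC : IsCusp C p f) (hT : IsCuspAut C p f T)
    (hb : IsCuspBasis p f b) (hp : T p = p)
    {u : Vec 3} (hu : f u = 1) (hfix : T u = u) :
    ∃ B, ∀ (n : ℕ) i j, |(linPart b T ^ n) i j| ≤ B := by
  have hbp : ∀ i, i ≠ 0 → b.coord i p = 0 := by
    intro i hi
    rw [← hb.zero, Module.Basis.coord_apply, b.repr_self, Finsupp.single_eq_of_ne hi]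
  have hfb : ∀ j, j ≠ 3 → f (b j) = 0 := by
    intro j hj
    rw [← hb.coord, b.repr_self, Finsupp.single_eq_of_ne hj.symm]
  have key : ∀ i j, i ≠ 0 → j ≠ 3 → ∃ B, ∀ n : ℕ, |mat b (T ^ n) i j| ≤ B := by
    intro i j hi hj
    obtain ⟨B, hB⟩ := hT.exists_abs_le_of_fixed hC hb hp hu hfix (b.coord i) (hbp i hi) (hfb j hj)
    refine ⟨B, fun n => ?_⟩
    rw [mat, LinearMap.toMatrix_apply]
    exact hB n
  obtain ⟨B₁, h1⟩ := key 1 1 (by decide) (by decide)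
  obtain ⟨B₂, h2⟩ := key 1 2 (by decide) (by decide)
  obtain ⟨B₃, h3⟩ := key 2 1 (by decide) (by decide)
  obtain ⟨B₄, h4⟩ := key 2 2 (by decide) (by decide)
  refine ⟨|B₁| + |B₂| + |B₃| + |B₄|, fun n i j => ?_⟩
  rw [← hT.linPart_pow hb]
  have k1 := h1 n
  have k2 := h2 n
  have k3 := h3 n
  have k4 := h4 n
  fin_cases i <;> fin_cases j <;> simp [linPart] <;>
  linarith [le_abs_self B₁, le_abs_self B₂, le_abs_self B₃, le_abs_self B₄, abs_nonneg B₁,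
    abs_nonneg B₂, abs_nonneg B₃, abs_nonneg B₄]

theorem det_le_one_of_bounded {A : Matrix (Fin 2) (Fin 2) ℝ} {B : ℝ}
    (hB : ∀ (n : ℕ) i j, |(A ^ n) i j| ≤ B) : A.det ≤ 1 := by
  by_contra! hlt
  have hB0 : 0 ≤ B := (abs_nonneg _).trans (hB 0 0 0)
  obtain ⟨n, hn⟩ := pow_unbounded_of_one_lt (2 * B ^ 2) hlt
  rw [← Matrix.det_pow, Matrix.det_fin_two] at hn
  have h1 : |(A ^ n) 0 0 * (A ^ n) 1 1| ≤ B * B := by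
    rw [abs_mul]
    exact mul_le_mul (hB _ _ _) (hB _ _ _) (abs_nonneg _) hB0
  have h2 : |(A ^ n) 0 1 * (A ^ n) 1 0| ≤ B * B := by
    rw [abs_mul]
    exact mul_le_mul (hB _ _ _) (hB _ _ _) (abs_nonneg _) hB0
  nlinarith [abs_le.1 h1, abs_le.1 h2]

/-- The linear part of a unipotent automorphism of a cusp is a rotation for some scalar product. -/
theorem linPart_of_unipotent (hC : IsCusp C p f) (hT : IsCuspAut C p f T)
    (hb : IsCuspBasis p f b) (ha : mat b T 0 0 = 1) :
    (linPart b T).det = 1 ∧ |(linPart b T).trace| ≤ 2 ∧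
      ((linPart b T).trace = 2 → linPart b T = 1) ∧
      ((linPart b T).trace = -2 → linPart b T = -1) := by
  by_cases h : ∀ u, f u = 1 → ∀ κ : ℝ, T u ≠ u + κ • p
  · rw [(hT.of_fixes_no_line hC hb h).2]
    norm_num
  push Not at h
  obtain ⟨u, hu, κ, h⟩ := h
  have hfix := hT.fixed_of_fixes_line hC hb ha hu h
  have hp : T p = p := by rw [(hT.mat_zero hb).2.2.2.2, ha, one_smul]
  obtain ⟨B, hB⟩ := hT.exists_linPart_pow_le hC hb hp hu hfix
  obtain ⟨B', hB'⟩ := hT.symm.exists_linPart_pow_le hC hb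
    (by rw [LinearEquiv.symm_apply_eq, hp]) hu (by rw [LinearEquiv.symm_apply_eq, hfix])
  have hd1 := det_le_one_of_bounded hB
  have hd2 := det_le_one_of_bounded hB'
  have hd3 := congrArg Matrix.det (hT.linPart_mul_symm hb)
  rw [Matrix.det_mul, Matrix.det_one] at hd3
  have hpos := hT.linPart_det_pos hb
  -- The powers of the linear part and of its inverse are bounded, so both determinants are at most
  -- `1`; their product is `1`.
  have hdet : (linPart b T).det = 1 := by nlinarith
  have htr : |(linPart b T).trace| ≤ 2 := by
    refine abs_trace_le_two_of_bounded (2 * B) _ hdet fun n => ?_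
    rw [Matrix.trace_fin_two]
    refine (abs_add_le _ _).trans ?_
    linarith [hB n 0 0, hB n 1 1]
  refine ⟨hdet, htr, fun h2 => eq_one_of_bounded hdet h2 hB, fun h2 => ?_⟩
  -- For trace `-2`, the square has trace `2` and bounded powers, so it is `1`. Then
  -- Cayley–Hamilton, `A ^ 2 + 2 A + 1 = 0`, gives `A = -1`.
  have hsq : linPart b T ^ 2 = 1 := by
    refine eq_one_of_bounded (B := B) (by rw [Matrix.det_pow, hdet, one_pow]) ?_ fun n i j => ?_
    · rw [Matrix.det_fin_two] at hdet
      rw [Matrix.trace_fin_two] at h2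
      simp only [pow_two, Matrix.trace_fin_two, Matrix.mul_apply, Fin.sum_univ_two]
      linear_combination (-2) * hdet + (linPart b T 0 0 + linPart b T 1 1 - 2) * h2
    · rw [← pow_mul]
      exact hB _ i j
  have hCH : linPart b T ^ 2 + (2 : ℝ) • linPart b T + 1 = 0 := by
    rw [Matrix.det_fin_two] at hdet
    rw [Matrix.trace_fin_two] at h2
    ext i j
    fin_cases i <;> fin_cases j <;>
      simp [pow_two, Matrix.mul_apply]
    · linear_combination (linPart b T 0 0) * h2 - hdet
    · linear_combination (linPart b T 0 1) * h2
    · linear_combination (linPart b T 1 0) * h2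
    · linear_combination (linPart b T 1 1) * h2 - hdet
  rw [hsq] at hCH
  ext i j
  have := congrFun (congrFun hCH i) j
  simp only [Matrix.add_apply, Matrix.smul_apply, smul_eq_mul, Matrix.zero_apply] at this
  rw [Matrix.neg_apply]
  linarith

end IsCuspAut


/-! ### The cusp at a boundary point of a strictly convex domain with `C¹` boundary -/

theorem exists_isCuspBasis_of_independent {p d e u : Vec 3} {f : Vec 3 →ₗ[ℝ] ℝ} (hp : f p = 0)
    (hd : f d = 0) (he : f e = 0) (hu : f u = 1)
    (hli : ∀ x y z : ℝ, x • p + y • d + z • e = 0 → x = 0 ∧ y = 0 ∧ z = 0) :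
    ∃ b, IsCuspBasis p f b ∧ b 1 = d ∧ b 2 = e ∧ b 3 = u := by
  have hli : LinearIndependent ℝ ![p, d, e, u] := by
    rw [Fintype.linearIndependent_iff]
    intro g hg
    rw [Fin.sum_univ_four] at hg
    have hg' : g 0 • p + g 1 • d + g 2 • e + g 3 • u = 0 := hg
    have h3 : g 3 = 0 := by
      have := congrArg f hg'
      simpa [hp, hd, he, hu] using this
    rw [h3, zero_smul, add_zero] at hg'
    obtain ⟨h0, h1, h2⟩ := hli _ _ _ hg'
    intro i
    fin_cases i <;> assumption
  set b := basisOfLinearIndependentOfCardEqFinrank hli (by simp) with hb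
  have hbc : ∀ i, b i = ![p, d, e, u] i := fun i => by
    rw [hb, coe_basisOfLinearIndependentOfCardEqFinrank]
  refine ⟨b, ⟨hbc 0, fun v => ?_⟩, hbc 1, hbc 2, hbc 3⟩
  have h1 : f = b.coord 3 := by
    refine b.ext fun i => ?_
    rw [Module.Basis.coord_apply, b.repr_self, hbc]
    fin_cases i <;> simp [hp, hd, he, hu]
  rw [h1, Module.Basis.coord_apply]

theorem exists_isCuspBasis {p : Vec 3} {f : Vec 3 →ₗ[ℝ] ℝ} (hp : p ≠ 0) (hf : f ≠ 0)
    (hfp : f p = 0) : ∃ b, IsCuspBasis p f b := by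
  obtain ⟨e, he⟩ : ∃ e, f e = 1 := by
    obtain ⟨u, hu⟩ : ∃ u, f u ≠ 0 := by
      by_contra! h
      exact hf (LinearMap.ext h)
    exact ⟨(f u)⁻¹ • u, by simp [hu]⟩
  have hrank : Module.finrank ℝ (LinearMap.ker f) = 3 := by
    have h1 := LinearMap.finrank_range_add_finrank_ker f
    have h2 : LinearMap.range f = ⊤ := by
      rw [LinearMap.range_eq_top]
      intro r
      exact ⟨r • e, by simp [he]⟩
    rw [h2, finrank_top, Module.finrank_self, Module.finrank_fin_fun] at h1
    omega
  have hli1 : LinearIndependent ℝ ![(⟨p, hfp⟩ : LinearMap.ker f)] := by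
    rw [linearIndependent_unique_iff]
    simpa [Subtype.ext_iff] using hp
  obtain ⟨x, hx⟩ := exists_linearIndependent_cons_of_lt_finrank hli1 (by rw [hrank]; norm_num)
  obtain ⟨y, hy⟩ := exists_linearIndependent_cons_of_lt_finrank hx (by rw [hrank]; norm_num)
  obtain ⟨b, hb, -⟩ := exists_isCuspBasis_of_independent hfp x.2 y.2 he fun c₀ c₁ c₂ h => by
    have h4 := Fintype.linearIndependent_iff.1 hy ![c₂, c₁, c₀] (by
      rw [Fin.sum_univ_three]
      apply Subtype.ext
      simp only [Fin.cons_zero, Fin.cons_one, Matrix.cons_val_zero, Matrix.cons_val_one,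
        Submodule.coe_add, Submodule.coe_smul, Submodule.coe_zero]
      rw [← h]
      simp [Fin.cons]
      abel)
    exact ⟨h4 2, h4 1, h4 0⟩
  exact ⟨b, hb⟩

/-- A strictly convex domain `Ω` with `C¹` boundary, with a cone `C` over it, a vector `p`
representing the boundary point `x`, and a basis adapted to the cusp at `x`. -/
structure IsCuspOf (Ω : Set (PSpace 3)) (x : PSpace 3) (C : Set (Vec 3)) (k : Vec 3 →ₗ[ℝ] ℝ)
    (p : Vec 3) (f : Vec 3 →ₗ[ℝ] ℝ) (b : Module.Basis (Fin 4) ℝ (Vec 3)) : Prop where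
  strict : IsStrictlyConvex Ω
  c1 : HasC1Boundary Ω
  isCone : IsConeOver C k Ω
  mem : p ∈ cone {x}
  mem_closure : p ∈ closure C
  notMem : p ∉ C
  cusp : IsCusp C p f
  basis : IsCuspBasis p f b

/-- This is where the regularity of `Ω` enters: the `C¹` boundary gives `full`, and strict convexity
gives `superlinear`. -/
theorem exists_isCuspOf {Ω : Set (PSpace 3)} (hs : IsStrictlyConvex Ω)
    (hC1 : HasC1Boundary Ω) {C : Set (Vec 3)} {k : Vec 3 →ₗ[ℝ] ℝ} (hC : IsConeOver C k Ω)
    {x : PSpace 3} (hx : x ∈ frontier Ω) :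
    ∃ p f b, IsCuspOf Ω x C k p f b := by
  obtain ⟨p, hpx, hp, hp'⟩ := hC.exists_rep_frontier hx
  obtain ⟨f, hf, hfp⟩ := hC.exists_support hp hp'
  have hf0 : f ≠ 0 := by
    rintro rfl
    obtain ⟨u, hu⟩ := hC.nonempty
    exact lt_irrefl _ (hf u hu)
  obtain ⟨b, hb⟩ := exists_isCuspBasis hpx.1 hf0 hfp
  refine ⟨p, f, b, hs, hC1, hC, hpx, hp, hp', ⟨hf, hfp, fun v hv => ?_, fun θ hθ => ?_⟩, hb⟩
  · exact hC.exists_add_smul_mem_of_support_pos hC1 hp hp' hpx.1 hf hfp hv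
  · obtain ⟨c, hc⟩ := hC.exists_add_mul_support_nonneg hs hp hpx.1 hf hfp θ hθ
    exact ⟨c, fun v hv => hc v (subset_closure hv)⟩

/-- `T` is the multiple of `g` that is an automorphism of the cusp preserving `f`. -/
structure IsNormalization (C : Set (Vec 3)) (p : Vec 3) (f : Vec 3 →ₗ[ℝ] ℝ) (g : SL 3)
    (T : Vec 3 ≃ₗ[ℝ] Vec 3) : Prop extends IsCuspAut C p f T where
  exists_smul : ∃ r : ℝ, r ≠ 0 ∧ ∀ v, T v = r • (g • v)

namespace IsNormalization

variable {C : Set (Vec 3)} {p : Vec 3} {f : Vec 3 →ₗ[ℝ] ℝ} {T S : Vec 3 ≃ₗ[ℝ] Vec 3} {g h : SL 3}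

theorem one : IsNormalization C p f 1 1 := ⟨IsCuspAut.one, 1, one_ne_zero, fun v => by simp⟩

theorem mul (hT : IsNormalization C p f g T) (hS : IsNormalization C p f h S) :
    IsNormalization C p f (g * h) (T * S) := by
  refine ⟨hT.toIsCuspAut.mul hS.toIsCuspAut, ?_⟩
  obtain ⟨r, hr, h1⟩ := hT.exists_smul
  obtain ⟨s, hs, h2⟩ := hS.exists_smul
  exact ⟨r * s, mul_ne_zero hr hs, fun v => by
    rw [LinearEquiv.mul_apply, h1, h2, mul_smul g h v, smul_comm g s, smul_smul]⟩

theorem inv (hT : IsNormalization C p f g T) : IsNormalization C p f g⁻¹ T⁻¹ := by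
  refine ⟨hT.toIsCuspAut.inv, ?_⟩
  obtain ⟨r, hr, h1⟩ := hT.exists_smul
  refine ⟨r⁻¹, inv_ne_zero hr, fun v => ?_⟩
  change T.symm v = _
  rw [LinearEquiv.symm_apply_eq, h1, smul_comm g, smul_inv_smul, smul_smul, mul_inv_cancel₀ hr,
    one_smul]

theorem pow (hT : IsNormalization C p f g T) (n : ℕ) : IsNormalization C p f (g ^ n) (T ^ n) := by
  induction n with
  | zero => exact one
  | succ k ih => rw [pow_succ, pow_succ]; exact ih.mul hT

theorem smul_mem_cone {A : Set (PSpace 3)} (hT : IsNormalization C p f g T) {v : Vec 3} :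
    T v ∈ cone A ↔ g • v ∈ cone A := by
  obtain ⟨r, hr, h1⟩ := hT.exists_smul
  rw [h1, smul_mem_cone_iff hr]

theorem apply_mem_cone_smul (hT : IsNormalization C p f g T) {v : Vec 3} {x : PSpace 3}
    (hv : v ∈ cone {x}) : T v ∈ cone {g • x} :=
  hT.smul_mem_cone.2 (smul_mem_cone_singleton hv)

end IsNormalization

/-- The condition on `f` determines the scalar. Consequently normalizations multiply, and a group
fixing `x` lifts to linear automorphisms by a homomorphism. -/
theorem IsNormalization.ext {C : Set (Vec 3)} {p : Vec 3} {f : Vec 3 →ₗ[ℝ] ℝ}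
    {T S : Vec 3 ≃ₗ[ℝ] Vec 3} {g : SL 3} (hf : f ≠ 0) (hT : IsNormalization C p f g T)
    (hS : IsNormalization C p f g S) : T = S := by
  obtain ⟨r, hr, h1⟩ := hT.exists_smul
  obtain ⟨s, hs, h2⟩ := hS.exists_smul
  obtain ⟨u, hu⟩ : ∃ u, f u ≠ 0 := by
    by_contra! h
    exact hf (LinearMap.ext h)
  have h3 := hT.map_f u
  have h4 := hS.map_f u
  rw [h1, map_smul, smul_eq_mul] at h3
  rw [h2, map_smul, smul_eq_mul] at h4
  have h5 : f (g • u) ≠ 0 := fun h0 => by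
    rw [h0, mul_zero] at h3
    exact hu h3.symm
  have : r = s := mul_right_cancel₀ h5 (h3.trans h4.symm)
  ext1 v
  rw [h1, h2, this]

namespace IsCuspOf

variable {Ω : Set (PSpace 3)} {x : PSpace 3} {C : Set (Vec 3)} {k : Vec 3 →ₗ[ℝ] ℝ}
  {p : Vec 3} {f : Vec 3 →ₗ[ℝ] ℝ} {b : Module.Basis (Fin 4) ℝ (Vec 3)}

theorem f_ne_zero (h : IsCuspOf Ω x C k p f b) : f ≠ 0 := by
  rintro rfl
  obtain ⟨u, hu⟩ := h.isCone.nonempty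
  exact lt_irrefl _ (h.cusp.pos u hu)

theorem p_ne_zero (h : IsCuspOf Ω x C k p f b) : p ≠ 0 := h.mem.1

theorem f_nonneg (h : IsCuspOf Ω x C k p f b) {v : Vec 3} (hv : v ∈ closure C) : 0 ≤ f v :=
  IsOpenConvexCone.functional_nonneg_closure (fun u hu => (h.cusp.pos u hu).le) hv

theorem eq_smul_of_f_eq_zero (h : IsCuspOf Ω x C k p f b) {v : Vec 3} (hv : v ∈ closure C)
    (hf : f v = 0) : ∃ r : ℝ, 0 ≤ r ∧ v = r • p :=
  h.isCone.support_eq_smul h.strict h.cusp.pos hv h.mem_closure hf h.cusp.map_p h.p_ne_zero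

theorem add_smul_mem (h : IsCuspOf Ω x C k p f b) {v : Vec 3} (hv : v ∈ C) {τ : ℝ} (hτ : 0 ≤ τ) :
    v + τ • p ∈ C := by
  rcases hτ.eq_or_lt with rfl | hτ
  · simpa using hv
  · exact h.isCone.add_closure_mem hv (h.isCone.closure_smul_mem h.mem_closure hτ)

/-- Up to sign, `g` preserves `C` and the half-line of `p`. Composing `f` with it gives another
supporting form at `p`, so `c f` by uniqueness, and dividing by `c` normalizes. -/
theorem exists_normalization (h : IsCuspOf Ω x C k p f b) {g : SL 3} (hg : g ∈ Aut Ω)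
    (hgx : g • x = x) : ∃ T, IsNormalization C p f g T := by
  obtain ⟨ε, hε, hεC⟩ := h.isCone.exists_sign hg
  have hε0 : ε ≠ 0 := by rcases hε with rfl | rfl <;> norm_num
  have hcont : Continuous fun v : Vec 3 => ε • (g • v) :=
    (LinearMap.continuous_of_finiteDimensional
      (ε • DistribSMul.toLinearMap ℝ (Vec 3) g : Vec 3 →ₗ[ℝ] Vec 3))
  obtain ⟨l, hl0, hl⟩ : ∃ l : ℝ, l ≠ 0 ∧ ε • (g • p) = l • p := by
    have h1 : g • p ∈ cone {x} := by
      have := smul_mem_cone_singleton (g := g) h.mem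
      rwa [hgx] at this
    have h2 := eq_mk_of_mem_cone h.mem
    rw [h2, mem_cone_singleton_mk] at h1
    obtain ⟨r, hr, hr'⟩ := h1
    exact ⟨ε * r, mul_ne_zero hε0 hr, by rw [hr', mul_smul]⟩
  have hlpos : 0 < l := by
    have h1 : l • p ∈ closure C := by
      rw [← hl]
      exact map_mem_closure (f := fun v : Vec 3 => ε • (g • v)) hcont h.mem_closure fun v hv => (hεC v).1 hv
    have h2 := h.isCone.pos _ h1 (smul_ne_zero hl0 h.p_ne_zero)
    rw [map_smul, smul_eq_mul] at h2
    exact pos_of_mul_pos_left h2 (h.isCone.pos p h.mem_closure h.p_ne_zero).le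
  set G : Vec 3 →ₗ[ℝ] Vec 3 := ε • DistribSMul.toLinearMap ℝ (Vec 3) g with hG
  have hGv : ∀ v, G v = ε • (g • v) := fun v => rfl
  obtain ⟨c, hc, hcf⟩ := h.isCone.support_unique h.c1 h.mem_closure h.notMem h.p_ne_zero
    h.cusp.pos h.cusp.map_p (f₂ := f ∘ₗ G) (fun u hu => h.cusp.pos _ ((hεC u).1 hu)) (by
      rw [LinearMap.comp_apply, hGv, hl, map_smul, h.cusp.map_p, smul_zero])
  have hr : c⁻¹ * ε ≠ 0 := mul_ne_zero (inv_ne_zero hc.ne') hε0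
  set T : Vec 3 ≃ₗ[ℝ] Vec 3 := (DistribMulAction.toLinearEquiv ℝ (Vec 3) g).trans
    (LinearEquiv.smulOfNeZero ℝ (Vec 3) _ hr) with hT
  have hTv : ∀ v, T v = (c⁻¹ * ε) • (g • v) := fun v => rfl
  have hTv' : ∀ v, T v = c⁻¹ • G v := fun v => by rw [hTv, hGv, smul_smul]
  have hTC : ∀ v, v ∈ C ↔ T v ∈ C := by
    intro v
    rw [hTv', hεC v, ← hGv]
    constructor
    · exact fun h' => h.isCone.smul_mem _ h' _ (inv_pos.2 hc)
    · intro h'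
      have := h.isCone.smul_mem _ h' _ hc
      rwa [smul_smul, mul_inv_cancel₀ hc.ne', one_smul] at this
  refine ⟨T, ⟨fun v hv => (hTC v).1 hv, fun v hv => ?_, fun v => ?_, ⟨c⁻¹ * l, by positivity, ?_⟩,
    ?_⟩, _, hr, hTv⟩
  · rw [hTC, T.apply_symm_apply]
    exact hv
  · rw [hTv', map_smul]
    have := hcf v
    rw [LinearMap.comp_apply] at this
    rw [this, smul_eq_mul, inv_mul_cancel_left₀ hc.ne']
  · rw [hTv', hGv, hl, smul_smul]
  · have : (T : Vec 3 →ₗ[ℝ] Vec 3) = (c⁻¹ * ε) • Matrix.toLin' g.1 := by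
      ext1 i
      ext1
      rfl
    rw [this, LinearMap.det_smul, LinearMap.det_toLin', g.2, Module.finrank_fin_fun, mul_one]
    -- The determinant is the fourth power of the scalar, hence positive whatever its sign.
    exact Even.pow_pos (by decide) hr

end IsCuspOf


/-! ### The limit set -/

theorem exists_subseq_tendsto_matrix {m : ℕ} {A : ℕ → Matrix (Fin m) (Fin m) ℝ} {B : ℝ}
    (h : ∀ k i j, |A k i j| ≤ B) :
    ∃ (M : Matrix (Fin m) (Fin m) ℝ) (φ : ℕ → ℕ), StrictMono φ ∧ Tendsto (A ∘ φ) atTop (𝓝 M) := by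
  have hK : IsCompact (Set.pi univ fun _ : Fin m => Set.pi univ fun _ : Fin m => Icc (-B) B) :=
    isCompact_univ_pi fun _ => isCompact_univ_pi fun _ => isCompact_Icc
  obtain ⟨M, -, φ, hφ, hM⟩ := hK.tendsto_subseq (x := fun k i j => A k i j)
    fun k i _ j _ => abs_le.1 (h k i j)
  exact ⟨M, φ, hφ, hM⟩

theorem tendsto_mulVec {m : ℕ} {ι : Type*} {l : Filter ι} {A : ι → Matrix (Fin m) (Fin m) ℝ}
    {M : Matrix (Fin m) (Fin m) ℝ} (h : Tendsto A l (𝓝 M)) (v : Fin m → ℝ) :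
    Tendsto (fun k => (A k).mulVec v) l (𝓝 (M.mulVec v)) := by
  have : Continuous fun A : Matrix (Fin m) (Fin m) ℝ => A.mulVec v :=
    continuous_id.matrix_mulVec continuous_const
  exact (this.tendsto M).comp h

/-! ### Limits of rescaled automorphisms of a convex cone -/

namespace IsConeOver

variable {C : Set (Vec n)} {k : Vec n →ₗ[ℝ] ℝ} {Ω : Set (PSpace n)}

theorem exists_norm_le (hC : IsConeOver C k Ω) : ∃ η : ℝ, 0 < η ∧ ∀ v ∈ closure C, η * ‖v‖ ≤ k v := by
  have hkc : Continuous k := LinearMap.continuous_of_finiteDimensional k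
  have hK : IsCompact (closure C ∩ Metric.sphere (0 : Vec n) 1) :=
    (isCompact_sphere 0 1).inter_left isClosed_closure
  obtain ⟨η, hη, hηK⟩ := hK.exists_forall_le' (f := k) hkc.continuousOn (a := 0) (by
    rintro v ⟨hv, hv1⟩
    refine hC.pos v hv ?_
    rintro rfl
    simp at hv1)
  refine ⟨η, hη, fun v hv => ?_⟩
  rcases eq_or_ne v 0 with rfl | hv0
  · simp
  · have hn : 0 < ‖v‖ := norm_pos_iff.2 hv0
    have h1 := hηK (‖v‖⁻¹ • v) ⟨hC.closure_smul_mem hv (inv_pos.2 hn), by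
      simp [norm_smul, hn.ne']⟩
    rw [map_smul, smul_eq_mul, ← div_eq_inv_mul, le_div_iff₀ hn] at h1
    exact h1

/-- The matrices preserving the cone are bounded by their values near a point of the cone. -/
theorem exists_entries_le (hC : IsConeOver C k Ω) {z : Vec n} (hz : z ∈ C) :
    ∃ δ K : ℝ, 0 < δ ∧ 0 ≤ K ∧ ∀ A : Matrix (Fin (n + 1)) (Fin (n + 1)) ℝ,
      (∀ v ∈ C, A.mulVec v ∈ closure C) → ∀ z', ‖z' - z‖ < δ → ∀ i j,
        |A i j| ≤ K * k (A.mulVec z') := by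
  obtain ⟨η, hη, hηC⟩ := hC.exists_norm_le
  obtain ⟨δ, hδ, hball⟩ := Metric.isOpen_iff.1 hC.isOpen z hz
  -- Since `z'` and `z' ± e` lie in `C` for `e` of norm `δ / 4`, the images `Z` and `E` of `z'` and
  -- `e` satisfy `η ‖E‖ ≤ 3 k(Z)`. An entry of `A` is at most `4 / δ` times `‖E‖`, whence the factor
  -- `12 / (δ η)`.
  refine ⟨δ / 2, 12 / (δ * η), by positivity, by positivity, fun A hA z' hz' i j => ?_⟩
  set e : Vec n := (δ / 4) • Pi.single j 1 with he
  have hen : ‖e‖ = δ / 4 := by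
    rw [he, norm_smul, Pi.norm_single, norm_one, mul_one, Real.norm_of_nonneg (by positivity)]
  have hmem : ∀ s : ℝ, |s| ≤ 1 → z' + s • e ∈ C := by
    intro s hs
    refine hball ?_
    rw [mem_ball_iff_norm, add_sub_right_comm]
    calc ‖z' - z + s • e‖ ≤ ‖z' - z‖ + ‖s • e‖ := norm_add_le _ _
      _ ≤ ‖z' - z‖ + 1 * (δ / 4) := by
          rw [norm_smul, hen]
          gcongr
          exact hs
      _ < δ := by linarith
  have h0 := hA _ (hmem 0 (by simp))
  have h1 := hA _ (hmem 1 (by simp))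
  have h2 := hA _ (hmem (-1) (by simp))
  rw [zero_smul, add_zero] at h0
  rw [one_smul, Matrix.mulVec_add] at h1
  rw [neg_one_smul, Matrix.mulVec_add, Matrix.mulVec_neg] at h2
  set Z := A.mulVec z' with hZ
  set E := A.mulVec e with hE
  have k0 := hηC _ h0
  have k1 := hηC _ h1
  have k2 := hηC _ h2
  rw [map_add] at k1 k2
  rw [map_neg] at k2
  have hkE : k E ≤ k Z := by
    have := mul_nonneg hη.le (norm_nonneg (Z + -E))
    linarith
  have hn1 : η * ‖E‖ ≤ 3 * k Z := by
    have : ‖E‖ ≤ ‖Z + E‖ + ‖Z‖ := by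
      have := norm_sub_le (Z + E) Z
      rwa [add_sub_cancel_left] at this
    nlinarith
  have hEi : E i = δ / 4 * A i j := by
    rw [hE, he, Matrix.mulVec_smul, Pi.smul_apply, Matrix.mulVec_single_one, smul_eq_mul]
    rfl
  have h4 : |E i| ≤ ‖E‖ := norm_le_pi_norm E i
  rw [hEi, abs_mul, abs_of_pos (by positivity : (0 : ℝ) < δ / 4)] at h4
  rw [div_mul_eq_mul_div, le_div_iff₀ (by positivity)]
  nlinarith

end IsConeOver

/-- `A` is a multiple of an element of `Γ` and preserves the cone `C`. -/
structure IsScaled (C : Set (Vec n)) (Γ : Subgroup (SL n)) (A : Matrix (Fin (n + 1)) (Fin (n + 1)) ℝ) :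
    Prop where
  map_mem : ∀ v ∈ C, A.mulVec v ∈ C
  exists_smul : ∃ g ∈ Γ, ∃ r : ℝ, r ≠ 0 ∧ A = r • g.1

namespace IsConeOver

variable {C : Set (Vec n)} {k : Vec n →ₗ[ℝ] ℝ} {Ω : Set (PSpace n)} {Γ : Subgroup (SL n)}

/-- An automorphism preserves `C` up to sign, so a single vector decides which multiples of it
preserve `C`. -/
theorem isScaled_of_apply_mem (hC : IsConeOver C k Ω) (hΓ : Γ ≤ Aut Ω) {g : SL n} (hg : g ∈ Γ)
    {r : ℝ} {v : Vec n} (hv : v ∈ C) (h : r • (g • v) ∈ C) : IsScaled C Γ (r • g.1) := by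
  have hr : r ≠ 0 := by
    rintro rfl
    rw [zero_smul] at h
    exact hC.zero_notMem h
  refine ⟨fun u hu => ?_, g, hg, r, hr, rfl⟩
  rw [Matrix.smul_mulVec]
  change r • (g • u) ∈ C
  obtain ⟨ε, hε, hεC⟩ := hC.exists_sign (hΓ hg)
  have hε2 : ε * ε = 1 := by rcases hε with rfl | rfl <;> norm_num
  have hrε : ∀ w : Vec n, r • (g • w) = (r * ε) • (ε • (g • w)) := fun w => by
    rw [smul_smul, mul_assoc, hε2, mul_one]
  have hpos : 0 < r * ε := by
    have h1 := hC.k_pos h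
    rw [hrε, map_smul, smul_eq_mul] at h1
    exact pos_of_mul_pos_left h1 (hC.k_pos ((hεC v).1 hv)).le
  rw [hrε]
  exact hC.smul_mem _ ((hεC u).1 hu) _ hpos

/-- A point of the closure of an orbit is the image of the base point by a limit of multiples of
elements of the group. -/
theorem exists_tendsto_of_mem_closure_orbit (hC : IsConeOver C k Ω) (hΓ : Γ ≤ Aut Ω)
    {x : PSpace n} {v w : Vec n} (hvx : v ∈ cone {x}) (hv : v ∈ C) (hw : w ∈ closure C)
    (hw0 : w ≠ 0) (h : w ∈ cone (closure (MulAction.orbit Γ x))) :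
    ∃ (A : ℕ → Matrix (Fin (n + 1)) (Fin (n + 1)) ℝ) (M : Matrix (Fin (n + 1)) (Fin (n + 1)) ℝ),
      (∀ j, IsScaled C Γ (A j)) ∧ Tendsto A atTop (𝓝 M) ∧ M.mulVec v = w := by
  have hkc : Continuous k := LinearMap.continuous_of_finiteDimensional k
  rw [mem_cone_closure hw0] at h
  have h2 : w ∈ closure (cone (MulAction.orbit Γ x) ∩ {u | 0 < k u}) := by
    rw [inter_comm]
    exact (isOpen_lt continuous_const hkc).inter_closure ⟨hC.pos w hw hw0, h⟩
  obtain ⟨u, hu, hlim⟩ := mem_closure_iff_seq_limit.1 h2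
  have hA : ∀ j, ∃ A, IsScaled C Γ A ∧ A.mulVec v = u j := by
    intro j
    obtain ⟨⟨hu0, hj⟩, hkj⟩ := hu j
    obtain ⟨⟨g, hg⟩, hgx⟩ := hj
    replace hgx : g • x = Projectivization.mk ℝ (u j) hu0 := hgx
    have h3 : u j ∈ cone {g • x} := ⟨hu0, hgx.symm⟩
    rw [eq_mk_of_mem_cone (smul_mem_cone_singleton (g := g) hvx), mem_cone_singleton_mk] at h3
    obtain ⟨r, hr, hr'⟩ := h3
    have h4 : r • (g • v) ∈ C := by
      refine hC.mem_of_mem_cone ?_ (by rw [← hr']; exact hkj)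
      rw [smul_mem_cone_iff hr, smul_mem_cone_of_mem_Aut (hΓ hg)]
      exact (hC.mem_cone v).2 (Or.inl hv)
    exact ⟨_, hC.isScaled_of_apply_mem hΓ hg hv h4, by rw [hr', Matrix.smul_mulVec]; rfl⟩
  choose A hA hAv using hA
  -- The entries of `A j` are controlled by `k (u j)`, which converges; a subsequence of the
  -- matrices converges too.
  obtain ⟨δ, K, hδ, hK, hbd⟩ := hC.exists_entries_le hv
  obtain ⟨B, hB⟩ := ((hkc.tendsto w).comp hlim).bddAbove_range
  obtain ⟨M, φ, hφ, hM⟩ := exists_subseq_tendsto_matrix (A := A) (B := K * B) fun j i i' => by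
    refine (hbd _ (fun v hv => subset_closure ((hA j).map_mem v hv)) v (by simpa using hδ) i i').trans ?_
    rw [hAv]
    exact mul_le_mul_of_nonneg_left (hB ⟨j, rfl⟩) hK
  refine ⟨A ∘ φ, M, fun j => hA _, hM, ?_⟩
  refine tendsto_nhds_unique (tendsto_mulVec hM v) ?_
  simp only [Function.comp_apply, hAv]
  exact hlim.comp hφ.tendsto_atTop

theorem mem_closure_of_tendsto {A : ℕ → Matrix (Fin (n + 1)) (Fin (n + 1)) ℝ}
    {M : Matrix (Fin (n + 1)) (Fin (n + 1)) ℝ} (hA : ∀ j, IsScaled C Γ (A j))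
    (hM : Tendsto A atTop (𝓝 M)) {v : Vec n} (hv : v ∈ C) : M.mulVec v ∈ closure C :=
  _root_.mem_closure_of_tendsto (tendsto_mulVec hM v) (Eventually.of_forall fun j => (hA j).map_mem v hv)

theorem mem_closure_orbit_of_tendsto {A : ℕ → Matrix (Fin (n + 1)) (Fin (n + 1)) ℝ}
    {M : Matrix (Fin (n + 1)) (Fin (n + 1)) ℝ} (hA : ∀ j, IsScaled C Γ (A j))
    (hM : Tendsto A atTop (𝓝 M)) {x : PSpace n} {v : Vec n} (hv : v ∈ cone {x})
    (hne : M.mulVec v ≠ 0) : M.mulVec v ∈ cone (closure (MulAction.orbit Γ x)) := by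
  rw [mem_cone_closure hne]
  refine _root_.mem_closure_of_tendsto (tendsto_mulVec hM v) (Eventually.of_forall fun j => ?_)
  obtain ⟨g, hg, r, hr, h⟩ := (hA j).exists_smul
  rw [h, Matrix.smul_mulVec, smul_mem_cone_iff hr]
  refine cone_mono ?_ (smul_mem_cone_singleton (g := g) hv)
  rw [singleton_subset_iff]
  exact ⟨⟨g, hg⟩, rfl⟩

/-- For a strictly convex domain, the limit points of an orbit do not depend on the base point. -/
theorem mem_closure_orbit_of_frontier (hC : IsConeOver C k Ω) (hs : IsStrictlyConvex Ω)
    (hΓ : Γ ≤ Aut Ω) {x y z : PSpace n} (hx : x ∈ Ω) (hy : y ∈ Ω) (hz : z ∈ frontier Ω)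
    (h : z ∈ closure (MulAction.orbit Γ x)) : z ∈ closure (MulAction.orbit Γ y) := by
  obtain ⟨v, hvx, hv⟩ := hC.exists_rep hx
  obtain ⟨u, huy, hu⟩ := hC.exists_rep hy
  obtain ⟨w, hwz, hw, hw'⟩ := hC.exists_rep_frontier hz
  obtain ⟨A, M, hA, hM, hMv⟩ := hC.exists_tendsto_of_mem_closure_orbit hΓ hvx hv hw hwz.1
    ((mem_iff_cone hwz).1 h)
  obtain ⟨f, hf, hfw⟩ := hC.exists_support hw hw'
  have hMC : ∀ u ∈ C, M.mulVec u ∈ closure C := fun u hu => mem_closure_of_tendsto hA hM hu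
  -- The form `φ ∘ M` is nonnegative on the open cone, so it vanishes everywhere or nowhere. With `φ
  -- = k` this shows `M u ≠ 0`; with `φ = f` it puts the image of `M` in the supporting hyperplane
  -- at `w`, where strict convexity leaves only the ray of `w`.
  have key : ∀ φ : Vec n →ₗ[ℝ] ℝ, (∀ u ∈ C, 0 < φ u) → ∀ u ∈ C, φ (M.mulVec u) = 0 →
      ∀ u' ∈ C, φ (M.mulVec u') = 0 := by
    intro φ hφ u hu h0 u' hu'
    have hnn : ∀ u ∈ C, 0 ≤ (φ ∘ₗ Matrix.toLin' M) u := fun u hu => by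
      rw [LinearMap.comp_apply, Matrix.toLin'_apply]
      exact IsOpenConvexCone.functional_nonneg_closure (fun u hu => (hφ u hu).le) (hMC u hu)
    by_cases hne : φ ∘ₗ Matrix.toLin' M = 0
    · have := LinearMap.congr_fun hne u'
      simpa using this
    · have := hC.functional_pos hne hnn u hu
      rw [LinearMap.comp_apply, Matrix.toLin'_apply, h0] at this
      exact absurd this (lt_irrefl _)
  have hMu : M.mulVec u ≠ 0 := by
    intro h0
    have := key k (fun u hu => hC.k_pos hu) u hu (by rw [h0, map_zero]) v hv
    rw [hMv] at this
    exact (hC.pos w hw hwz.1).ne' this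
  have hfu := key f hf v hv (by rw [hMv, hfw]) u hu
  obtain ⟨r, hr, hr'⟩ := hC.support_eq_smul hs hf (hMC u hu) hw hfu hfw hwz.1
  have hr0 : r ≠ 0 := by
    rintro rfl
    rw [zero_smul] at hr'
    exact hMu hr'
  have h2 := mem_closure_orbit_of_tendsto hA hM huy hMu
  rw [hr', smul_mem_cone_iff hr0] at h2
  exact (mem_iff_cone hwz).2 h2

/-- The orbits of a discrete group are closed in `Ω`. -/
theorem mem_orbit_of_mem_closure (hC : IsConeOver C k Ω) (hΓ : Γ ≤ Aut Ω)
    (hd : DiscreteTopology Γ) {x y : PSpace n} (hx : x ∈ Ω) (hy : y ∈ Ω)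
    (h : y ∈ closure (MulAction.orbit Γ x)) : y ∈ MulAction.orbit Γ x := by
  obtain ⟨v, hvx, hv⟩ := hC.exists_rep hx
  obtain ⟨w, hwy, hw⟩ := hC.exists_rep hy
  obtain ⟨A, M, hA, hM, hMv⟩ := hC.exists_tendsto_of_mem_closure_orbit hΓ hvx hv
    (subset_closure hw) hwy.1 ((mem_iff_cone hwy).1 h)
  have hAC := fun j => (hA j).map_mem
  choose g hg r hr hAr using fun j => (hA j).exists_smul
  have hAlim := tendsto_mulVec hM v
  rw [hMv] at hAlim
  -- The inverses preserve `C` and send `(A j) v`, which is close to the interior point `w`, to the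
  -- fixed vector `v`. So they are bounded as well, and the limit `M` is invertible.
  have hinv : ∀ j, IsScaled C Γ ((r j)⁻¹ • (g j)⁻¹.1) := by
    intro j
    refine hC.isScaled_of_apply_mem hΓ (Γ.inv_mem (hg j)) (hAC j v hv) ?_
    rw [hAr, Matrix.smul_mulVec, smul_comm (g j)⁻¹, smul_smul, inv_mul_cancel₀ (hr j), one_smul]
    rwa [← SL_smul_eq, inv_smul_smul]
  have hinv_apply : ∀ j, ((r j)⁻¹ • (g j)⁻¹.1).mulVec ((A j).mulVec v) = v := by
    intro j
    rw [hAr, Matrix.smul_mulVec, Matrix.smul_mulVec, Matrix.mulVec_smul, smul_smul,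
      inv_mul_cancel₀ (hr j), one_smul, ← SL_smul_eq, ← SL_smul_eq, inv_smul_smul]
  obtain ⟨δ, K, hδ, hK, hbd⟩ := hC.exists_entries_le hw
  obtain ⟨N, hN⟩ := eventually_atTop.1 (Metric.tendsto_nhds.1 hAlim δ hδ)
  obtain ⟨M', φ, hφ, hM'⟩ := exists_subseq_tendsto_matrix
    (A := fun j => (r (j + N))⁻¹ • (g (j + N))⁻¹.1) (B := K * k v) fun j i i' => by
    have h1 := hbd _ (fun v hv => subset_closure ((hinv (j + N)).map_mem v hv))
      ((A (j + N)).mulVec v) (by simpa [dist_eq_norm] using hN (j + N) (by omega)) i i'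
    rwa [hinv_apply] at h1
  have hM2 : Tendsto (fun j => A (φ j + N)) atTop (𝓝 M) :=
    hM.comp ((tendsto_add_atTop_nat N).comp hφ.tendsto_atTop)
  have hprod : M * M' = 1 := by
    refine tendsto_nhds_unique (hM2.mul hM') ?_
    refine tendsto_const_nhds.congr fun j => ?_
    rw [Function.comp_apply, hAr, smul_mul_smul_comm, mul_inv_cancel₀ (hr _), one_smul,
      ← Matrix.SpecialLinearGroup.coe_mul, mul_inv_cancel, Matrix.SpecialLinearGroup.coe_one]
  have hdet : M.det ≠ 0 := by
    intro h0
    have := congrArg Matrix.det hprod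
    rw [Matrix.det_mul, h0, zero_mul, Matrix.det_one] at this
    exact zero_ne_one this
  -- The determinant of `A j` is a power of its scalar `r j`. As `det M` is finite and nonzero, the
  -- scalars accumulate at some `s ≠ 0`, and the group elements themselves converge along a
  -- subsequence.
  have hdetlim : Tendsto (fun j => (r (φ j + N)) ^ (n + 1)) atTop (𝓝 M.det) := by
    have := (continuous_id.matrix_det.tendsto M).comp hM2
    refine this.congr fun j => ?_
    rw [Function.comp_apply, id, hAr, Matrix.det_smul, (g _).2, mul_one, Fintype.card_fin]
  obtain ⟨B, hB⟩ := hdetlim.abs.bddAbove_range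
  have hrB : ∀ j, r (φ j + N) ∈ Icc (-(max 1 B)) (max 1 B) := by
    intro j
    rw [mem_Icc, ← abs_le, le_max_iff]
    by_contra! hcon
    have h1 : |r (φ j + N)| ≤ |r (φ j + N)| ^ (n + 1) := le_self_pow₀ hcon.1.le (by omega)
    rw [← abs_pow] at h1
    exact absurd (h1.trans (hB ⟨j, rfl⟩)) (not_le.2 hcon.2)
  obtain ⟨s, -, ψ, hψ, hs⟩ := isCompact_Icc.tendsto_subseq hrB
  have hs0 : s ≠ 0 := by
    rintro rfl
    have h1 := hdetlim.comp hψ.tendsto_atTop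
    have h2 := hs.pow (n + 1)
    rw [zero_pow (by omega)] at h2
    exact hdet (tendsto_nhds_unique h1 h2)
  have hM3 := hM2.comp hψ.tendsto_atTop
  have hglim : Tendsto (fun j => (g (φ (ψ j) + N)).1) atTop (𝓝 (s⁻¹ • M)) := by
    refine ((hs.inv₀ hs0).smul hM3).congr fun j => ?_
    simp only [Function.comp_apply]
    rw [hAr, smul_smul, inv_mul_cancel₀ (hr _), one_smul]
  have hdet1 : (s⁻¹ • M).det = 1 := by
    refine tendsto_nhds_unique ((continuous_id.matrix_det.tendsto _).comp hglim) ?_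
    refine tendsto_const_nhds.congr fun j => ?_
    rw [Function.comp_apply, id, (g _).2]
  obtain ⟨G, hG⟩ : ∃ G : SL n, G.1 = s⁻¹ • M := ⟨⟨_, hdet1⟩, rfl⟩
  rw [← hG] at hglim
  have hglim' : Tendsto (fun j => g (φ (ψ j) + N)) atTop (𝓝 G) := tendsto_subtype_rng.2 hglim
  have hclosed : IsClosed (Γ : Set (SL n)) := Subgroup.isClosed_of_discrete
  have hmem : G ∈ Γ := hclosed.mem_of_tendsto hglim' (Eventually.of_forall fun j => hg _)
  refine ⟨⟨G, hmem⟩, ?_⟩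
  change G • x = y
  have h1 := smul_mem_cone_singleton (g := G) hvx
  rw [SL_smul_eq, hG, Matrix.smul_mulVec, hMv, smul_mem_cone_iff (inv_ne_zero hs0)] at h1
  exact eq_of_mem_cone h1 hwy

theorem orbit_subset (hΓ : Γ ≤ Aut Ω) {x : PSpace n} (hx : x ∈ Ω) :
    MulAction.orbit Γ x ⊆ Ω := by
  rintro _ ⟨⟨g, hg⟩, rfl⟩
  have := Set.smul_mem_smul_set (a := g) hx
  rwa [mem_Aut_iff.1 (hΓ hg)] at this

/-- Orbits are closed in `Ω`, and their limits on the boundary do not depend on the base point; a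
single orbit computes the limit set. -/
theorem limitSet_eq (hC : IsConeOver C k Ω) (hs : IsStrictlyConvex Ω) (hΓ : Γ ≤ Aut Ω)
    (hd : DiscreteTopology Γ) {x : PSpace n} (hx : x ∈ Ω) :
    limitSet Ω Γ = closure (MulAction.orbit Γ x) ∩ frontier Ω := by
  have hfr : frontier Ω = closure Ω \ Ω := hC.isOpen_domain.frontier_eq
  ext z
  simp only [limitSet, mem_iUnion, exists_prop]
  constructor
  · rintro ⟨y, hy, h1, h2⟩
    have hz : z ∈ frontier Ω := by
      rw [hfr]
      exact ⟨closure_mono (orbit_subset hΓ hy) h1,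
        fun hz => h2 (hC.mem_orbit_of_mem_closure hΓ hd hy hz h1)⟩
    exact ⟨hC.mem_closure_orbit_of_frontier hs hΓ hy hx hz h1, hz⟩
  · rintro ⟨h1, h2⟩
    refine ⟨x, hx, h1, fun h3 => ?_⟩
    rw [hfr] at h2
    exact h2.2 (orbit_subset hΓ hx h3)

theorem isClosed_limitSet (hC : IsConeOver C k Ω) (hs : IsStrictlyConvex Ω) (hΓ : Γ ≤ Aut Ω)
    (hd : DiscreteTopology Γ) : IsClosed (limitSet Ω Γ) := by
  obtain ⟨v, hv⟩ := hC.nonempty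
  have hx := mk_mem_of_mem_cone ((hC.mem_cone v).2 (Or.inl hv))
  rw [hC.limitSet_eq hs hΓ hd hx]
  exact isClosed_closure.inter isClosed_frontier

theorem limitSet_subset_frontier (hC : IsConeOver C k Ω) (hs : IsStrictlyConvex Ω)
    (hΓ : Γ ≤ Aut Ω) (hd : DiscreteTopology Γ) : limitSet Ω Γ ⊆ frontier Ω := by
  obtain ⟨v, hv⟩ := hC.nonempty
  have hx := mk_mem_of_mem_cone ((hC.mem_cone v).2 (Or.inl hv))
  rw [hC.limitSet_eq hs hΓ hd hx]
  exact inter_subset_right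

end IsConeOver

theorem smul_mem_limitSet {Ω : Set (PSpace n)} {Γ : Subgroup (SL n)} {g : SL n} (hg : g ∈ Γ)
    {z : PSpace n} (hz : z ∈ limitSet Ω Γ) : g • z ∈ limitSet Ω Γ := by
  simp only [limitSet, mem_iUnion, exists_prop] at hz ⊢
  obtain ⟨x, hx, h1, h2⟩ := hz
  refine ⟨x, hx, ?_, fun h3 => h2 ?_⟩
  · refine map_mem_closure (continuous_smul_pspace g) h1 ?_
    rintro _ ⟨⟨a, ha⟩, rfl⟩
    exact ⟨⟨g * a, Γ.mul_mem hg ha⟩, mul_smul g a x⟩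
  · obtain ⟨⟨a, ha⟩, h⟩ := h3
    refine ⟨⟨g⁻¹ * a, Γ.mul_mem (Γ.inv_mem hg) ha⟩, ?_⟩
    replace h : a • x = g • z := h
    change (g⁻¹ * a) • x = z
    rw [mul_smul, h, inv_smul_smul]


/-! ### Groups of area-preserving affine maps of the plane -/

/-- Let `A' = B A B⁻¹`; the hypothesis says that `A A'⁻¹` has trace at most `2`. For the
discriminant form, the traceless parts of `A` and `A'` are timelike vectors of equal norm in the
same half-cone, since `c c' > 0`. If distinct, their difference would be spacelike, whereas the
hypothesis makes its discriminant nonpositive. So `A = A'`. -/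
theorem commute_of_commutator_aux {a b c d P q r s : ℝ} (hA : a * d - b * c = 1)
    (hB : P * s - q * r = 1) (h1 : -2 < a + d) (h2 : a + d < 2)
    (h : a * (-(r * a + s * c) * q + (r * b + s * d) * P) - b * ((r * a + s * c) * s
      - (r * b + s * d) * r) - c * (-(P * a + q * c) * q + (P * b + q * d) * P)
      + d * ((P * a + q * c) * s - (P * b + q * d) * r) ≤ 2) :
    P * a + q * c = a * P + b * r ∧ P * b + q * d = a * q + b * s ∧
      r * a + s * c = c * P + d * r ∧ r * b + s * d = c * q + d * s := by
  obtain ⟨a', ha'⟩ : ∃ a', a' = (P * a + q * c) * s - (P * b + q * d) * r := ⟨_, rfl⟩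
  obtain ⟨b', hb'⟩ : ∃ b', b' = -(P * a + q * c) * q + (P * b + q * d) * P := ⟨_, rfl⟩
  obtain ⟨c', hc'⟩ : ∃ c', c' = (r * a + s * c) * s - (r * b + s * d) * r := ⟨_, rfl⟩
  obtain ⟨d', hd'⟩ : ∃ d', d' = -(r * a + s * c) * q + (r * b + s * d) * P := ⟨_, rfl⟩
  have hδ : 0 < 4 - (a + d) ^ 2 := by nlinarith
  have hbc : (d - a) ^ 2 + 4 * b * c = (a + d) ^ 2 - 4 := by linear_combination (-4) * hA
  have htr : a' + d' = a + d := by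
    rw [ha', hd']
    linear_combination (a + d) * hB
  have hdet : a' * d' - b' * c' = 1 := by
    have : a' * d' - b' * c' = (a * d - b * c) * (P * s - q * r) ^ 2 := by
      rw [ha', hb', hc', hd']; ring
    rw [this, hA, hB]
    norm_num
  have hbc' : (d' - a') ^ 2 + 4 * b' * c' = (a + d) ^ 2 - 4 := by
    rw [← htr]
    linear_combination (-4) * hdet
  have hc0 : c ≠ 0 := by
    rintro rfl
    nlinarith [sq_nonneg (d - a)]
  have hcc : 0 < c * c' := by
    have e : c * c' = (c * s + (a - d) / 2 * r) ^ 2 + r ^ 2 * ((4 - (a + d) ^ 2) / 4) := by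
      rw [hc']
      linear_combination (-r ^ 2 / 4) * hbc
    rw [e]
    rcases eq_or_ne r 0 with rfl | hr
    · have hs : s ≠ 0 := by
        rintro rfl
        norm_num at hB
      have : c * s ≠ 0 := mul_ne_zero hc0 hs
      have := sq_pos_of_ne_zero this
      nlinarith
    · have := sq_pos_of_ne_zero hr
      have := mul_pos this (by linarith : 0 < (4 - (a + d) ^ 2) / 4)
      positivity
  have hle : a * d' - b * c' - c * b' + d * a' ≤ 2 := by
    rw [ha', hb', hc', hd']
    exact h
  have hdisc : ((d - a) - (d' - a')) ^ 2 + 4 * (b - b') * (c - c') ≤ 0 := by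
    have e : ((d - a) - (d' - a')) ^ 2 + 4 * (b - b') * (c - c')
        = 4 * (a * d' - b * c' - c * b' + d * a') - 8 := by
      linear_combination hbc + hbc' + (-(a + d) * 2 ) * htr
    rw [e]
    linarith
  -- This sum of squares expresses that the difference of the traceless parts is spacelike or zero.
  have hsos : c * c' * (((d - a) - (d' - a')) ^ 2 + 4 * (b - b') * (c - c'))
      = (4 - (a + d) ^ 2) * (c - c') ^ 2 + ((d - a) * c' - (d' - a') * c) ^ 2 := by
    linear_combination (c' * (c - c')) * hbc - (c * (c - c')) * hbc'
  have hnonpos : (4 - (a + d) ^ 2) * (c - c') ^ 2 + ((d - a) * c' - (d' - a') * c) ^ 2 ≤ 0 := by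
    rw [← hsos]
    exact mul_nonpos_of_nonneg_of_nonpos hcc.le hdisc
  have hceq : c = c' := by
    by_contra hne
    have := sq_pos_of_ne_zero (sub_ne_zero.2 hne)
    have := mul_pos hδ this
    nlinarith [sq_nonneg ((d - a) * c' - (d' - a') * c)]
  have heeq : d - a = d' - a' := by
    have h1 : ((d - a) * c' - (d' - a') * c) ^ 2 ≤ 0 := by
      rw [hceq, sub_self] at hnonpos
      rw [hceq]
      nlinarith
    have h2 : (d - a) * c' - (d' - a') * c = 0 := by
      have := sq_nonneg ((d - a) * c' - (d' - a') * c)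
      exact pow_eq_zero_iff (two_ne_zero) |>.1 (le_antisymm h1 this)
    rw [← hceq] at h2
    have h3 : ((d - a) - (d' - a')) * c = 0 := by linear_combination h2
    rcases mul_eq_zero.1 h3 with h4 | h4
    · linarith
    · exact absurd h4 hc0
  have haeq : a = a' := by linarith
  have hdeq : d = d' := by linarith
  have hbeq : b = b' := by
    have : 4 * c * (b - b') = 0 := by
      rw [← hceq, ← heeq] at hbc'
      linear_combination hbc - hbc'
    rcases mul_eq_zero.1 this with h4 | h4
    · exact absurd h4 (by simpa using hc0)
    · linarith
  refine ⟨?_, ?_, ?_, ?_⟩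
  · linear_combination -(P * a + q * c) * hB - P * ha' - r * hb' - P * haeq - r * hbeq
  · linear_combination -(P * b + q * d) * hB - q * ha' - s * hb' - q * haeq - s * hbeq
  · linear_combination -(r * a + s * c) * hB - P * hc' - r * hd' - P * hceq - r * hdeq
  · linear_combination -(r * b + s * d) * hB - q * hc' - s * hd' - q * hceq - s * hdeq

/-- Two elements of `SL₂(ℝ)`, the first one elliptic, commute if their commutator is not
hyperbolic. -/
theorem commute_of_trace_commutator_le {A B : Matrix (Fin 2) (Fin 2) ℝ} (hA : A.det = 1)
    (hB : B.det = 1) (hA2 : |A.trace| < 2)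
    (h : (A * (B * A.adjugate * B.adjugate)).trace ≤ 2) : A * B = B * A := by
  rw [abs_lt, Matrix.trace_fin_two] at hA2
  simp only [Matrix.trace_fin_two, Matrix.adjugate_fin_two, Matrix.mul_apply, Fin.sum_univ_two,
    Matrix.of_apply, Matrix.cons_val', Matrix.cons_val_zero, Matrix.cons_val_one,
    Matrix.cons_val_fin_one] at h
  rw [Matrix.det_fin_two] at hA hB
  obtain ⟨h1, h2, h3, h4⟩ := commute_of_commutator_aux hA hB hA2.1 hA2.2
    (le_trans (le_of_eq (by ring)) h)
  ext i j
  fin_cases i <;> fin_cases j <;> simp [Matrix.mul_apply, Fin.sum_univ_two]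
  · exact h1.symm
  · exact h2.symm
  · exact h3.symm
  · exact h4.symm


/-- Groups of affine maps `y ↦ A y + c` of the plane with linear parts in `SL₂(ℝ)` that are
identities, central symmetries or elliptic. -/
structure IsEllipticAffineGroup (G : Set (Matrix (Fin 2) (Fin 2) ℝ × (Fin 2 → ℝ))) : Prop where
  one : (1, 0) ∈ G
  mul : ∀ A c B d, (A, c) ∈ G → (B, d) ∈ G → (A * B, A.mulVec d + c) ∈ G
  inv : ∀ A c, (A, c) ∈ G → (A.adjugate, -A.adjugate.mulVec c) ∈ G
  det : ∀ A c, (A, c) ∈ G → A.det = 1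
  trace : ∀ A c, (A, c) ∈ G → |A.trace| ≤ 2
  of_trace : ∀ A c, (A, c) ∈ G → A.trace = 2 → A = 1
  of_trace_neg : ∀ A c, (A, c) ∈ G → A.trace = -2 → A = -1

namespace IsEllipticAffineGroup

variable {G : Set (Matrix (Fin 2) (Fin 2) ℝ × (Fin 2 → ℝ))}

theorem eq_one_or_neg_one_or (hG : IsEllipticAffineGroup G) {A : Matrix (Fin 2) (Fin 2) ℝ}
    {c : Fin 2 → ℝ} (h : (A, c) ∈ G) : A = 1 ∨ A = -1 ∨ |A.trace| < 2 := by
  rcases (hG.trace A c h).lt_or_eq with h1 | h1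
  · exact Or.inr (Or.inr h1)
  · rcases (abs_eq (by norm_num : (0 : ℝ) ≤ 2)).1 h1 with h2 | h2
    · exact Or.inl (hG.of_trace A c h h2)
    · exact Or.inr (Or.inl (hG.of_trace_neg A c h h2))

theorem translation_int (hG : IsEllipticAffineGroup G) {c : Fin 2 → ℝ} (h : (1, c) ∈ G) (m : ℤ) :
    (1, (m : ℝ) • c) ∈ G := by
  have hnat : ∀ {c : Fin 2 → ℝ}, (1, c) ∈ G → ∀ m : ℕ, (1, (m : ℝ) • c) ∈ G := by
    intro c h m
    induction m with
    | zero => simpa using hG.one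
    | succ k ih =>
      have := hG.mul _ _ _ _ ih h
      rw [one_mul, Matrix.one_mulVec] at this
      convert this using 2
      push_cast
      rw [add_smul, one_smul, add_comm]
  have hneg : (1, -c) ∈ G := by simpa using hG.inv _ _ h
  obtain ⟨k, rfl | rfl⟩ := m.eq_nat_or_neg
  · simpa using hnat h k
  · simpa using hnat hneg k

theorem conj_translation (hG : IsEllipticAffineGroup G) {A : Matrix (Fin 2) (Fin 2) ℝ}
    {c d : Fin 2 → ℝ} (h : (A, c) ∈ G) (hd : (1, d) ∈ G) : (1, A.mulVec d) ∈ G := by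
  have h1 := hG.mul _ _ _ _ (hG.mul _ _ _ _ h hd) (hG.inv _ _ h)
  rw [mul_one, Matrix.mul_adjugate, hG.det _ _ h, one_smul, Matrix.mulVec_neg,
    Matrix.mulVec_mulVec, Matrix.mul_adjugate, hG.det _ _ h, one_smul, Matrix.one_mulVec] at h1
  convert h1 using 2
  abel

/-- Some compact set has translates under `G` that cover the closure of the convex hull of `Y`. -/
def CoversHull (G : Set (Matrix (Fin 2) (Fin 2) ℝ × (Fin 2 → ℝ))) (Y : Set (Fin 2 → ℝ)) : Prop :=
  ∃ D : Set (Fin 2 → ℝ), IsCompact D ∧ ∀ y ∈ closure (convexHull ℝ Y),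
    ∃ g ∈ G, ∃ z ∈ D, y = g.1.mulVec z + g.2

theorem coversHull_of_bounded (hG : IsEllipticAffineGroup G) {Y : Set (Fin 2 → ℝ)} {R : ℝ}
    (hY : ∀ y ∈ Y, ‖y‖ ≤ R) : CoversHull G Y := by
  refine ⟨Metric.closedBall 0 R, isCompact_closedBall 0 R, fun y hy => ⟨_, hG.one, y, ?_, by simp⟩⟩
  exact closure_minimal (convexHull_min (fun y hy => by simpa using hY y hy)
    (convex_closedBall 0 R)) Metric.isClosed_closedBall hy

/-- Two independent translations. -/
theorem coversHull_of_two_translations (hG : IsEllipticAffineGroup G) {c d : Fin 2 → ℝ}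
    (hc : (1, c) ∈ G) (hd : (1, d) ∈ G) (hcd : c 0 * d 1 - c 1 * d 0 ≠ 0) (Y : Set (Fin 2 → ℝ)) :
    CoversHull G Y := by
  refine ⟨(fun s : ℝ × ℝ => s.1 • c + s.2 • d) '' (Icc 0 1 ×ˢ Icc 0 1),
    (isCompact_Icc.prod isCompact_Icc).image (by fun_prop), fun y _ => ?_⟩
  set s := (y 0 * d 1 - y 1 * d 0) / (c 0 * d 1 - c 1 * d 0) with hs
  set t := (c 0 * y 1 - c 1 * y 0) / (c 0 * d 1 - c 1 * d 0) with ht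
  have hy : y = s • c + t • d := by
    ext i
    simp only [Pi.add_apply, Pi.smul_apply, smul_eq_mul, hs, ht]
    have es : s * (c 0 * d 1 - c 1 * d 0) = y 0 * d 1 - y 1 * d 0 := div_mul_cancel₀ _ hcd
    have et : t * (c 0 * d 1 - c 1 * d 0) = c 0 * y 1 - c 1 * y 0 := div_mul_cancel₀ _ hcd
    refine mul_right_cancel₀ hcd ?_
    rw [← hs, ← ht]
    fin_cases i
    · simp only [Fin.zero_eta]
      linear_combination (-(c 0)) * es - d 0 * et
    · simp only [Fin.mk_one]
      linear_combination (-(c 1)) * es - d 1 * et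
  have h1 := hG.mul _ _ _ _ (hG.translation_int hc ⌊s⌋) (hG.translation_int hd ⌊t⌋)
  rw [one_mul, Matrix.one_mulVec] at h1
  refine ⟨_, h1, Int.fract s • c + Int.fract t • d, ⟨(Int.fract s, Int.fract t),
    ⟨⟨Int.fract_nonneg _, (Int.fract_lt_one _).le⟩,
      ⟨Int.fract_nonneg _, (Int.fract_lt_one _).le⟩⟩, rfl⟩, ?_⟩
  rw [Matrix.one_mulVec]
  simp only
  nth_rewrite 1 [hy]
  nth_rewrite 1 [← Int.floor_add_fract s, ← Int.floor_add_fract t]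
  rw [add_smul, add_smul]
  abel

/-- All translations are parallel. -/
theorem coversHull_of_parallel (hG : IsEllipticAffineGroup G) {b : Fin 2 → ℝ}
    (hb : (1, b) ∈ G) (hb0 : b ≠ 0) (hpar : ∀ c, (1, c) ∈ G → b 0 * c 1 - b 1 * c 0 = 0)
    {Y : Set (Fin 2 → ℝ)} {R : ℝ}
    (hY : ∀ y ∈ Y, ∃ g ∈ G, ∃ z, ‖z‖ ≤ R ∧ y = g.1.mulVec z + g.2) : CoversHull G Y := by
  have hbb : 0 < b 0 ^ 2 + b 1 ^ 2 := by
    by_contra! hle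
    refine hb0 ?_
    ext i
    fin_cases i <;> simp <;> nlinarith [sq_nonneg (b 0), sq_nonneg (b 1)]
  have hA : ∀ A c, (A, c) ∈ G → A = 1 ∨ A = -1 := by
    intro A c h
    rcases hG.eq_one_or_neg_one_or h with h1 | h1 | h1
    · exact Or.inl h1
    · exact Or.inr h1
    · exfalso
      -- The translation by `A b` is parallel to `b`, so `b` would be a real eigenvector of an
      -- elliptic matrix; completing squares makes this contradictory.
      have h2 := hpar _ (hG.conj_translation h hb)
      have h3 := hG.det _ _ h
      rw [abs_lt, Matrix.trace_fin_two] at h1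
      rw [Matrix.det_fin_two] at h3
      simp only [Matrix.mulVec, dotProduct, Fin.sum_univ_two] at h2
      have h4 : 0 < 4 - (A 0 0 + A 1 1) ^ 2 := by nlinarith
      have e1 : (4 - (A 0 0 + A 1 1) ^ 2) * b 0 ^ 2
          + (2 * A 0 1 * b 1 - (A 1 1 - A 0 0) * b 0) ^ 2 = 0 := by
        linear_combination (-4 * b 0 ^ 2) * h3 - 4 * A 0 1 * h2
      have e2 : (4 - (A 0 0 + A 1 1) ^ 2) * b 1 ^ 2
          + (2 * A 1 0 * b 0 + (A 1 1 - A 0 0) * b 1) ^ 2 = 0 := by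
        linear_combination (-4 * b 1 ^ 2) * h3 + 4 * A 1 0 * h2
      have := mul_pos h4 hbb
      nlinarith [sq_nonneg (2 * A 0 1 * b 1 - (A 1 1 - A 0 0) * b 0),
        sq_nonneg (2 * A 1 0 * b 0 + (A 1 1 - A 0 0) * b 1)]
  set ω : (Fin 2 → ℝ) →ₗ[ℝ] ℝ := b 0 • LinearMap.proj 1 - b 1 • LinearMap.proj 0 with hω
  have hωv : ∀ y, ω y = b 0 * y 1 - b 1 * y 0 := fun y => by simp [hω]
  have hωc : Continuous ω := LinearMap.continuous_of_finiteDimensional ω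
  obtain ⟨B, hB⟩ : ∃ B, ∀ z : Fin 2 → ℝ, ‖z‖ ≤ R → |ω z| ≤ B := by
    obtain ⟨B, hB⟩ := ((isCompact_closedBall (0 : Fin 2 → ℝ) R).image
      hωc).isBounded.exists_norm_le
    exact ⟨B, fun z hz => hB _ ⟨z, by simpa using hz, rfl⟩⟩
  obtain ⟨E, hE⟩ : ∃ E, ∀ A c, (A, c) ∈ G → |ω c| ≤ E := by
    by_cases hex : ∃ c, (-1, c) ∈ G
    · obtain ⟨c₀, hc₀⟩ := hex
      refine ⟨|ω c₀|, fun A c h => ?_⟩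
      rcases hA A c h with rfl | rfl
      · rw [hωv, hpar c h]
        simp
      · have h1 := hpar _ (by simpa [Matrix.neg_mulVec] using hG.mul _ _ _ _ h hc₀)
        have h2 : ω c = ω c₀ := by
          rw [hωv, hωv]
          simp at h1
          linarith
        rw [h2]
    · refine ⟨0, fun A c h => ?_⟩
      rcases hA A c h with rfl | rfl
      · rw [hωv, hpar c h]
        simp
      · exact absurd ⟨c, h⟩ hex
  -- The group moves points boundedly in the direction transverse to `b`, so the set, and its closed
  -- convex hull, lie in a strip. The translation by `b` cuts the strip down to a compact piece.
  have hstrip : ∀ y ∈ closure (convexHull ℝ Y), |ω y| ≤ B + E := by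
    intro y hy
    rw [abs_le]
    refine closure_minimal (t := ω ⁻¹' Icc (-(B + E)) (B + E)) (convexHull_min ?_ ?_)
      (isClosed_Icc.preimage hωc) hy
    · intro y hy
      obtain ⟨⟨A, c⟩, hg, z, hz, rfl⟩ := hY y hy
      rw [mem_preimage, mem_Icc, ← abs_le]
      simp only
      rw [map_add]
      have h1 : |ω (A.mulVec z)| = |ω z| := by
        rcases hA A c hg with rfl | rfl
        · rw [Matrix.one_mulVec]
        · rw [Matrix.neg_mulVec, Matrix.one_mulVec, map_neg, abs_neg]
      refine (abs_add_le _ _).trans ?_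
      rw [h1]
      exact add_le_add (hB z hz) (hE A c hg)
    · exact (convex_Icc _ _).linear_preimage ω
  set σ : (Fin 2 → ℝ) →ₗ[ℝ] ℝ := b 0 • LinearMap.proj 0 + b 1 • LinearMap.proj 1 with hσ
  have hσv : ∀ y, σ y = b 0 * y 0 + b 1 * y 1 := fun y => by simp [hσ]
  have hσc : Continuous σ := LinearMap.continuous_of_finiteDimensional σ
  have hcoord : ∀ y : Fin 2 → ℝ, y = (ω y / (b 0 ^ 2 + b 1 ^ 2)) • ![-b 1, b 0]
      + (σ y / (b 0 ^ 2 + b 1 ^ 2)) • b := by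
    intro y
    ext i
    simp only [Pi.add_apply, Pi.smul_apply, smul_eq_mul, hωv, hσv]
    fin_cases i <;> simp <;> field_simp <;> ring
  refine ⟨(fun s : ℝ × ℝ => (s.1 / (b 0 ^ 2 + b 1 ^ 2)) • ![-b 1, b 0] + s.2 • b) ''
    (Icc (-(B + E)) (B + E) ×ˢ Icc 0 1),
    (isCompact_Icc.prod isCompact_Icc).image (by fun_prop), fun y hy => ?_⟩
  set t := σ y / (b 0 ^ 2 + b 1 ^ 2) with ht
  refine ⟨_, hG.translation_int hb ⌊t⌋, _, ⟨(ω y, Int.fract t),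
    ⟨abs_le.1 (hstrip y hy), ⟨Int.fract_nonneg _, (Int.fract_lt_one _).le⟩⟩, rfl⟩, ?_⟩
  rw [Matrix.one_mulVec]
  simp only
  nth_rewrite 1 [hcoord y]
  rw [← ht]
  nth_rewrite 1 [← Int.floor_add_fract t]
  rw [add_smul]
  abel

/-- No translations, but an elliptic element: the group fixes a point and is bounded. -/
theorem exists_bound_of_elliptic (hG : IsEllipticAffineGroup G) (hno : ∀ c, (1, c) ∈ G → c = 0)
    {A₀ : Matrix (Fin 2) (Fin 2) ℝ} {c₀ : Fin 2 → ℝ} (h₀ : (A₀, c₀) ∈ G) (ht : |A₀.trace| < 2)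
    (R : ℝ) : ∃ R', ∀ g ∈ G, ∀ z, ‖z‖ ≤ R → ‖g.1.mulVec z + g.2‖ ≤ R' := by
  have hA0 := hG.det _ _ h₀
  have ht' := ht
  rw [abs_lt, Matrix.trace_fin_two] at ht'
  have hA0' := hA0
  rw [Matrix.det_fin_two] at hA0'
  set δ := 4 - (A₀ 0 0 + A₀ 1 1) ^ 2 with hδ
  have hδpos : 0 < δ := by nlinarith
  -- This determinant is `2 - tr A₀`, so the elliptic element has a unique fixed point `x₀`.
  have hN : (1 - A₀).det ≠ 0 := by
    rw [Matrix.det_fin_two]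
    simp only [Matrix.sub_apply, Matrix.one_apply_eq, ne_eq, Fin.isValue, zero_ne_one,
      not_false_eq_true, Matrix.one_apply_ne, zero_sub, one_ne_zero]
    nlinarith
  have hu : IsUnit (1 - A₀).det := isUnit_iff_ne_zero.2 hN
  set x₀ := (1 - A₀)⁻¹.mulVec c₀ with hx₀
  have hfix : A₀.mulVec x₀ + c₀ = x₀ := by
    have : (1 - A₀).mulVec x₀ = c₀ := by
      rw [hx₀, Matrix.mulVec_mulVec, Matrix.mul_nonsing_inv _ hu, Matrix.one_mulVec]
    rw [Matrix.sub_mulVec, Matrix.one_mulVec] at this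
    rw [add_comm, ← eq_sub_iff_add_eq]
    exact this.symm
  have hA₀x : A₀.mulVec x₀ = x₀ - c₀ := eq_sub_of_add_eq hfix
  have huniq : ∀ y, A₀.mulVec y + c₀ = y → y = x₀ := by
    intro y hy
    have h1 : (1 - A₀).mulVec (y - x₀) = 0 := by
      rw [Matrix.sub_mulVec, Matrix.one_mulVec, Matrix.mulVec_sub]
      nth_rewrite 1 [← hy]
      nth_rewrite 1 [← hfix]
      abel
    have h2 := congrArg ((1 - A₀)⁻¹.mulVec) h1
    rw [Matrix.mulVec_mulVec, Matrix.nonsing_inv_mul _ hu, Matrix.one_mulVec,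
      Matrix.mulVec_zero] at h2
    exact sub_eq_zero.1 h2
  have hcomm : ∀ B d, (B, d) ∈ G → A₀ * B = B * A₀ ∧ B.mulVec x₀ + d = x₀ := by
    intro B d h
    have hB := hG.det _ _ h
    -- The commutator lies in the group, so its trace is at most `2` and the linear parts commute.
    -- It is then a translation, hence trivial, and the affine maps themselves commute.
    have h1 := hG.mul _ _ _ _ (hG.mul _ _ _ _ (hG.mul _ _ _ _ h₀ h) (hG.inv _ _ h₀))
      (hG.inv _ _ h)
    have hAB : A₀ * B = B * A₀ := by
      refine commute_of_trace_commutator_le hA0 hB ht ?_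
      have := (abs_le.1 (hG.trace _ _ h1)).2
      rwa [mul_assoc, mul_assoc, ← mul_assoc B] at this
    refine ⟨hAB, huniq _ ?_⟩
    have e1 : A₀ * B * A₀.adjugate * B.adjugate = 1 := by
      rw [hAB, mul_assoc B, Matrix.mul_adjugate, hA0, one_smul, mul_one, Matrix.mul_adjugate, hB,
        one_smul]
    rw [e1] at h1
    have h2 := hno _ h1
    have e2 : A₀ * B * A₀.adjugate = B := by
      rw [hAB, mul_assoc B, Matrix.mul_adjugate, hA0, one_smul, mul_one]
    rw [e2, Matrix.mulVec_neg, Matrix.mulVec_mulVec, Matrix.mul_adjugate, hB, one_smul,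
      Matrix.one_mulVec, Matrix.mulVec_neg, Matrix.mulVec_mulVec, e2] at h2
    rw [Matrix.mulVec_add, Matrix.mulVec_mulVec, hAB, ← Matrix.mulVec_mulVec, hA₀x,
      Matrix.mulVec_sub]
    have h3 : A₀.mulVec d + c₀ = B.mulVec c₀ + d := by
      have : (A₀.mulVec d + c₀) - (B.mulVec c₀ + d) = 0 := by
        rw [← h2]
        abel
      exact sub_eq_zero.1 this
    rw [add_assoc, h3]
    abel
  -- `q z` is the determinant of `(z, A₀ z)`. It is invariant under the matrices of determinant `1`
  -- that commute with `A₀`, and it is definite because `A₀` is elliptic.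
  set q : (Fin 2 → ℝ) → ℝ := fun z => A₀ 1 0 * z 0 ^ 2 + (A₀ 1 1 - A₀ 0 0) * z 0 * z 1
    - A₀ 0 1 * z 1 ^ 2 with hq
  have hqinv : ∀ B d, (B, d) ∈ G → ∀ z, q (B.mulVec z) = q z := by
    intro B d h z
    have hB := hG.det _ _ h
    obtain ⟨hAB, -⟩ := hcomm B d h
    rw [Matrix.det_fin_two] at hB
    have e := fun i j => congrFun (congrFun hAB i) j
    simp only [Matrix.mul_apply, Fin.sum_univ_two] at e
    have e00 := e 0 0
    have e01 := e 0 1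
    have e10 := e 1 0
    have e11 := e 1 1
    simp only [hq, Matrix.mulVec, dotProduct, Fin.sum_univ_two]
    linear_combination ((B 0 0 * z 0 + B 0 1 * z 1) * z 0) * e10
      + ((B 0 0 * z 0 + B 0 1 * z 1) * z 1) * e11 - ((B 1 0 * z 0 + B 1 1 * z 1) * z 0) * e00
      - ((B 1 0 * z 0 + B 1 1 * z 1) * z 1) * e01
      + (A₀ 1 0 * z 0 ^ 2 + (A₀ 1 1 - A₀ 0 0) * z 0 * z 1 - A₀ 0 1 * z 1 ^ 2) * hB
  have hq0 : ∀ z, δ * z 1 ^ 2 ≤ 4 * A₀ 1 0 * q z := by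
    intro z
    have : 4 * A₀ 1 0 * q z = (2 * A₀ 1 0 * z 0 + (A₀ 1 1 - A₀ 0 0) * z 1) ^ 2 + δ * z 1 ^ 2 := by
      simp only [hq, hδ]
      linear_combination (4 * z 1 ^ 2) * hA0'
    rw [this]
    nlinarith [sq_nonneg (2 * A₀ 1 0 * z 0 + (A₀ 1 1 - A₀ 0 0) * z 1)]
  have hq1 : ∀ z, δ * z 0 ^ 2 ≤ -4 * A₀ 0 1 * q z := by
    intro z
    have : -4 * A₀ 0 1 * q z = (2 * A₀ 0 1 * z 1 - (A₀ 1 1 - A₀ 0 0) * z 0) ^ 2 + δ * z 0 ^ 2 := by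
      simp only [hq, hδ]
      linear_combination (4 * z 0 ^ 2) * hA0'
    rw [this]
    nlinarith [sq_nonneg (2 * A₀ 0 1 * z 1 - (A₀ 1 1 - A₀ 0 0) * z 0)]
  obtain ⟨Q, hQ⟩ : ∃ Q, ∀ z : Fin 2 → ℝ, ‖z‖ ≤ R → |q (z - x₀)| ≤ Q := by
    have hqc : Continuous fun z => q (z - x₀) := by
      simp only [hq]
      fun_prop
    obtain ⟨B, hB⟩ := ((isCompact_closedBall (0 : Fin 2 → ℝ) R).image
      hqc).isBounded.exists_norm_le
    exact ⟨B, fun z hz => hB _ ⟨z, by simpa using hz, rfl⟩⟩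
  set S := (4 * (|A₀ 1 0| + |A₀ 0 1|) * |Q|) / δ with hS
  have hbound : ∀ w : Fin 2 → ℝ, |q w| ≤ Q → ‖w‖ ≤ S + 1 := by
    intro w hw
    have hw' : |q w| ≤ |Q| := hw.trans (le_abs_self Q)
    have hm : ∀ i, w i ^ 2 ≤ S := by
      intro i
      rw [hS, le_div_iff₀ hδpos]
      have a1 : 4 * A₀ 1 0 * q w ≤ 4 * |A₀ 1 0| * |Q| := by
        calc 4 * A₀ 1 0 * q w ≤ |4 * A₀ 1 0 * q w| := le_abs_self _
          _ = 4 * |A₀ 1 0| * |q w| := by rw [abs_mul, abs_mul]; norm_num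
          _ ≤ _ := by gcongr
      have a2 : -4 * A₀ 0 1 * q w ≤ 4 * |A₀ 0 1| * |Q| := by
        calc -4 * A₀ 0 1 * q w ≤ |-4 * A₀ 0 1 * q w| := le_abs_self _
          _ = 4 * |A₀ 0 1| * |q w| := by rw [abs_mul, abs_mul]; norm_num
          _ ≤ _ := by gcongr
      have a3 : 0 ≤ 4 * |A₀ 1 0| * |Q| := by positivity
      have a4 : 0 ≤ 4 * |A₀ 0 1| * |Q| := by positivity
      fin_cases i
      · have := hq1 w
        simp only [Fin.zero_eta]
        linarith
      · have := hq0 w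
        simp only [Fin.mk_one]
        linarith
    have hS0 : 0 ≤ S := (sq_nonneg _).trans (hm 0)
    rw [pi_norm_le_iff_of_nonneg (by linarith)]
    intro i
    rw [Real.norm_eq_abs]
    refine abs_le_of_sq_le_sq ?_ (by linarith)
    nlinarith [hm i]
  refine ⟨S + 1 + ‖x₀‖, ?_⟩
  rintro ⟨B, d⟩ h z hz
  have h1 : B.mulVec z + d = B.mulVec (z - x₀) + x₀ := by
    have hd : d = x₀ - B.mulVec x₀ := by
      rw [eq_sub_iff_add_eq, add_comm]
      exact (hcomm B d h).2
    rw [hd, Matrix.mulVec_sub]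
    abel
  simp only
  rw [h1]
  refine (norm_add_le _ _).trans ?_
  gcongr
  refine hbound _ ?_
  rw [hqinv B d h]
  exact hQ z hz

/-- If a set is covered by the translates of a ball, then the closure of its convex hull is covered
by the translates of a compact set. -/
theorem coversHull (hG : IsEllipticAffineGroup G) {Y : Set (Fin 2 → ℝ)} {R : ℝ}
    (hY : ∀ y ∈ Y, ∃ g ∈ G, ∃ z, ‖z‖ ≤ R ∧ y = g.1.mulVec z + g.2) : CoversHull G Y := by
  by_cases hno : ∀ c, (1, c) ∈ G → c = 0
  · have hbd : ∃ R', ∀ g ∈ G, ∀ z, ‖z‖ ≤ R → ‖g.1.mulVec z + g.2‖ ≤ R' := by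
      by_cases hell : ∃ A c, (A, c) ∈ G ∧ |A.trace| < 2
      · obtain ⟨A, c, h, ht⟩ := hell
        exact hG.exists_bound_of_elliptic hno h ht R
      · push Not at hell
        have hA : ∀ A c, (A, c) ∈ G → A = 1 ∨ A = -1 := by
          intro A c h
          rcases hG.eq_one_or_neg_one_or h with h1 | h1 | h1
          · exact Or.inl h1
          · exact Or.inr h1
          · exact absurd (hell A c h) (not_le.2 h1)
        by_cases hex : ∃ c, (-1, c) ∈ G
        · obtain ⟨c₀, hc₀⟩ := hex
          refine ⟨R + ‖c₀‖, ?_⟩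
          rintro ⟨A, c⟩ h z hz
          rcases hA A c h with rfl | rfl
          · have := hno c h
            subst this
            simp only [Matrix.one_mulVec, add_zero]
            linarith [norm_nonneg c₀]
          · have h1 := hno _ (by simpa [Matrix.neg_mulVec] using hG.mul _ _ _ _ h hc₀)
            have h2 : c = c₀ := by
              rw [neg_add_eq_zero] at h1
              exact h1.symm
            subst h2
            simp only [Matrix.neg_mulVec, Matrix.one_mulVec]
            refine (norm_add_le _ _).trans ?_
            rw [norm_neg]
            gcongr
        · refine ⟨R, ?_⟩
          rintro ⟨A, c⟩ h z hz
          rcases hA A c h with rfl | rfl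
          · have := hno c h
            subst this
            simpa using hz
          · exact absurd ⟨c, h⟩ hex
    obtain ⟨R', hR'⟩ := hbd
    refine hG.coversHull_of_bounded (R := R') fun y hy => ?_
    obtain ⟨g, hg, z, hz, rfl⟩ := hY y hy
    exact hR' g hg z hz
  · push Not at hno
    obtain ⟨b, hb, hb0⟩ := hno
    by_cases hpar : ∀ c, (1, c) ∈ G → b 0 * c 1 - b 1 * c 0 = 0
    · exact hG.coversHull_of_parallel hb hb0 hpar hY
    · push Not at hpar
      obtain ⟨c, hc, hbc⟩ := hpar
      exact hG.coversHull_of_two_translations hb hc hbc Y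

end IsEllipticAffineGroup


/-! ### The affine plane of the lines through a boundary point -/

/-- The vector of last coordinate `1` above the point `y` of the plane. -/
def planeVec (b : Module.Basis (Fin 4) ℝ (Vec 3)) (y : Fin 2 → ℝ) : Vec 3 :=
  y 0 • b 1 + y 1 • b 2 + b 3

/-- The point of the plane below the vector `v`. -/
def planePt (b : Module.Basis (Fin 4) ℝ (Vec 3)) (f : Vec 3 →ₗ[ℝ] ℝ) (v : Vec 3) : Fin 2 → ℝ :=
  (f v)⁻¹ • ![b.repr v 1, b.repr v 2]

/-- The translation part of the action of `T` on the plane. -/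
def transPart (b : Module.Basis (Fin 4) ℝ (Vec 3)) (T : Vec 3 ≃ₗ[ℝ] Vec 3) : Fin 2 → ℝ :=
  ![mat b T 1 3, mat b T 2 3]

section Plane

variable {p : Vec 3} {f : Vec 3 →ₗ[ℝ] ℝ} {b : Module.Basis (Fin 4) ℝ (Vec 3)}

theorem continuous_planeVec (b : Module.Basis (Fin 4) ℝ (Vec 3)) : Continuous (planeVec b) := by
  unfold planeVec
  fun_prop

theorem repr_planeVec (b : Module.Basis (Fin 4) ℝ (Vec 3)) (y : Fin 2 → ℝ) :
    b.repr (planeVec b y) 0 = 0 ∧ b.repr (planeVec b y) 1 = y 0 ∧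
      b.repr (planeVec b y) 2 = y 1 ∧ b.repr (planeVec b y) 3 = 1 := by
  simp [planeVec]

theorem IsCuspBasis.f_planeVec (hb : IsCuspBasis p f b) (y : Fin 2 → ℝ) : f (planeVec b y) = 1 := by
  rw [← hb.coord, (repr_planeVec b y).2.2.2]

theorem IsCuspBasis.f_p (hb : IsCuspBasis p f b) : f p = 0 := by
  rw [← hb.coord, ← hb.zero, b.repr_self]
  simp

theorem IsCuspBasis.f_planeVec_add (hb : IsCuspBasis p f b) (y : Fin 2 → ℝ) (τ : ℝ) :
    f (planeVec b y + τ • p) = 1 := by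
  rw [map_add, map_smul, hb.f_p, hb.f_planeVec, smul_zero, add_zero]

theorem IsCuspBasis.repr_p (hb : IsCuspBasis p f b) :
    b.repr p 0 = 1 ∧ b.repr p 1 = 0 ∧ b.repr p 2 = 0 := by
  rw [← hb.zero]
  simp

theorem IsCuspBasis.planePt_planeVec (hb : IsCuspBasis p f b) (y : Fin 2 → ℝ) (τ : ℝ) :
    planePt b f (planeVec b y + τ • p) = y := by
  obtain ⟨h0, h1, h2⟩ := hb.repr_p
  obtain ⟨k0, k1, k2, k3⟩ := repr_planeVec b y
  unfold planePt
  rw [hb.f_planeVec_add, inv_one, one_smul, map_add, map_smul, Finsupp.add_apply, Finsupp.add_apply,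
    Finsupp.smul_apply, Finsupp.smul_apply, h1, h2, k1, k2]
  ext i
  fin_cases i <;> simp

theorem IsCuspBasis.eq_planeVec (hb : IsCuspBasis p f b) {v : Vec 3} (hv : f v ≠ 0) :
    v = f v • planeVec b (planePt b f v) + b.repr v 0 • p := by
  rw [← hb.zero]
  apply b.ext_elem
  intro i
  obtain ⟨k0, k1, k2, k3⟩ := repr_planeVec b (planePt b f v)
  rw [b.repr.map_add, b.repr.map_smul, b.repr.map_smul, b.repr_self, Finsupp.add_apply,
    Finsupp.smul_apply, Finsupp.smul_apply]
  fin_cases i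
  · simp [k0]
  · simp only [Fin.mk_one]; rw [k1]; simp [planePt, hv]
  · simp only [Fin.reduceFinMk]; rw [k2]; simp [planePt, hv]
  · simp [k3, hb.coord]

theorem IsCuspBasis.eq_planeVec_of_f_eq_one (hb : IsCuspBasis p f b) {v : Vec 3} (hv : f v = 1) :
    v = planeVec b (planePt b f v) + b.repr v 0 • p := by
  conv_lhs => rw [hb.eq_planeVec (v := v) (by rw [hv]; exact one_ne_zero), hv, one_smul]

theorem planePt_smul {v : Vec 3} {r : ℝ} (hr : r ≠ 0) : planePt b f (r • v) = planePt b f v := by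
  unfold planePt
  ext i
  fin_cases i <;> simp <;> field_simp

theorem IsCuspAut.planePt_apply {C : Set (Vec 3)} {T : Vec 3 ≃ₗ[ℝ] Vec 3} (hT : IsCuspAut C p f T)
    (hb : IsCuspBasis p f b) {v : Vec 3} (hv : f v ≠ 0) :
    planePt b f (T v) = (linPart b T).mulVec (planePt b f v) + transPart b T := by
  unfold planePt
  rw [hT.map_f, hT.repr_one hb, hT.repr_two hb]
  ext i
  fin_cases i <;> simp [linPart, transPart] <;> field_simp

theorem continuousOn_planePt (b : Module.Basis (Fin 4) ℝ (Vec 3)) (f : Vec 3 →ₗ[ℝ] ℝ) :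
    ContinuousOn (planePt b f) {v | f v ≠ 0} := by
  have hfc : Continuous f := LinearMap.continuous_of_finiteDimensional f
  have h1 : Continuous fun v : Vec 3 => b.repr v 1 :=
    LinearMap.continuous_of_finiteDimensional (b.coord 1)
  have h2 : Continuous fun v : Vec 3 => b.repr v 2 :=
    LinearMap.continuous_of_finiteDimensional (b.coord 2)
  unfold planePt
  refine (hfc.continuousOn.inv₀ fun v hv => hv).smul (Continuous.continuousOn ?_)
  refine continuous_pi fun i => ?_
  fin_cases i
  · exact h1
  · exact h2

theorem mkQ_ne_zero_of_f {x : PSpace 3} (hp : p ∈ cone {x}) (hb : IsCuspBasis p f b) {v : Vec 3}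
    (hv : f v ≠ 0) : x.submodule.mkQ v ≠ 0 := by
  intro h
  rw [Submodule.mkQ_apply, Submodule.Quotient.mk_eq_zero, eq_mk_of_mem_cone hp,
    Projectivization.submodule_mk, Submodule.mem_span_singleton] at h
  obtain ⟨a, rfl⟩ := h
  rw [map_smul, hb.f_p, smul_zero] at hv
  exact hv rfl

theorem mkQ_p {x : PSpace 3} (hp : p ∈ cone {x}) : x.submodule.mkQ p = 0 := by
  rw [Submodule.mkQ_apply, Submodule.Quotient.mk_eq_zero, eq_mk_of_mem_cone hp,
    Projectivization.submodule_mk]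
  exact Submodule.mem_span_singleton_self p

/-- The line through `x` above the point `y` of the plane. -/
def planeLine {x : PSpace 3} (hp : p ∈ cone {x}) (hb : IsCuspBasis p f b) (y : Fin 2 → ℝ) :
    LinesThrough x :=
  Projectivization.mk ℝ (x.submodule.mkQ (planeVec b y))
    (mkQ_ne_zero_of_f hp hb (by rw [hb.f_planeVec]; exact one_ne_zero))

variable {x : PSpace 3} (hp : p ∈ cone {x}) (hb : IsCuspBasis p f b)

theorem isLineTo_planeLine_iff {v : Vec 3} {y : Fin 2 → ℝ} :
    IsLineTo x v (planeLine hp hb y) ↔ f v ≠ 0 ∧ planePt b f v = y := by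
  constructor
  · rintro ⟨h, hl⟩
    obtain ⟨a, ha⟩ := (Projectivization.mk_eq_mk_iff ℝ _ _ _ _).1 hl
    have h1 : (a : ℝ) • v - planeVec b y ∈ x.submodule := by
      rw [← Submodule.Quotient.mk_eq_zero, ← Submodule.mkQ_apply, map_sub, map_smul, sub_eq_zero]
      exact ha
    rw [eq_mk_of_mem_cone hp, Projectivization.submodule_mk, Submodule.mem_span_singleton] at h1
    obtain ⟨c, hc⟩ := h1
    have h2 : (a : ℝ) • v = planeVec b y + c • p := by rw [hc]; abel
    have h3 : f ((a : ℝ) • v) = 1 := by rw [h2, hb.f_planeVec_add]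
    refine ⟨fun h0 => ?_, ?_⟩
    · rw [map_smul, h0, smul_zero] at h3
      exact zero_ne_one h3
    · rw [← planePt_smul a.ne_zero, h2, hb.planePt_planeVec]
  · rintro ⟨h, rfl⟩
    refine ⟨mkQ_ne_zero_of_f hp hb h, ?_⟩
    refine (Projectivization.mk_eq_mk_iff' ℝ _ _ _ _).2 ⟨(f v)⁻¹, ?_⟩
    have e := congrArg x.submodule.mkQ (hb.eq_planeVec h)
    rw [map_add, map_smul, map_smul, mkQ_p hp, smul_zero, add_zero] at e
    rw [e, smul_smul, inv_mul_cancel₀ h, one_smul]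

theorem planeLine_injective : Function.Injective (planeLine hp hb) := by
  intro y z h
  have h1 : IsLineTo x (planeVec b y) (planeLine hp hb y) := ⟨_, rfl⟩
  rw [h] at h1
  have h2 := ((isLineTo_planeLine_iff hp hb).1 h1).2
  have h3 := hb.planePt_planeVec y 0
  rw [zero_smul, add_zero] at h3
  rw [← h2, h3]

theorem eq_planeLine {v : Vec 3} {l : LinesThrough x} (h : IsLineTo x v l) (hv : f v ≠ 0) :
    l = planeLine hp hb (planePt b f v) := by
  obtain ⟨h0, rfl⟩ := h
  obtain ⟨h1, h2⟩ := (isLineTo_planeLine_iff hp hb).2 ⟨hv, rfl⟩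
  exact h2.symm

/-- The plane is an open affine chart of the space of lines through `x`, so closures relative to the
affine space of these lines can be computed in `ℝ²`. -/
theorem isOpenEmbedding_planeLine : IsOpenEmbedding (planeLine hp hb) := by
  have hc : Continuous (planeLine hp hb) :=
    continuous_mk_comp (u := fun y => x.submodule.mkQ (planeVec b y))
      ((Submodule.continuous_mkQ _).comp (continuous_planeVec b)) _
  refine .of_continuous_injective_isOpenMap hc (planeLine_injective hp hb) fun U hU => ?_
  have hfc : Continuous f := LinearMap.continuous_of_finiteDimensional f
  have hW : IsOpen ({v | f v ≠ 0} ∩ planePt b f ⁻¹' U) :=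
    (continuousOn_planePt b f).isOpen_inter_preimage (isOpen_ne.preimage hfc) hU
  have hW' : IsOpen (x.submodule.mkQ '' ({v | f v ≠ 0} ∩ planePt b f ⁻¹' U)) :=
    Submodule.isOpenMap_mkQ _ _ hW
  have h := isOpenMap_projMk _ (hW'.preimage (continuous_subtype_val (p := fun v => v ≠ 0)))
  convert h using 1
  ext l
  constructor
  · rintro ⟨y, hy, rfl⟩
    refine ⟨⟨x.submodule.mkQ (planeVec b y), mkQ_ne_zero_of_f hp hb
      (by rw [hb.f_planeVec]; exact one_ne_zero)⟩, ⟨planeVec b y, ⟨?_, ?_⟩, rfl⟩, rfl⟩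
    · simp [hb.f_planeVec]
    · have h3 := hb.planePt_planeVec y 0
      rw [zero_smul, add_zero] at h3
      rwa [mem_preimage, h3]
  · rintro ⟨⟨q, hq⟩, ⟨v, ⟨hv, hvU⟩, rfl⟩, rfl⟩
    exact ⟨_, hvU, (eq_planeLine hp hb ⟨hq, rfl⟩ hv).symm⟩

end Plane

/-! ### The boundary as a graph over the plane -/

/-- The boundary of the cone is the graph of `height` over the plane. -/
def height (C : Set (Vec 3)) (p : Vec 3) (b : Module.Basis (Fin 4) ℝ (Vec 3)) (y : Fin 2 → ℝ) : ℝ :=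
  sInf {τ : ℝ | planeVec b y + τ • p ∈ C}

namespace IsCuspOf

variable {Ω : Set (PSpace 3)} {x : PSpace 3} {C : Set (Vec 3)} {k : Vec 3 →ₗ[ℝ] ℝ}
  {p : Vec 3} {f : Vec 3 →ₗ[ℝ] ℝ} {b : Module.Basis (Fin 4) ℝ (Vec 3)}

theorem bddBelow_height (h : IsCuspOf Ω x C k p f b) (y : Fin 2 → ℝ) :
    BddBelow {τ : ℝ | planeVec b y + τ • p ∈ C} := by
  obtain ⟨h0, h1, h2⟩ := h.basis.repr_p
  obtain ⟨c, hc⟩ := h.cusp.superlinear (b.coord 0) (by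
    rw [Module.Basis.coord_apply, h0]; exact one_pos)
  refine ⟨-c, fun τ hτ => ?_⟩
  have := hc _ hτ
  rw [h.basis.f_planeVec_add, Module.Basis.coord_apply, map_add, map_smul, Finsupp.add_apply,
    Finsupp.smul_apply, h0, (repr_planeVec b y).1] at this
  simp only [smul_eq_mul, mul_one, zero_add] at this
  linarith

/-- The cone is open and stable under adding positive multiples of `p`, so it meets each vertical
line in an open upper half-line. -/
theorem planeVec_mem_iff (h : IsCuspOf Ω x C k p f b) {y : Fin 2 → ℝ} {τ : ℝ} :
    planeVec b y + τ • p ∈ C ↔ height C p b y < τ := by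
  constructor
  · intro hτ
    obtain ⟨ε, hε, hm⟩ := h.isCone.exists_add_smul_mem hτ (-p)
    rw [smul_neg, add_assoc, ← sub_eq_add_neg, ← sub_smul] at hm
    have : height C p b y ≤ τ - ε := csInf_le (h.bddBelow_height y) hm
    linarith
  · intro hlt
    have hne : {τ : ℝ | planeVec b y + τ • p ∈ C}.Nonempty :=
      h.cusp.full _ (by rw [h.basis.f_planeVec]; exact one_pos)
    obtain ⟨σ, hσ, hlt'⟩ := (csInf_lt_iff (h.bddBelow_height y) hne).1 hlt
    have := h.add_smul_mem hσ (τ := τ - σ) (by linarith)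
    rwa [add_assoc, ← add_smul, add_sub_cancel] at this

theorem planeVec_mem_closure_iff (h : IsCuspOf Ω x C k p f b) {y : Fin 2 → ℝ} {τ : ℝ} :
    planeVec b y + τ • p ∈ closure C ↔ height C p b y ≤ τ := by
  constructor
  · intro hτ
    refine le_of_forall_pos_lt_add fun ε hε => ?_
    have hne : planeVec b y + (τ + ε) • p ∈ C := by
      -- Mixing the boundary vector with a high interior vector, with weight `ε / (M + ε)` on the
      -- latter, gives a vector of `C` whose height stays below `τ + ε`.
      set M := |height C p b y + 1 - τ| + 1 with hM
      have hMpos : 0 < M := by positivity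
      have h2 : planeVec b y + (τ + M) • p ∈ C := by
        rw [h.planeVec_mem_iff]
        have := le_abs_self (height C p b y + 1 - τ)
        linarith
      have hs : 0 < ε / (M + ε) := by positivity
      have hs' : 0 < M / (M + ε) := by positivity
      have h3 := h.isCone.add_closure_mem (h.isCone.smul_mem _ h2 _ hs)
        (h.isCone.closure_smul_mem hτ hs')
      have h4 : (ε / (M + ε)) • (planeVec b y + (τ + M) • p)
          + (M / (M + ε)) • (planeVec b y + τ • p)
          = planeVec b y + (τ + ε * M / (M + ε)) • p := by
        have e1 : ε / (M + ε) + M / (M + ε) = 1 := by field_simp; ring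
        have e2 : ε / (M + ε) * (τ + M) + M / (M + ε) * τ = τ + ε * M / (M + ε) := by
          field_simp
          ring
        rw [smul_add, smul_add, smul_smul, smul_smul, add_add_add_comm, ← add_smul, ← add_smul, e1,
          e2, one_smul]
      rw [h4] at h3
      have h5 := h.add_smul_mem h3 (τ := ε - ε * M / (M + ε)) (by
        rw [sub_nonneg, div_le_iff₀ (by positivity)]
        nlinarith)
      rwa [add_assoc, ← add_smul, show τ + ε * M / (M + ε) + (ε - ε * M / (M + ε)) = τ + ε by ring]
        at h5
    exact h.planeVec_mem_iff.1 hne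
  · intro hle
    have hlim : Tendsto (fun ε : ℝ => planeVec b y + (τ + ε) • p) (𝓝[>] 0)
        (𝓝 (planeVec b y + τ • p)) := by
      have : Continuous fun ε : ℝ => planeVec b y + (τ + ε) • p := by fun_prop
      simpa using (this.tendsto 0).mono_left nhdsWithin_le_nhds
    refine mem_closure_of_tendsto hlim ?_
    filter_upwards [self_mem_nhdsWithin] with ε hε
    rw [h.planeVec_mem_iff]
    have : (0 : ℝ) < ε := hε
    linarith

/-- The strict epigraph is open because `C` is, and the large one is closed because it comes from
`closure C`: these are the two semicontinuities. -/
theorem continuous_height (h : IsCuspOf Ω x C k p f b) : Continuous (height C p b) := by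
  rw [continuous_iff_lower_upperSemicontinuous, lowerSemicontinuous_iff_isOpen_preimage,
    upperSemicontinuous_iff_isOpen_preimage]
  refine ⟨fun a => ?_, fun a => ?_⟩
  · have : height C p b ⁻¹' Ioi a = (fun y => planeVec b y + a • p) ⁻¹' (closure C)ᶜ := by
      ext y
      rw [mem_preimage, mem_preimage, mem_compl_iff, h.planeVec_mem_closure_iff, not_le]
      rfl
    rw [this]
    exact isClosed_closure.isOpen_compl.preimage ((continuous_planeVec b).add continuous_const)
  · have : height C p b ⁻¹' Iio a = (fun y => planeVec b y + a • p) ⁻¹' C := by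
      ext y
      rw [mem_preimage, mem_preimage, h.planeVec_mem_iff]
      rfl
    rw [this]
    exact h.isCone.isOpen.preimage ((continuous_planeVec b).add continuous_const)

theorem planeVec_add_ne_zero (hb : IsCuspBasis p f b) (y : Fin 2 → ℝ) (τ : ℝ) :
    planeVec b y + τ • p ≠ 0 := by
  intro h0
  have := hb.f_planeVec_add y τ
  rw [h0, map_zero] at this
  exact zero_ne_one this

theorem eq_height (h : IsCuspOf Ω x C k p f b) {v : Vec 3} (hv : v ∈ closure C) (hv' : v ∉ C)
    (hf : f v = 1) : v = planeVec b (planePt b f v) + height C p b (planePt b f v) • p := by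
  have h1 := h.basis.eq_planeVec_of_f_eq_one hf
  have h2 : b.repr v 0 = height C p b (planePt b f v) := by
    apply le_antisymm
    · by_contra! hlt
      rw [← h.planeVec_mem_iff, ← h1] at hlt
      exact hv' hlt
    · rw [← h.planeVec_mem_closure_iff, ← h1]
      exact hv
  rwa [h2] at h1

/-- The point of the boundary above the point `y` of the plane. -/
def boundaryPt (hb : IsCuspBasis p f b) (C : Set (Vec 3)) (y : Fin 2 → ℝ) : PSpace 3 :=
  Projectivization.mk ℝ (planeVec b y + height C p b y • p) (planeVec_add_ne_zero hb y _)

theorem continuous_boundaryPt (h : IsCuspOf Ω x C k p f b) :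
    Continuous (boundaryPt h.basis C) :=
  continuous_mk_comp (u := fun y => planeVec b y + height C p b y • p)
    ((continuous_planeVec b).add (h.continuous_height.smul continuous_const)) _

theorem mem_cone_boundaryPt (hb : IsCuspBasis p f b) (C : Set (Vec 3)) (y : Fin 2 → ℝ) :
    planeVec b y + height C p b y • p ∈ cone {boundaryPt hb C y} :=
  ⟨planeVec_add_ne_zero hb y _, rfl⟩

theorem boundaryPt_ne (h : IsCuspOf Ω x C k p f b) (y : Fin 2 → ℝ) :
    boundaryPt h.basis C y ≠ x := by
  intro hx
  have h1 := mem_cone_boundaryPt h.basis C y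
  rw [hx, eq_mk_of_mem_cone h.mem, mem_cone_singleton_mk] at h1
  obtain ⟨r, -, hr⟩ := h1
  have h2 := h.basis.f_planeVec_add y (height C p b y)
  rw [hr, map_smul, h.basis.f_p, smul_zero] at h2
  exact zero_ne_one h2

/-- A boundary point other than `x` is the point above some point of the plane. -/
theorem f_ne_zero_of_frontier (h : IsCuspOf Ω x C k p f b) {z : PSpace 3} (hz : z ∈ frontier Ω)
    (hzx : z ≠ x) {v : Vec 3} (hv : v ∈ cone {z}) :
    f v ≠ 0 ∧ boundaryPt h.basis C (planePt b f v) = z := by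
  obtain ⟨u, huz, hu, hu'⟩ := h.isCone.exists_rep_frontier hz
  have hfu : f u ≠ 0 := by
    intro h0
    obtain ⟨r, hr, rfl⟩ := h.eq_smul_of_f_eq_zero hu h0
    have hr0 : r ≠ 0 := by
      rintro rfl
      exact huz.1 (zero_smul _ _)
    rw [smul_mem_cone_iff hr0] at huz
    exact hzx (eq_of_mem_cone huz h.mem)
  have hfpos : 0 < f u := lt_of_le_of_ne (h.f_nonneg hu) hfu.symm
  have hv2 := hv
  rw [eq_mk_of_mem_cone huz, mem_cone_singleton_mk] at hv2
  obtain ⟨r, hr, rfl⟩ := hv2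
  refine ⟨by rw [map_smul, smul_eq_mul]; exact mul_ne_zero hr hfu, ?_⟩
  rw [planePt_smul hr]
  have h1 := h.eq_height (h.isCone.closure_smul_mem hu (inv_pos.2 hfpos)) (fun hm => hu' (by
    have := h.isCone.smul_mem _ hm _ hfpos
    rwa [smul_smul, mul_inv_cancel₀ hfu, one_smul] at this)) (by
    rw [map_smul, smul_eq_mul, inv_mul_cancel₀ hfu])
  rw [planePt_smul (inv_ne_zero hfu)] at h1
  refine eq_of_mem_cone (mem_cone_boundaryPt _ _ _) ?_
  rw [← h1, smul_mem_cone_iff (inv_ne_zero hfu)]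
  exact huz

end IsCuspOf


/-! ### The action on the plane -/

theorem transPart_one (b : Module.Basis (Fin 4) ℝ (Vec 3)) : transPart b 1 = 0 := by
  unfold transPart
  rw [IsCuspAut.mat_one]
  ext i
  fin_cases i <;> simp

theorem IsCuspAut.transPart_mul {C : Set (Vec 3)} {p : Vec 3} {f : Vec 3 →ₗ[ℝ] ℝ}
    {b : Module.Basis (Fin 4) ℝ (Vec 3)} {T S : Vec 3 ≃ₗ[ℝ] Vec 3} (hT : IsCuspAut C p f T)
    (hS : IsCuspAut C p f S) (hb : IsCuspBasis p f b) :
    transPart b (T * S) = (linPart b T).mulVec (transPart b S) + transPart b T := by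
  obtain ⟨h1, h2, -, -⟩ := hT.mat_zero hb
  obtain ⟨-, -, h3⟩ := hS.mat_three hb
  unfold linPart transPart
  rw [mat_mul]
  ext i
  fin_cases i <;> simp [Matrix.mul_apply, Fin.sum_univ_four, h1, h2, h3, Matrix.vecHead,
    Matrix.vecTail] <;> ring

instance : ContinuousConstSMul (SL n) (PSpace n) := ⟨continuous_smul_pspace⟩

theorem smul_mem_cone_closure_of_mem_Aut {Ω : Set (PSpace n)} {g : SL n} (hg : g ∈ Aut Ω)
    {v : Vec n} : g • v ∈ cone (closure Ω) ↔ v ∈ cone (closure Ω) := by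
  conv_lhs => rw [← mem_Aut_iff.1 hg, closure_smul]
  exact smul_mem_cone_smul

theorem IsAdapted.comp_smul {Ω : Set (PSpace n)} {f : Vec n →ₗ[ℝ] ℝ} (hf : IsAdapted Ω f)
    {g : SL n} (hg : g ∈ Aut Ω) : IsAdapted Ω (f ∘ₗ DistribSMul.toLinearMap ℝ (Vec n) g) :=
  fun v hv => hf (g • v) ((smul_mem_cone_closure_of_mem_Aut hg).2 hv)

theorem mem_cone_hull {Ω A : Set (PSpace n)} {v : Vec n} :
    v ∈ cone (hull Ω A) ↔ ∃ f : Vec n →ₗ[ℝ] ℝ, IsAdapted Ω f ∧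
      ∃ u ∈ convexHull ℝ (cone A ∩ {v | f v = 1}), u ≠ 0 ∧ ∃ r : ℝ, r ≠ 0 ∧ v = r • u := by
  constructor
  · rintro ⟨hv, f, hf, u, hu, hu'⟩
    rw [mem_cone_singleton_mk] at hu'
    obtain ⟨r, hr, rfl⟩ := hu'
    exact ⟨f, hf, _, hu, smul_ne_zero hr hv, r⁻¹, inv_ne_zero hr, by
      rw [smul_smul, inv_mul_cancel₀ hr, one_smul]⟩
  · rintro ⟨f, hf, u, hu, hu0, r, hr, rfl⟩
    rw [smul_mem_cone_iff hr]
    exact ⟨hu0, f, hf, u, hu, hu0, rfl⟩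

theorem smul_mem_cone_hull {Ω A : Set (PSpace n)} {g : SL n} (hg : g ∈ Aut Ω)
    (hA : ∀ z ∈ A, g • z ∈ A) {v : Vec n} (hv : v ∈ cone (hull Ω A)) :
    g • v ∈ cone (hull Ω A) := by
  rw [mem_cone_hull] at hv ⊢
  obtain ⟨f, hf, u, hu, hu0, r, hr, rfl⟩ := hv
  refine ⟨_, hf.comp_smul ((Aut Ω).inv_mem hg), g • u, ?_, (smul_ne_zero_iff_ne g).2 hu0, r, hr,
    smul_comm g r u⟩
  have h := (convex_convexHull ℝ (cone A ∩ {v | (f ∘ₗ DistribSMul.toLinearMap ℝ (Vec n) g⁻¹) v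
    = 1})).linear_preimage (DistribSMul.toLinearMap ℝ (Vec n) g)
  refine convexHull_min ?_ h hu
  rintro w ⟨hw, hfw⟩
  refine subset_convexHull ℝ _ ⟨?_, ?_⟩
  · exact (mem_iff_cone (smul_mem_cone_singleton (g := g) ⟨hw.1, rfl⟩)).1 (hA _ hw.2)
  · change f (g⁻¹ • g • w) = 1
    rw [inv_smul_smul]
    exact hfw

namespace IsConeOver

variable {C : Set (Vec n)} {k : Vec n →ₗ[ℝ] ℝ} {Ω : Set (PSpace n)}

theorem mem_cone_closure_iff (hC : IsConeOver C k Ω) {v : Vec n} :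
    v ∈ cone (closure Ω) ↔ v ≠ 0 ∧ (v ∈ closure C ∨ -v ∈ closure C) := by
  by_cases hv : v = 0
  · exact ⟨fun h => (h.1 hv).elim, fun h => (h.1 hv).elim⟩
  · rw [mem_cone_closure hv, hC.mem_closure_cone]
    exact ⟨fun h => ⟨hv, h⟩, fun h => h.2⟩

theorem isAdapted (hC : IsConeOver C k Ω) : IsAdapted Ω k := by
  intro v hv h0
  rw [hC.mem_cone_closure_iff] at hv
  rcases hv with ⟨hv0, h | h⟩
  · exact (hC.pos v h hv0).ne' h0
  · have := hC.pos _ h (neg_ne_zero.2 hv0)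
    rw [map_neg, h0, neg_zero] at this
    exact lt_irrefl _ this

/-- A functional defining an affine chart has a constant sign on the cone. -/
theorem exists_sign_of_isAdapted (hC : IsConeOver C k Ω) {f : Vec n →ₗ[ℝ] ℝ}
    (hf : IsAdapted Ω f) : ∃ ε : ℝ, ε ≠ 0 ∧ ∀ v ∈ closure C, v ≠ 0 → 0 < ε * f v := by
  have hfc : Continuous f := LinearMap.continuous_of_finiteDimensional f
  have hne : ∀ v ∈ closure C, v ≠ 0 → f v ≠ 0 := fun v hv hv0 =>
    hf v (hC.mem_cone_closure_iff.2 ⟨hv0, Or.inl hv⟩)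
  obtain ⟨u, hu⟩ := hC.nonempty
  have hu' := subset_closure hu
  refine ⟨f u, hne u hu' (hC.ne_zero hu), fun v hv hv0 => ?_⟩
  by_contra! hle
  have hlt : f u * f v < 0 :=
    lt_of_le_of_ne hle (mul_ne_zero (hne u hu' (hC.ne_zero hu)) (hne v hv hv0))
  -- If the signs differed, a positive combination of the two vectors would be a zero of `f` in the
  -- cone.
  obtain ⟨s, t, hs, ht, h0⟩ : ∃ s t : ℝ, 0 < s ∧ 0 < t ∧ s * f u + t * f v = 0 := by
    rcases mul_neg_iff.1 hlt with ⟨h1, h2⟩ | ⟨h1, h2⟩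
    · exact ⟨-f v, f u, by linarith, h1, by ring⟩
    · exact ⟨f v, -f u, h2, by linarith, by ring⟩
  have h1 := hC.add_closure_mem (hC.smul_mem u hu s hs) (hC.closure_smul_mem hv ht)
  refine hne _ (subset_closure h1) (hC.ne_zero h1) ?_
  rw [map_add, map_smul, map_smul, smul_eq_mul, smul_eq_mul, h0]

end IsConeOver

/-- The central projection carries convex combinations to convex combinations, the weights being
multiplied by the values of `f`. -/
theorem convex_planePt {b : Module.Basis (Fin 4) ℝ (Vec 3)} {f : Vec 3 →ₗ[ℝ] ℝ}
    {Y : Set (Fin 2 → ℝ)} (hY : Convex ℝ Y) : Convex ℝ {u | 0 < f u ∧ planePt b f u ∈ Y} := by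
  rintro u ⟨hu, hu'⟩ w ⟨hw, hw'⟩ s t hs ht hst
  have h1 : 0 < f (s • u + t • w) := by
    rw [map_add, map_smul, map_smul, smul_eq_mul, smul_eq_mul]
    rcases hs.eq_or_lt with rfl | hs
    · rw [zero_add] at hst
      rw [hst]
      linarith
    · positivity
  refine ⟨h1, ?_⟩
  have h2 : planePt b f (s • u + t • w) = (s * f u / f (s • u + t • w)) • planePt b f u
      + (t * f w / f (s • u + t • w)) • planePt b f w := by
    unfold planePt
    ext i
    fin_cases i <;> simp <;> field_simp
  rw [h2]
  refine hY hu' hw' (by positivity) (by positivity) ?_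
  rw [← add_div, div_eq_one_iff_eq h1.ne']
  simp

/-! ### Convex hulls of limit sets and the two notions of bounded parabolic point -/

namespace IsCuspOf

variable {Ω : Set (PSpace 3)} {x : PSpace 3} {C : Set (Vec 3)} {k : Vec 3 →ₗ[ℝ] ℝ}
  {p : Vec 3} {f : Vec 3 →ₗ[ℝ] ℝ} {b : Module.Basis (Fin 4) ℝ (Vec 3)}

/-- The cone over a convex hull lies above the convex hull. -/
theorem planePt_mem_of_hull (h : IsCuspOf Ω x C k p f b) {A : Set (PSpace 3)}
    (hA : A ⊆ frontier Ω \ {x}) {v : Vec 3} (hv : v ∈ cone (hull Ω A)) :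
    planePt b f v ∈ convexHull ℝ (planePt b f '' cone A) := by
  obtain ⟨f₀, hf₀, u, hu, hu0, r, hr, rfl⟩ := mem_cone_hull.1 hv
  rw [planePt_smul hr]
  -- In the chart `f₀ = 1`, every representative of a point of `A` lies in the closure of `C` after
  -- multiplication by `ε`, up to a positive factor; so `f` is positive on it.
  obtain ⟨ε, hε, hεC⟩ := h.isCone.exists_sign_of_isAdapted hf₀
  have hW := (convex_planePt (b := b) (f := f)
    (convex_convexHull ℝ (planePt b f '' cone A))).smul_preimage ε
  have h1 := convexHull_min (fun w hw => ?_) hW hu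
  · have := h1.2
    rwa [planePt_smul hε] at this
  obtain ⟨hwA, hw1⟩ := hw
  have hw1' : f₀ w = 1 := hw1
  have hfw := (h.f_ne_zero_of_frontier (hA hwA.2).1 (hA hwA.2).2 ⟨hwA.1, rfl⟩).1
  refine ⟨?_, ?_⟩
  · rw [map_smul, smul_eq_mul]
    have hcl := cone_mono (hA.trans (sdiff_subset.trans frontier_subset_closure)) hwA
    rw [h.isCone.mem_cone_closure_iff] at hcl
    rcases hcl with ⟨hw0, hm | hm⟩
    · have h2 := hεC w hm hw0
      rw [hw1', mul_one] at h2
      exact mul_pos h2 (lt_of_le_of_ne (h.f_nonneg hm) hfw.symm)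
    · have h2 := hεC _ hm (neg_ne_zero.2 hw0)
      have h3 := h.f_nonneg hm
      rw [map_neg] at h2 h3
      rw [hw1'] at h2
      exact mul_pos_of_neg_of_neg (by linarith)
        (lt_of_le_of_ne (by linarith) hfw)
  · rw [planePt_smul hε]
    exact subset_convexHull ℝ _ ⟨w, hwA, rfl⟩

theorem mem_cone_hull_of_mem_cone (h : IsCuspOf Ω x C k p f b) {A : Set (PSpace 3)}
    (hA : A ⊆ frontier Ω \ {x}) {v : Vec 3} (hv : v ∈ cone A) : v ∈ cone (hull Ω A) := by
  have hk : k v ≠ 0 := h.isCone.isAdapted v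
    (cone_mono (hA.trans (sdiff_subset.trans frontier_subset_closure)) hv)
  refine mem_cone_hull.2 ⟨k, h.isCone.isAdapted, (k v)⁻¹ • v, subset_convexHull ℝ _ ⟨?_, ?_⟩,
    smul_ne_zero (inv_ne_zero hk) hv.1, k v, hk, ?_⟩
  · rwa [smul_mem_cone_iff (inv_ne_zero hk)]
  · change k ((k v)⁻¹ • v) = 1
    rw [map_smul, smul_eq_mul, inv_mul_cancel₀ hk]
  · rw [smul_smul, mul_inv_cancel₀ hk, one_smul]

theorem dirs_eq_range (h : IsCuspOf Ω x C k p f b) :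
    dirs x Ω = range (planeLine h.mem h.basis) := by
  ext l
  constructor
  · rintro ⟨v, hv, hl⟩
    refine ⟨_, (eq_planeLine h.mem h.basis hl ?_).symm⟩
    rcases (h.isCone.mem_cone v).1 hv with h1 | h1
    · exact (h.cusp.pos v h1).ne'
    · have := h.cusp.pos _ h1
      rw [map_neg] at this
      linarith
  · rintro ⟨y, rfl⟩
    obtain ⟨τ, hτ⟩ := h.cusp.full (planeVec b y) (by rw [h.basis.f_planeVec]; exact one_pos)
    refine ⟨_, (h.isCone.mem_cone _).2 (Or.inl hτ), (isLineTo_planeLine_iff _ _).2 ⟨?_, ?_⟩⟩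
    · rw [h.basis.f_planeVec_add]
      exact one_ne_zero
    · exact h.basis.planePt_planeVec y τ

/-- The points of the plane below the convex hull of the limit set without `x`. -/
def hullPts (h : IsCuspOf Ω x C k p f b) (Γ : Subgroup (SL 3)) : Set (Fin 2 → ℝ) :=
  planeLine h.mem h.basis ⁻¹' dirs x (hull Ω (limitSet Ω Γ \ {x}))

variable {Γ : Subgroup (SL 3)}

theorem limitDirs_eq (h : IsCuspOf Ω x C k p f b) (Γ : Subgroup (SL 3)) :
    limitDirs Ω Γ x = planeLine h.mem h.basis '' closure (h.hullPts Γ) := by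
  have he := isOpenEmbedding_planeLine h.mem h.basis
  rw [hullPts, ← he.isOpenMap.preimage_closure_eq_closure_preimage he.continuous,
    image_preimage_eq_inter_range, limitDirs, h.dirs_eq_range]

theorem mem_hullPts (h : IsCuspOf Ω x C k p f b) {y : Fin 2 → ℝ} :
    y ∈ h.hullPts Γ ↔
      ∃ v ∈ cone (hull Ω (limitSet Ω Γ \ {x})), f v ≠ 0 ∧ planePt b f v = y := by
  simp only [hullPts, mem_preimage, dirs, mem_ofPred_eq, isLineTo_planeLine_iff]

theorem hullPts_subset (h : IsCuspOf Ω x C k p f b) (hΛ : limitSet Ω Γ ⊆ frontier Ω) :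
    h.hullPts Γ ⊆ convexHull ℝ (planePt b f '' cone (limitSet Ω Γ \ {x})) := by
  intro y hy
  obtain ⟨v, hv, -, rfl⟩ := h.mem_hullPts.1 hy
  exact h.planePt_mem_of_hull (sdiff_subset_sdiff_left hΛ) hv

theorem planePt_mem_hullPts (h : IsCuspOf Ω x C k p f b) (hΛ : limitSet Ω Γ ⊆ frontier Ω)
    {v : Vec 3} (hv : v ∈ cone (limitSet Ω Γ \ {x})) : planePt b f v ∈ h.hullPts Γ := by
  have hA : limitSet Ω Γ \ {x} ⊆ frontier Ω \ {x} := sdiff_subset_sdiff_left hΛ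
  exact h.mem_hullPts.2 ⟨v, h.mem_cone_hull_of_mem_cone hA hv,
    (h.f_ne_zero_of_frontier (hA hv.2).1 (hA hv.2).2 ⟨hv.1, rfl⟩).1, rfl⟩

theorem smul_mem_limitSet_diff {g : SL 3} (hg : g ∈ stab Γ x) {z : PSpace 3}
    (hz : z ∈ limitSet Ω Γ \ {x}) : g • z ∈ limitSet Ω Γ \ {x} := by
  refine ⟨smul_mem_limitSet hg.1 hz.1, fun h0 => hz.2 ?_⟩
  have h1 : g • x = x := hg.2
  rw [mem_singleton_iff] at h0 ⊢
  rw [← h1] at h0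
  exact MulAction.injective g h0

theorem mulVec_mem_closure_hullPts (h : IsCuspOf Ω x C k p f b) (hΓ : Γ ≤ Aut Ω) {g : SL 3}
    (hg : g ∈ stab Γ x) {T : Vec 3 ≃ₗ[ℝ] Vec 3} (hT : IsNormalization C p f g T) {y : Fin 2 → ℝ}
    (hy : y ∈ closure (h.hullPts Γ)) :
    (linPart b T).mulVec y + transPart b T ∈ closure (h.hullPts Γ) := by
  have hc : Continuous fun y : Fin 2 → ℝ => (linPart b T).mulVec y + transPart b T :=
    ((linPart b T).mulVecLin.continuous_of_finiteDimensional).add continuous_const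
  refine map_mem_closure (f := fun y : Fin 2 → ℝ => (linPart b T).mulVec y + transPart b T) hc hy fun y hy => ?_
  obtain ⟨v, hv, hfv, rfl⟩ := h.mem_hullPts.1 hy
  rw [h.mem_hullPts]
  refine ⟨T v, ?_, by rwa [hT.map_f], hT.planePt_apply h.basis hfv⟩
  rw [hT.smul_mem_cone]
  exact smul_mem_cone_hull (hΓ hg.1) (fun z hz => smul_mem_limitSet_diff hg hz) hv

theorem isLineTo_smul (h : IsCuspOf Ω x C k p f b) {g : SL 3} {T : Vec 3 ≃ₗ[ℝ] Vec 3}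
    (hT : IsNormalization C p f g T) {v : Vec 3} {y : Fin 2 → ℝ}
    (hv : IsLineTo x v (planeLine h.mem h.basis y)) :
    IsLineTo x (g • v) (planeLine h.mem h.basis ((linPart b T).mulVec y + transPart b T)) := by
  rw [isLineTo_planeLine_iff] at hv ⊢
  obtain ⟨hf, rfl⟩ := hv
  obtain ⟨r, hr, hTr⟩ := hT.exists_smul
  rw [← hT.planePt_apply h.basis hf, hTr, planePt_smul hr]
  refine ⟨fun h0 => ?_, rfl⟩
  have := hT.map_f v
  rw [hTr, map_smul, h0, smul_zero] at this
  exact hf this.symm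

/-- Pull the compact set of lines back to the plane, keep the closed set of those lines whose
boundary point is a limit point, and push it to the boundary by `boundaryPt`. -/
theorem isBoundedParabolicPoint (h : IsCuspOf Ω x C k p f b) (hΓ : Γ ≤ Aut Ω)
    (hcl : IsClosed (limitSet Ω Γ)) (hΛ : limitSet Ω Γ ⊆ frontier Ω)
    (hx : IsUniformlyBoundedParabolicPoint Ω Γ x) : IsBoundedParabolicPoint Ω Γ x := by
  obtain ⟨hxΛ, K, hK, hKc, hcov⟩ := hx
  have he := isOpenEmbedding_planeLine h.mem h.basis
  refine ⟨hxΛ, boundaryPt h.basis C '' (planeLine h.mem h.basis ⁻¹' K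
    ∩ boundaryPt h.basis C ⁻¹' limitSet Ω Γ), ?_, ?_, fun z hz => ?_⟩
  · rintro _ ⟨y, ⟨-, hy⟩, rfl⟩
    exact ⟨hy, h.boundaryPt_ne y⟩
  · refine IsCompact.image (IsCompact.inter_right ?_ (hcl.preimage h.continuous_boundaryPt))
      h.continuous_boundaryPt
    rw [he.isInducing.isCompact_preimage_iff]
    · exact hKc
    · rw [← h.dirs_eq_range]
      exact hK.trans inter_subset_right
  · have hv : z.rep ∈ cone (limitSet Ω Γ \ {x}) := (mem_iff_cone (rep_mem_cone z)).1 hz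
    have hl : planeLine h.mem h.basis (planePt b f z.rep) ∈ limitDirs Ω Γ x := by
      rw [h.limitDirs_eq]
      exact ⟨_, subset_closure (h.planePt_mem_hullPts hΛ hv), rfl⟩
    obtain ⟨g, hg, l, hlK, v, hvl, hgv⟩ := hcov _ hl
    obtain ⟨y, -, rfl⟩ := (h.limitDirs_eq Γ) ▸ hK hlK
    obtain ⟨T, hT⟩ := h.exists_normalization (hΓ hg.1) hg.2
    have h1 := hT.inv
    have h2 := h.isLineTo_smul h1 hgv
    rw [inv_smul_smul, isLineTo_planeLine_iff] at h2
    have hz' := smul_mem_limitSet_diff ((stab Γ x).inv_mem hg) hz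
    have hfz := (h.f_ne_zero_of_frontier (hΛ hz.1) hz.2 (rep_mem_cone z)).1
    have h3 := h.f_ne_zero_of_frontier (hΛ hz'.1) hz'.2 (h1.apply_mem_cone_smul (rep_mem_cone z))
    rw [h1.planePt_apply h.basis hfz, ← h2.2, ((isLineTo_planeLine_iff _ _).1 hvl).2] at h3
    refine ⟨g, hg, _, ⟨y, ⟨hlK, ?_⟩, rfl⟩, ?_⟩
    · rw [mem_preimage, h3.2]
      exact hz'.1
    · rw [h3.2, smul_inv_smul]

/-- An element with `a ≠ 1` fixes a line through `x` and a second vector `u` on it. The orbit `u + a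
^ j s p` runs along this line to `x`, so it stays exactly on a half-line ending at `x`. -/
theorem isConicalLimitPoint_of_one_lt (h : IsCuspOf Ω x C k p f b) (hx : x ∈ limitSet Ω Γ)
    {g : SL 3} (hg : g ∈ Γ) {T : Vec 3 ≃ₗ[ℝ] Vec 3} (hT : IsNormalization C p f g T)
    (ha : 1 < mat b T 0 0) : IsConicalLimitPoint Ω Γ x := by
  set a := mat b T 0 0 with ha_def
  have hTp : T p = a • p := (hT.mat_zero h.basis).2.2.2.2
  obtain ⟨u, hu, κ, hκ⟩ : ∃ u, f u = 1 ∧ ∃ κ : ℝ, T u = u + κ • p := by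
    by_contra! hno
    exact ha.ne' (hT.of_fixes_no_line h.cusp h.basis hno).1
  obtain ⟨u, hu, hTu⟩ := hT.exists_fixed_of_fixes_line h.basis h.cusp.map_p ha.ne' hu hκ
  obtain ⟨s, hs, hsC⟩ : ∃ s : ℝ, 0 < s ∧ u + s • p ∈ C := by
    obtain ⟨τ, hτ⟩ := h.cusp.full u (by rw [hu]; exact one_pos)
    refine ⟨τ + (|τ| + 1), by linarith [neg_abs_le τ], ?_⟩
    rw [add_smul, ← add_assoc]
    exact h.add_smul_mem hτ (by positivity)
  have hpow : ∀ j : ℕ, (T ^ j) (u + s • p) = u + (a ^ j * s) • p := by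
    intro j
    induction j with
    | zero => simp
    | succ j ih =>
      rw [pow_succ', LinearEquiv.mul_apply, ih, map_add, map_smul, hTu, hTp, smul_smul, pow_succ]
      congr 2
      ring
  have hge : ∀ j : ℕ, s ≤ a ^ j * s := fun j => by
    have := one_le_pow₀ (n := j) ha.le
    nlinarith
  have hcone : ∀ j : ℕ, u + (a ^ j * s) • p
      ∈ cone {g ^ j • Projectivization.mk ℝ _ (h.isCone.ne_zero hsC)} := by
    intro j
    rw [← hpow]
    exact (hT.pow j).apply_mem_cone_smul ⟨h.isCone.ne_zero hsC, rfl⟩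
  have hdom : Projectivization.mk ℝ _ (h.isCone.ne_zero hsC) ∈ Ω :=
    mk_mem_of_mem_cone ((h.isCone.mem_cone _).2 (Or.inl hsC))
  refine ⟨hx, fun j => g ^ j, fun j => Γ.pow_mem hg j, _, hdom, _, hdom, 1, one_pos, ?_,
    fun j => ⟨g ^ j • Projectivization.mk ℝ _ (h.isCone.ne_zero hsC), ?_, ?_⟩⟩
  · have hne : ∀ j : ℕ, (a ^ j * s)⁻¹ • u + p ≠ 0 := by
      intro j h0
      have hpos : 0 < a ^ j * s := hs.trans_le (hge j)
      have := congrArg f h0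
      rw [map_add, map_smul, hu, h.cusp.map_p, map_zero, smul_eq_mul, mul_one, add_zero] at this
      exact (inv_ne_zero hpos.ne') this
    have heq : ∀ j : ℕ, g ^ j • Projectivization.mk ℝ _ (h.isCone.ne_zero hsC)
        = Projectivization.mk ℝ _ (hne j) := by
      intro j
      have hpos : 0 < a ^ j * s := hs.trans_le (hge j)
      refine eq_of_mem_cone (hcone j) ?_
      rw [mem_cone_singleton_mk]
      refine ⟨a ^ j * s, hpos.ne', ?_⟩
      rw [smul_add, smul_smul, mul_inv_cancel₀ hpos.ne', one_smul]
    simp only [heq]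
    rw [eq_mk_of_mem_cone h.mem]
    refine tendsto_mk hne h.p_ne_zero ?_
    have h1 : Tendsto (fun j : ℕ => a ^ j * s) atTop atTop :=
      (tendsto_pow_atTop_atTop_of_one_lt ha).atTop_mul_const hs
    simpa using (h1.inv_tendsto_atTop.smul_const u).add_const p
  · refine ⟨u + s • p, ⟨h.isCone.ne_zero hsC, rfl⟩, p, h.mem, fun r hr => ?_, a ^ j * s - s,
      by linarith [hge j], ?_⟩
    · exact (h.isCone.mem_cone _).2 (Or.inl (h.add_smul_mem hsC hr))
    · rw [add_assoc, ← add_smul, add_sub_cancel]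
      exact hcone j
  · rw [hilbertDist, if_pos rfl]
    exact zero_le_one

theorem isConicalLimitPoint_of_ne_one (h : IsCuspOf Ω x C k p f b) (hx : x ∈ limitSet Ω Γ)
    {g : SL 3} (hg : g ∈ Γ) {T : Vec 3 ≃ₗ[ℝ] Vec 3} (hT : IsNormalization C p f g T)
    (ha : mat b T 0 0 ≠ 1) : IsConicalLimitPoint Ω Γ x := by
  rcases ha.lt_or_gt with h1 | h1
  · refine h.isConicalLimitPoint_of_one_lt hx (Γ.inv_mem hg) hT.inv ?_
    obtain ⟨-, -, -, hpos, hTp⟩ := hT.mat_zero h.basis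
    obtain ⟨-, -, -, -, hTp'⟩ := hT.inv.mat_zero h.basis
    have h2 : (T⁻¹ * T) p = p := by rw [inv_mul_cancel]; rfl
    rw [LinearEquiv.mul_apply, hTp, map_smul, hTp', smul_smul] at h2
    have h3 : mat b T 0 0 * mat b T⁻¹ 0 0 = 1 := by
      have := smul_left_injective ℝ h.p_ne_zero (a₁ := mat b T 0 0 * mat b T⁻¹ 0 0) (a₂ := 1)
      exact this (by simpa using h2)
    by_contra! hle
    nlinarith
  · exact h.isConicalLimitPoint_of_one_lt hx hg hT h1

/-- If the stabilizer of `x` is unipotent, it acts on the plane by an elliptic affine group. -/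
theorem isEllipticAffineGroup (h : IsCuspOf Ω x C k p f b) (H : Subgroup (SL 3))
    (hone : ∀ g ∈ H, ∀ T, IsNormalization C p f g T → mat b T 0 0 = 1) :
    IsEllipticAffineGroup {q : Matrix (Fin 2) (Fin 2) ℝ × (Fin 2 → ℝ) | ∃ g ∈ H, ∃ T,
      IsNormalization C p f g T ∧ linPart b T = q.1 ∧ transPart b T = q.2} where
  one := ⟨1, H.one_mem, 1, .one, IsCuspAut.linPart_one b, transPart_one b⟩
  mul := by
    rintro _ _ _ _ ⟨g, hg, T, hT, rfl, rfl⟩ ⟨g', hg', S, hS, rfl, rfl⟩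
    exact ⟨g * g', H.mul_mem hg hg', T * S, hT.mul hS, hT.linPart_mul hS.toIsCuspAut h.basis,
      hT.transPart_mul hS.toIsCuspAut h.basis⟩
  inv := by
    rintro _ _ ⟨g, hg, T, hT, rfl, rfl⟩
    have hdet := (hT.linPart_of_unipotent h.cusp h.basis (hone g hg T hT)).1
    have h1 : linPart b T⁻¹ = (linPart b T).adjugate := by
      have h2 := hT.linPart_mul hT.inv.toIsCuspAut h.basis
      rw [mul_inv_cancel, IsCuspAut.linPart_one] at h2
      calc linPart b T⁻¹ = (linPart b T).adjugate * linPart b T * linPart b T⁻¹ := by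
            rw [Matrix.adjugate_mul, hdet, one_smul, one_mul]
        _ = _ := by rw [mul_assoc, ← h2, mul_one]
    refine ⟨g⁻¹, H.inv_mem hg, T⁻¹, hT.inv, h1, ?_⟩
    have h2 := hT.inv.transPart_mul hT.toIsCuspAut h.basis
    rw [inv_mul_cancel, transPart_one, h1] at h2
    exact (neg_eq_of_add_eq_zero_right h2.symm).symm
  det := by
    rintro _ _ ⟨g, hg, T, hT, rfl, rfl⟩
    exact (hT.linPart_of_unipotent h.cusp h.basis (hone g hg T hT)).1
  trace := by
    rintro _ _ ⟨g, hg, T, hT, rfl, rfl⟩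
    exact (hT.linPart_of_unipotent h.cusp h.basis (hone g hg T hT)).2.1
  of_trace := by
    rintro _ _ ⟨g, hg, T, hT, rfl, rfl⟩
    exact (hT.linPart_of_unipotent h.cusp h.basis (hone g hg T hT)).2.2.1
  of_trace_neg := by
    rintro _ _ ⟨g, hg, T, hT, rfl, rfl⟩
    exact (hT.linPart_of_unipotent h.cusp h.basis (hone g hg T hT)).2.2.2

/-- The open sets of points lying over the balls of the plane exhaust the boundary without `x`, so
one of them contains `K`. -/
theorem exists_norm_planePt_le (h : IsCuspOf Ω x C k p f b) {K : Set (PSpace 3)}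
    (hK : IsCompact K) (hKx : K ⊆ frontier Ω \ {x}) :
    ∃ R : ℝ, ∀ z ∈ K, ∀ v ∈ cone {z}, ‖planePt b f v‖ ≤ R := by
  have hfc : Continuous f := LinearMap.continuous_of_finiteDimensional f
  set W : ℕ → Set (Vec 3) := fun m => {v | f v ≠ 0} ∩ planePt b f ⁻¹' Metric.ball 0 m with hW
  have hWo : ∀ m, IsOpen (W m) := fun m =>
    (continuousOn_planePt b f).isOpen_inter_preimage (isOpen_ne.preimage hfc) Metric.isOpen_ball
  obtain ⟨m, hm⟩ := hK.elim_directed_cover (fun m => projMk '' (Subtype.val ⁻¹' W m))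
    (fun m => isOpenMap_projMk _ ((hWo m).preimage continuous_subtype_val)) (fun z hz => by
      obtain ⟨m, hm⟩ := exists_nat_gt ‖planePt b f z.rep‖
      refine mem_iUnion.2 ⟨m, ⟨z.rep, z.rep_nonzero⟩, ⟨?_, ?_⟩, by simp [projMk]⟩
      · exact (h.f_ne_zero_of_frontier (hKx hz).1 (hKx hz).2 (rep_mem_cone z)).1
      · simpa using hm)
    (directed_of_isDirected_le fun m m' hmm => image_mono fun v hv => ⟨hv.1,
      Metric.ball_subset_ball (by exact_mod_cast hmm) hv.2⟩)
  refine ⟨m, fun z hz v hv => ?_⟩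
  obtain ⟨⟨w, hw0⟩, ⟨-, hw⟩, rfl⟩ := hm hz
  obtain ⟨r, hr, rfl⟩ := (mem_cone_singleton_mk hw0).1 hv
  rw [planePt_smul hr]
  exact (mem_ball_zero_iff.1 hw).le

/-- The compact set covering the limit set lies over a ball of the plane. `coversHull` then provides
a compact set `D` whose translates cover the closed convex hull of the projected limit set. -/
theorem isUniformlyBoundedParabolicPoint (h : IsCuspOf Ω x C k p f b) (hΓ : Γ ≤ Aut Ω)
    (hΛ : limitSet Ω Γ ⊆ frontier Ω)
    (hone : ∀ g ∈ stab Γ x, ∀ T, IsNormalization C p f g T → mat b T 0 0 = 1)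
    (hx : IsBoundedParabolicPoint Ω Γ x) : IsUniformlyBoundedParabolicPoint Ω Γ x := by
  obtain ⟨hxΛ, K, hK, hKc, hcov⟩ := hx
  have hA : limitSet Ω Γ \ {x} ⊆ frontier Ω \ {x} := sdiff_subset_sdiff_left hΛ
  obtain ⟨R, hR⟩ := h.exists_norm_planePt_le hKc (hK.trans hA)
  have hnorm : ∀ g ∈ stab Γ x, ∃ T, IsNormalization C p f g T := fun g hg =>
    h.exists_normalization (hΓ hg.1) hg.2
  obtain ⟨D, hDc, hD⟩ := (h.isEllipticAffineGroup (stab Γ x) hone).coversHull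
    (Y := planePt b f '' cone (limitSet Ω Γ \ {x})) (R := R) (by
      rintro _ ⟨v, hv, rfl⟩
      obtain ⟨g, hg, z, hz, hgz⟩ := hcov _ hv.2
      obtain ⟨T, hT⟩ := hnorm g hg
      refine ⟨(linPart b T, transPart b T), ⟨g, hg, T, hT, rfl, rfl⟩, planePt b f z.rep,
        hR z hz _ (rep_mem_cone z), ?_⟩
      have hfz := (h.f_ne_zero_of_frontier (hA (hK hz)).1 (hA (hK hz)).2 (rep_mem_cone z)).1
      rw [← hT.planePt_apply h.basis hfz]
      have h1 := hT.apply_mem_cone_smul (rep_mem_cone z)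
      rw [← hgz, mem_cone_singleton_mk] at h1
      obtain ⟨r, hr, h1⟩ := h1
      rw [h1, planePt_smul hr])
  have he := isOpenEmbedding_planeLine h.mem h.basis
  refine ⟨hxΛ, planeLine h.mem h.basis '' (closure (h.hullPts Γ) ∩ D), ?_,
    (hDc.inter_left isClosed_closure).image he.continuous, fun l hl => ?_⟩
  · rw [h.limitDirs_eq]
    exact image_mono inter_subset_left
  · rw [h.limitDirs_eq] at hl
    obtain ⟨y, hy, rfl⟩ := hl
    obtain ⟨⟨_, _⟩, ⟨g, hg, T, hT, rfl, rfl⟩, z, hz, rfl⟩ :=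
      hD y (closure_mono (h.hullPts_subset hΛ) hy)
    have hzl : IsLineTo x (planeVec b z) (planeLine h.mem h.basis z) := ⟨_, rfl⟩
    refine ⟨g, hg, _, ⟨z, ⟨?_, hz⟩, rfl⟩, planeVec b z, hzl, h.isLineTo_smul hT hzl⟩
    -- The closure of `hullPts` is invariant under the stabilizer, so the point of `D` that is moved
    -- to a point of it belongs to it already.
    have h1 := h.mulVec_mem_closure_hullPts hΓ ((stab Γ x).inv_mem hg) hT.inv hy
    convert h1 using 1
    have h2 := hT.inv.linPart_mul hT.toIsCuspAut h.basis
    have h3 := hT.inv.transPart_mul hT.toIsCuspAut h.basis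
    rw [inv_mul_cancel, IsCuspAut.linPart_one] at h2
    rw [inv_mul_cancel, transPart_one] at h3
    rw [Matrix.mulVec_add, Matrix.mulVec_mulVec, add_assoc, ← h2, ← h3, Matrix.one_mulVec, add_zero]

end IsCuspOf

/-- For discrete groups, geometric finiteness on the domain and on the boundary coincide. -/
theorem geomFiniteOnDomain_iff {Ω : Set (PSpace 3)} (hΩ : IsProperlyConvex Ω)
    (hs : IsStrictlyConvex Ω) (hC1 : HasC1Boundary Ω) {Γ : Subgroup (SL 3)} (hΓ : Γ ≤ Aut Ω)
    (hd : DiscreteTopology Γ) : GeomFiniteOnDomain Ω Γ ↔ GeomFiniteOnBoundary Ω Γ := by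
  obtain ⟨C, k, hC⟩ := hΩ.exists_isConeOver
  have hΛ := hC.limitSet_subset_frontier hs hΓ hd
  refine forall₂_congr fun x hx => ⟨?_, ?_⟩
  all_goals
    obtain ⟨p, f, b, h⟩ := exists_isCuspOf hs hC1 hC (hΛ hx)
    rintro (h1 | h1)
    · exact Or.inl h1
  · exact Or.inr (h.isBoundedParabolicPoint hΓ (hC.isClosed_limitSet hs hΓ hd) hΛ h1)
  · by_cases hone : ∀ g ∈ stab Γ x, ∀ T, IsNormalization C p f g T → mat b T 0 0 = 1
    -- A bounded parabolic point whose stabilizer is not unipotent is handled below: it is conical,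
    -- which both definitions allow.
    · exact Or.inr (h.isUniformlyBoundedParabolicPoint hΓ hΛ hone h1)
    · push Not at hone
      obtain ⟨g, hg, T, hT, ha⟩ := hone
      exact Or.inl (h.isConicalLimitPoint_of_ne_one hx hg.1 hT ha)


/-! ### Lower bounds for the Hilbert distance -/

/-- A function `α + u β` without zero on `u > 0` has coefficients of one sign; for nonnegative
coefficients both bounds are immediate. -/
theorem ratio_bounds {α β s t : ℝ} (hs : 0 < s) (hst : s < t)
    (h : ∀ u : ℝ, 0 < u → α + u * β ≠ 0) :
    1 ≤ (α + t * β) / (α + s * β) ∧ (α + t * β) / (α + s * β) ≤ t / s := by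
  have hαβ : 0 ≤ α * β := by
    by_contra! hneg
    have hβ : β ≠ 0 := by
      rintro rfl
      simp at hneg
    refine h (-α / β) ?_ (by field_simp; ring)
    rw [neg_div, neg_pos, div_neg_iff]
    exact mul_neg_iff.1 hneg
  have hs0 := h s hs
  have key : ∀ {α β : ℝ}, 0 ≤ α → 0 ≤ β → α + s * β ≠ 0 →
      1 ≤ (α + t * β) / (α + s * β) ∧ (α + t * β) / (α + s * β) ≤ t / s := by
    intro α β hα hβ h0
    have hpos : 0 < α + s * β := lt_of_le_of_ne (by positivity) h0.symm
    rw [one_le_div hpos, div_le_div_iff₀ hpos hs]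
    constructor <;> nlinarith
  rcases mul_nonneg_iff.1 hαβ with ⟨h1, h2⟩ | ⟨h1, h2⟩
  · exact key h1 h2 hs0
  · have := key (neg_nonneg.2 h1) (neg_nonneg.2 h2) (by
      intro h0
      exact hs0 (by linarith))
    rwa [show -α + t * -β = -(α + t * β) by ring, show -α + s * -β = -(α + s * β) by ring,
      neg_div_neg_eq] at this

namespace IsConeOver

variable {C : Set (Vec n)} {k : Vec n →ₗ[ℝ] ℝ} {Ω : Set (PSpace n)}

/-- The line through two vectors of the cone leaves the cone. -/
theorem exists_sub_smul_mem_closure (hC : IsConeOver C k Ω) {X Y : Vec n} (hX : X ∈ C)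
    (hY : Y ∈ C) : ∃ α : ℝ, 0 < α ∧ X - α • Y ∈ closure C ∧ X - α • Y ∉ C := by
  set S : Set ℝ := {α | X - α • Y ∈ C} with hS
  have h0 : (0 : ℝ) ∈ S := by simpa [hS] using hX
  have hbd : BddAbove S := by
    refine ⟨k X / k Y, fun α hα => ?_⟩
    have h1 := hC.k_pos hα
    rw [map_sub, map_smul, smul_eq_mul] at h1
    rw [le_div_iff₀ (hC.k_pos hY)]
    linarith
  have hc : Continuous fun α : ℝ => X - α • Y := by fun_prop
  have hSo : IsOpen S := hC.isOpen.preimage hc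
  have hnot : sSup S ∉ S := by
    intro hmem
    obtain ⟨ε, hε, hball⟩ := Metric.isOpen_iff.1 hSo _ hmem
    have : sSup S + ε / 2 ∈ S := hball (by
      rw [Metric.mem_ball, Real.dist_eq, add_sub_cancel_left, abs_of_pos (by positivity)]
      linarith)
    linarith [le_csSup hbd this]
  refine ⟨sSup S, lt_of_le_of_ne (le_csSup hbd h0) fun h => hnot (h ▸ h0), ?_, hnot⟩
  exact map_mem_closure (f := fun α : ℝ => X - α • Y) hc (csSup_mem_closure ⟨0, h0⟩ hbd)
    fun α hα => hα

/-- The endpoints of the chord are `X - α Y` and `Y - β X`. A supporting form vanishing at a point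
strictly between them would vanish at both, giving `f X = α β f X` with `α β < 1`. -/
theorem crossRatios_nonempty (hC : IsConeOver C k Ω) {x y : PSpace n}
    (hxy : x ≠ y) {X Y : Vec n} (hX : X ∈ C) (hY : Y ∈ C) (hx : X ∈ cone {x})
    (hy : Y ∈ cone {y}) : (crossRatios Ω x y).Nonempty := by
  obtain ⟨α, hα, ha, ha'⟩ := hC.exists_sub_smul_mem_closure hX hY
  obtain ⟨β, hβ, hb, hb'⟩ := hC.exists_sub_smul_mem_closure hY hX
  have hindep : ∀ r : ℝ, r ≠ 0 → X ≠ r • Y := by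
    intro r hr h
    refine hxy (eq_of_mem_cone hx ?_)
    rwa [h, smul_mem_cone_iff hr]
  have ha0 : X - α • Y ≠ 0 := fun h => hindep α hα.ne' (sub_eq_zero.1 h)
  have hb0 : Y - β • X ≠ 0 := fun h => hindep β⁻¹ (inv_ne_zero hβ.ne') (by
    rw [sub_eq_zero.1 h, smul_smul, inv_mul_cancel₀ hβ.ne', one_smul])
  have hka := hC.pos _ ha ha0
  have hkb := hC.pos _ hb hb0
  have hkX := hC.k_pos hX
  have hkY := hC.k_pos hY
  rw [map_sub, map_smul, smul_eq_mul] at hka hkb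
  have hαβ : α * β < 1 := by
    by_contra! hge
    have h1 : α * β * k X ≤ α * k Y := by nlinarith
    nlinarith
  have hmem : ∀ u : ℝ, 0 < u → X - α • Y + u • (Y - β • X) ∈ C := by
    intro u hu
    by_contra hnot
    have hcl := hC.closure_add_mem ha (hC.closure_smul_mem hb hu)
    obtain ⟨f, hf, hf0⟩ := hC.exists_support hcl hnot
    have hfn : ∀ v ∈ closure C, 0 ≤ f v := fun v hv =>
      IsOpenConvexCone.functional_nonneg_closure (fun u hu => (hf u hu).le) hv
    have h1 := hfn _ ha
    have h2 := hfn _ hb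
    rw [map_add, map_smul, smul_eq_mul] at hf0
    have h3 : f (X - α • Y) = 0 := by nlinarith
    have h4 : f (Y - β • X) = 0 := by nlinarith
    rw [map_sub, map_smul, smul_eq_mul] at h3 h4
    have h5 := hf X hX
    nlinarith [hf Y hY]
  refine ⟨β⁻¹ / α, X - α • Y, (hC.mem_cone_frontier_iff ha0).2 (Or.inl ⟨ha, ha'⟩), Y - β • X,
    (hC.mem_cone_frontier_iff hb0).2 (Or.inl ⟨hb, hb'⟩),
    fun u hu => (hC.mem_cone _).2 (Or.inl (hmem u hu)), α, β⁻¹, hα, ?_, ?_, ?_, rfl⟩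
  · rwa [lt_inv_comm₀ hα hβ, ← one_div, lt_div_iff₀ hα, mul_comm]
  · have : X - α • Y + α • (Y - β • X) = (1 - α * β) • X := by module
    rw [this, smul_mem_cone_iff (by linarith)]
    exact hx
  · have : X - α • Y + β⁻¹ • (Y - β • X) = (β⁻¹ - α) • Y := by
      rw [smul_sub, smul_smul, inv_mul_cancel₀ hβ.ne']
      module
    rw [this, smul_mem_cone_iff]
    · exact hy
    · have : α < β⁻¹ := by rwa [lt_inv_comm₀ hα hβ, ← one_div, lt_div_iff₀ hα, mul_comm]
      linarith

/-- If `X - ε Y` and `Y - δ X` lie in `C`, the endpoints of the chord lie beyond them, which bounds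
the cross-ratio by `1 / (ε δ)`. Boundedness is needed for the supremum defining the distance to be
meaningful. -/
theorem bddAbove_crossRatios (hC : IsConeOver C k Ω) {x y : PSpace n}
    {X Y : Vec n} (hX : X ∈ C) (hY : Y ∈ C) (hx : X ∈ cone {x})
    (hy : Y ∈ cone {y}) : BddAbove (crossRatios Ω x y) := by
  obtain ⟨ε, hε, h1⟩ := hC.exists_add_smul_mem hX (-Y)
  obtain ⟨δ, hδ, h2⟩ := hC.exists_add_smul_mem hY (-X)
  refine ⟨(ε * δ)⁻¹, ?_⟩
  rintro r ⟨a, ha, b, hb, hab, s, t, hs, hst, hax, hby, rfl⟩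
  rw [eq_mk_of_mem_cone hx, mem_cone_singleton_mk] at hax
  rw [eq_mk_of_mem_cone hy, mem_cone_singleton_mk] at hby
  obtain ⟨l, hl, hax⟩ := hax
  obtain ⟨m, hm, hby⟩ := hby
  have ht : 0 < t := hs.trans hst
  have hk0 : ∀ v ∈ cone Ω, k v ≠ 0 := by
    intro v hv
    rcases (hC.mem_cone v).1 hv with h | h
    · exact (hC.k_pos h).ne'
    · have := hC.k_pos h
      rw [map_neg] at this
      linarith
  have hratio := (ratio_bounds (α := k a) (β := k b) hs hst fun u hu => by
    have := hk0 _ (hab u hu)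
    rwa [map_add, map_smul, smul_eq_mul] at this).1
  have e1 : k a + s * k b = l * k X := by
    rw [← smul_eq_mul, ← map_smul, ← map_add, hax, map_smul, smul_eq_mul]
  have e2 : k a + t * k b = m * k Y := by
    rw [← smul_eq_mul, ← map_smul, ← map_add, hby, map_smul, smul_eq_mul]
  rw [e1, e2] at hratio
  have hkX := hC.k_pos hX
  have hkY := hC.k_pos hY
  set q := m / l with hq
  have hqpos : 0 < q := by
    have h3 : m * k Y / (l * k X) = q * (k Y / k X) := by rw [hq]; field_simp
    rw [h3] at hratio
    have h4 : 0 < k Y / k X := by positivity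
    by_contra! hle
    nlinarith
  have hnotfr : ∀ v ∈ cone (frontier Ω), v ∉ cone Ω := by
    intro v hv
    exact ((mem_cone_frontier hC.isOpen_domain hv.1).1 hv).2
  have hts : 0 < t - s := by linarith
  have hYm : ∀ r : ℝ, r ≤ ε → X - r • Y ∈ C := by
    intro r hr
    rcases hr.eq_or_lt with rfl | hr
    · rwa [smul_neg, ← sub_eq_add_neg] at h1
    · have := hC.add_mem _ h1 _ (hC.smul_mem _ hY (ε - r) (by linarith))
      convert this using 1
      module
  have hXm : ∀ r : ℝ, r ≤ δ → Y - r • X ∈ C := by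
    intro r hr
    rcases hr.eq_or_lt with rfl | hr
    · rwa [smul_neg, ← sub_eq_add_neg] at h2
    · have := hC.add_mem _ h2 _ (hC.smul_mem _ hX (δ - r) (by linarith))
      convert this using 1
      module
  have ha2 : (t - s) • a = (t * l) • (X - (s * q / t) • Y) := by
    have e3 : t * l * (s * q / t) = s * m := by rw [hq]; field_simp
    rw [smul_sub, smul_smul, e3, mul_smul, mul_smul, ← hax, ← hby]
    module
  have hb2 : (t - s) • b = m • (Y - q⁻¹ • X) := by
    have e3 : m * q⁻¹ = l := by rw [hq]; field_simp
    rw [smul_sub, smul_smul, e3, ← hax, ← hby]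
    module
  have h3 : ε < s * q / t := by
    by_contra! hle
    refine hnotfr a ha ?_
    rw [← smul_mem_cone_iff hts.ne', ha2, smul_mem_cone_iff (by positivity)]
    exact (hC.mem_cone _).2 (Or.inl (hYm _ hle))
  have h4 : δ < q⁻¹ := by
    by_contra! hle
    refine hnotfr b hb ?_
    rw [← smul_mem_cone_iff hts.ne', hb2, smul_mem_cone_iff hm]
    exact (hC.mem_cone _).2 (Or.inl (hXm _ hle))
  rw [le_inv_comm₀ (by positivity) (by positivity), inv_div]
  calc ε * δ ≤ s * q / t * q⁻¹ := by gcongr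
    _ = s / t := by field_simp

/-- On the chord, passing from `x` to `y` multiplies any form positive on `C` by a factor between
`1` and the cross-ratio, up to a common scalar. Hence the cross-ratio dominates the quotient of two
such factors. -/
theorem half_log_le_hilbertDist (hC : IsConeOver C k Ω)
    {f₁ f₂ : Vec n →ₗ[ℝ] ℝ} (hf₁ : ∀ v ∈ C, 0 < f₁ v) (hf₂ : ∀ v ∈ C, 0 < f₂ v)
    {x y : PSpace n} {X Y : Vec n} (hX : X ∈ C) (hY : Y ∈ C) (hx : X ∈ cone {x})
    (hy : Y ∈ cone {y}) :
    1 / 2 * Real.log (f₁ X * f₂ Y / (f₁ Y * f₂ X)) ≤ hilbertDist Ω x y := by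
  have p1 := hf₁ X hX
  have p2 := hf₁ Y hY
  have p3 := hf₂ X hX
  have p4 := hf₂ Y hY
  unfold hilbertDist
  split_ifs with hxy
  · rw [← hxy, eq_mk_of_mem_cone hx, mem_cone_singleton_mk] at hy
    obtain ⟨r, hr, rfl⟩ := hy
    rw [map_smul, map_smul, smul_eq_mul, smul_eq_mul,
      show f₁ X * (r * f₂ X) / (r * f₁ X * f₂ X) = 1 by field_simp]
    simp
  · refine mul_le_mul_of_nonneg_left (Real.log_le_log (by positivity) ?_) (by norm_num)
    obtain ⟨r, hr⟩ := hC.crossRatios_nonempty hxy hX hY hx hy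
    refine le_trans ?_ (le_csSup (hC.bddAbove_crossRatios hX hY hx hy) hr)
    obtain ⟨a, ha, b, hb, hab, s, t, hs, hst, hax, hby, rfl⟩ := hr
    rw [eq_mk_of_mem_cone hx, mem_cone_singleton_mk] at hax
    rw [eq_mk_of_mem_cone hy, mem_cone_singleton_mk] at hby
    obtain ⟨l, hl, hax⟩ := hax
    obtain ⟨m, hm, hby⟩ := hby
    have hne : ∀ {f : Vec n →ₗ[ℝ] ℝ}, (∀ v ∈ C, 0 < f v) → ∀ u : ℝ, 0 < u → f a + u * f b ≠ 0 := by
      intro f hf u hu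
      rw [← smul_eq_mul, ← map_smul, ← map_add]
      rcases (hC.mem_cone _).1 (hab u hu) with h | h
      · exact (hf _ h).ne'
      · have := hf _ h
        rw [map_neg] at this
        linarith
    have e1 : ∀ f : Vec n →ₗ[ℝ] ℝ, f a + s * f b = l * f X := fun f => by
      rw [← smul_eq_mul, ← map_smul, ← map_add, hax, map_smul, smul_eq_mul]
    have e2 : ∀ f : Vec n →ₗ[ℝ] ℝ, f a + t * f b = m * f Y := fun f => by
      rw [← smul_eq_mul, ← map_smul, ← map_add, hby, map_smul, smul_eq_mul]
    have b1 := (ratio_bounds hs hst (hne hf₁)).1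
    have b2 := (ratio_bounds hs hst (hne hf₂)).2
    rw [e1, e2] at b1 b2
    have h1 : f₁ X * f₂ Y / (f₁ Y * f₂ X)
        = (m * f₂ Y / (l * f₂ X)) / (m * f₁ Y / (l * f₁ X)) := by field_simp
    rw [h1]
    refine (div_le_iff₀ (by linarith)).2 (b2.trans ?_)
    exact le_mul_of_one_le_right (by have := hs.trans hst; positivity) b1

end IsConeOver

/-! ### Parabolic automorphisms -/

theorem IsParabolic.smul_ne {Ω : Set (PSpace n)} {g : SL n} (hg : IsParabolic Ω g)
    {x : PSpace n} (hx : x ∈ Ω) : g • x ≠ x := by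
  intro h
  have h1 := hg.2.2 x hx
  rw [h, hg.2.1, hilbertDist, if_pos rfl] at h1
  exact h1 rfl

namespace IsCuspOf

variable {Ω : Set (PSpace 3)} {x : PSpace 3} {C : Set (Vec 3)} {k : Vec 3 →ₗ[ℝ] ℝ}
  {p : Vec 3} {f : Vec 3 →ₗ[ℝ] ℝ} {b : Module.Basis (Fin 4) ℝ (Vec 3)} {g : SL 3}
  {T : Vec 3 ≃ₗ[ℝ] Vec 3}

/-- Iterating from a vector `u + s p` of `C` gives `u + a ^ j s p`, which tends to `u`. -/
theorem mem_closure_of_fixed_of_lt_one (h : IsCuspOf Ω x C k p f b) (hT : IsCuspAut C p f T)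
    {a : ℝ} (ha0 : 0 < a) (ha : a < 1) (hp : T p = a • p) {u : Vec 3} (hu : f u = 1)
    (hTu : T u = u) : u ∈ closure C := by
  obtain ⟨s, hs⟩ := h.cusp.full u (by rw [hu]; exact one_pos)
  have hpow : ∀ j : ℕ, u + (a ^ j * s) • p ∈ C := by
    intro j
    induction j with
    | zero => simpa using hs
    | succ j ih =>
      have := hT.map_mem _ ih
      rw [map_add, map_smul, hTu, hp, smul_smul] at this
      convert this using 3
      ring
  have hlim : Tendsto (fun j : ℕ => u + (a ^ j * s) • p) atTop (𝓝 u) := by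
    have h1 : Tendsto (fun j : ℕ => a ^ j * s) atTop (𝓝 0) := by
      simpa using (tendsto_pow_atTop_nhds_zero_of_lt_one ha0.le ha).mul_const s
    simpa using (h1.smul_const p).const_add u
  exact mem_closure_of_tendsto hlim (Eventually.of_forall hpow)

theorem inv_apply_p (h : IsCuspOf Ω x C k p f b) (hT : IsCuspAut C p f T) :
    T⁻¹ p = (mat b T 0 0)⁻¹ • p := by
  obtain ⟨-, -, -, hpos, hTp⟩ := hT.mat_zero h.basis
  change T.symm p = _
  rw [LinearEquiv.symm_apply_eq, map_smul, hTp, smul_smul, inv_mul_cancel₀ hpos.ne', one_smul]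

theorem mem_closure_of_fixed (h : IsCuspOf Ω x C k p f b) (hT : IsCuspAut C p f T)
    (ha : mat b T 0 0 ≠ 1) {u : Vec 3} (hu : f u = 1) (hTu : T u = u) : u ∈ closure C := by
  obtain ⟨-, -, -, hpos, hTp⟩ := hT.mat_zero h.basis
  rcases ha.lt_or_gt with h1 | h1
  · exact h.mem_closure_of_fixed_of_lt_one hT hpos h1 hTp hu hTu
  · refine h.mem_closure_of_fixed_of_lt_one hT.inv (inv_pos.2 hpos) (inv_lt_one_of_one_lt₀ h1)
      (h.inv_apply_p hT) hu ?_
    change T.symm u = u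
    rw [LinearEquiv.symm_apply_eq, hTu]

/-- The fixed vector `u` is a boundary vector. Its supporting form `q` is multiplied by `T` by a
constant, equal to `a` as seen at `p`, while `f` is preserved. The quotient `q / f` thus changes by
the factor `a`, and `half_log_le_hilbertDist` applies. -/
theorem half_abs_log_le (h : IsCuspOf Ω x C k p f b) (hT : IsNormalization C p f g T)
    (ha : mat b T 0 0 ≠ 1) {u : Vec 3} (hu : f u = 1) (hTu : T u = u) (hu' : u ∉ C)
    {y : PSpace 3} (hy : y ∈ Ω) : 1 / 2 * |Real.log (mat b T 0 0)| ≤ hilbertDist Ω y (g • y) := by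
  obtain ⟨-, -, -, hpos, hTp⟩ := hT.mat_zero h.basis
  have hcl := h.mem_closure_of_fixed hT.toIsCuspAut ha hu hTu
  obtain ⟨q, hq, hqu⟩ := h.isCone.exists_support hcl hu'
  have hu0 : u ≠ 0 := by
    rintro rfl
    rw [map_zero] at hu
    exact zero_ne_one hu
  obtain ⟨c, hc, hqT⟩ := h.isCone.support_unique h.c1 hcl hu' hu0 hq hqu
    (f₂ := q ∘ₗ (T : Vec 3 →ₗ[ℝ] Vec 3)) (fun v hv => hq _ (hT.map_mem v hv))
    (by rw [LinearMap.comp_apply, LinearEquiv.coe_coe, hTu, hqu])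
  -- By strict convexity the supporting hyperplane at `u` contains no other boundary point.
  have hqp : q p ≠ 0 := by
    intro h0
    obtain ⟨r, -, hr⟩ := h.isCone.support_eq_smul h.strict hq hcl h.mem_closure hqu h0 h.p_ne_zero
    rw [hr, map_smul, h.cusp.map_p, smul_zero] at hu
    exact zero_ne_one hu
  have hca : c = mat b T 0 0 := by
    have := hqT p
    rw [LinearMap.comp_apply, LinearEquiv.coe_coe, hTp, map_smul, smul_eq_mul] at this
    exact (mul_right_cancel₀ hqp this).symm
  obtain ⟨Y, hYy, hY⟩ := h.isCone.exists_rep hy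
  have hTY := hT.map_mem Y hY
  have hTYy := hT.apply_mem_cone_smul hYy
  have e1 : q (T Y) = mat b T 0 0 * q Y := by rw [← hca]; exact hqT Y
  have p1 := h.cusp.pos Y hY
  have p2 := hq Y hY
  have b1 := h.isCone.half_log_le_hilbertDist h.cusp.pos hq hY hTY hYy hTYy
  have b2 := h.isCone.half_log_le_hilbertDist hq h.cusp.pos hY hTY hYy hTYy
  rw [hT.map_f, e1] at b1 b2
  rw [show f Y * (mat b T 0 0 * q Y) / (f Y * q Y) = mat b T 0 0 by field_simp] at b1
  rw [show q Y * f Y / (mat b T 0 0 * q Y * f Y) = (mat b T 0 0)⁻¹ by field_simp,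
    Real.log_inv] at b2
  rcases abs_choice (Real.log (mat b T 0 0)) with h1 | h1 <;> rw [h1]
  · exact b1
  · exact b2

/-- A parabolic automorphism fixing `x` fixes no line through `x` that meets `Ω`. -/
theorem apply_ne_of_isParabolic (h : IsCuspOf Ω x C k p f b) (hT : IsNormalization C p f g T)
    (hg : IsParabolic Ω g) {u : Vec 3} (hu : f u = 1) (κ : ℝ) : T u ≠ u + κ • p := by
  intro hκ
  have hfix : ∀ v ∈ C, T v ≠ v := by
    intro v hv hTv
    have hv0 := h.isCone.ne_zero hv
    refine hg.smul_ne
      (mk_mem_of_mem_cone ((h.isCone.mem_cone v).2 (Or.inl hv))) (eq_of_mem_cone (v := v) ?_ ⟨hv0, rfl⟩)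
    have := hT.apply_mem_cone_smul (v := v) (x := Projectivization.mk ℝ v hv0) ⟨hv0, rfl⟩
    rwa [hTv] at this
  obtain ⟨-, -, -, hpos, hTp⟩ := hT.mat_zero h.basis
  -- For `a = 1` the line is fixed pointwise, and it meets `Ω`. For `a ≠ 1` the displacement is
  -- bounded below by a positive constant. Both are impossible for a parabolic element.
  by_cases ha : mat b T 0 0 = 1
  · have hTu := hT.fixed_of_fixes_line h.cusp h.basis ha hu hκ
    obtain ⟨s, hs⟩ := h.cusp.full u (by rw [hu]; exact one_pos)
    refine hfix _ hs ?_
    rw [map_add, map_smul, hTu, hTp, ha, one_smul]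
  · obtain ⟨u, hu, hTu⟩ := hT.exists_fixed_of_fixes_line h.basis h.cusp.map_p ha hu hκ
    have hu' : u ∉ C := fun hm => hfix u hm hTu
    obtain ⟨y, hy⟩ := h.isCone.nonempty
    have hyΩ := mk_mem_of_mem_cone ((h.isCone.mem_cone y).2 (Or.inl hy))
    have hle : 1 / 2 * |Real.log (mat b T 0 0)| ≤ translationDist Ω g := by
      refine le_csInf ⟨_, _, hyΩ, rfl⟩ ?_
      rintro _ ⟨z, hz, rfl⟩
      exact h.half_abs_log_le hT ha hu hTu hu' hz
    have hlog : 0 < |Real.log (mat b T 0 0)| :=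
      abs_pos.2 (Real.log_ne_zero_of_pos_of_ne_one hpos ha)
    rw [hg.2.1] at hle
    linarith

theorem unipotent_of_isParabolic (h : IsCuspOf Ω x C k p f b) (hT : IsNormalization C p f g T)
    (hg : IsParabolic Ω g) : mat b T 0 0 = 1 ∧ linPart b T = 1 :=
  hT.of_fixes_no_line h.cusp h.basis fun _ hu κ => h.apply_ne_of_isParabolic hT hg hu κ

/-- A second fixed boundary point would determine a fixed line through `x`. -/
theorem eq_of_smul_eq_of_isParabolic (h : IsCuspOf Ω x C k p f b)
    (hT : IsNormalization C p f g T) (hg : IsParabolic Ω g) {z : PSpace 3} (hz : z ∈ frontier Ω)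
    (hgz : g • z = z) : z = x := by
  by_contra hzx
  have hfz := (h.f_ne_zero_of_frontier hz hzx (rep_mem_cone z)).1
  have h1 := hT.apply_mem_cone_smul (rep_mem_cone z)
  rw [hgz, eq_mk_of_mem_cone (rep_mem_cone z), mem_cone_singleton_mk] at h1
  obtain ⟨r, -, h1⟩ := h1
  have h2 := hT.map_f z.rep
  rw [← eq_mk_of_mem_cone (rep_mem_cone z)] at h1
  rw [h1, map_smul, smul_eq_mul] at h2
  have hr : r = 1 := mul_right_cancel₀ hfz (by rw [h2, one_mul])
  rw [hr, one_smul] at h1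
  refine h.apply_ne_of_isParabolic hT hg (u := (f z.rep)⁻¹ • z.rep) ?_ 0 ?_
  · rw [map_smul, smul_eq_mul, inv_mul_cancel₀ hfz]
  · rw [map_smul, h1, zero_smul, add_zero]

end IsCuspOf


/-! ### Discrete subgroups of the plane -/

theorem exists_basis_of_discrete (L : Submodule ℤ (Fin 2 → ℝ)) [DiscreteTopology L] (hL : L ≠ ⊥) :
    (Nonempty (L ≃+ ℤ) ∧ ∃ c ∈ L, c ≠ 0 ∧ ∀ z ∈ L, ∃ m : ℤ, z = m • c) ∨
      (Nonempty (L ≃+ ℤ × ℤ) ∧ ∃ c ∈ L, ∃ d ∈ L, LinearIndependent ℝ ![c, d] ∧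
        ∀ z ∈ L, ∃ m l : ℤ, z = m • c + l • d) := by
  have hrank : Module.finrank ℤ L ≤ 2 := by
    have h1 := Real.finrank_eq_int_finrank_of_discrete (s := (L : Set (Fin 2 → ℝ)))
      (by rwa [Submodule.span_eq])
    have h2 : Set.finrank ℤ (L : Set (Fin 2 → ℝ)) = Module.finrank ℤ L := by
      rw [Set.finrank, Submodule.span_eq]
    rw [← h2, ← h1]
    exact (Submodule.finrank_le _).trans (by simp)
  have hpos : 0 < Module.finrank ℤ L := by
    have : Nontrivial L := (Submodule.nontrivial_iff_ne_bot).2 hL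
    exact Module.finrank_pos
  have B := Module.finBasis ℤ L
  obtain hr | hr : Module.finrank ℤ L = 1 ∨ Module.finrank ℤ L = 2 := by omega
  · rw [hr] at B
    refine Or.inl ⟨⟨(B.equivFun.trans (LinearEquiv.funUnique (Fin 1) ℤ ℤ)).toAddEquiv⟩, B 0,
      (B 0).2, fun h0 => B.ne_zero 0 (Subtype.ext h0), fun z hz => ⟨B.repr ⟨z, hz⟩ 0, ?_⟩⟩
    have := congrArg Subtype.val (B.sum_repr ⟨z, hz⟩)
    simpa using this.symm
  · rw [hr] at B
    refine Or.inr ⟨⟨(B.equivFun.trans (LinearEquiv.finTwoArrow ℤ ℤ)).toAddEquiv⟩, B 0,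
      (B 0).2, B 1, (B 1).2, ?_, fun z hz => ⟨B.repr ⟨z, hz⟩ 0, B.repr ⟨z, hz⟩ 1, ?_⟩⟩
    · have hspan : Submodule.span ℤ (range fun i => (B i : Fin 2 → ℝ)) = L := by
        have h1 : (range fun i => (B i : Fin 2 → ℝ)) = L.subtype '' range B := by
          rw [← range_comp]
          rfl
        rw [h1, ← Submodule.map_span, B.span_eq, Submodule.map_top, Submodule.range_subtype]
      have h2 := Real.finrank_eq_int_finrank_of_discrete
        (s := range fun i => (B i : Fin 2 → ℝ)) (by rwa [hspan])
      have h3 : LinearIndependent ℝ fun i => (B i : Fin 2 → ℝ) := by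
        rw [linearIndependent_iff_card_eq_finrank_span, h2, Set.finrank, hspan, hr]
        simp
      convert h3 using 1
      ext i j
      fin_cases i <;> rfl
    · have := congrArg Subtype.val (B.sum_repr ⟨z, hz⟩)
      rw [Fin.sum_univ_two] at this
      simpa using this.symm

/-! ### Parabolic subgroups -/

/-- Take `ν ≠ 1` in the normal core of the finite index subgroup. The conjugate `γ⁻¹ ν γ` fixes `x`,
so `ν` fixes the boundary point `γ x`; but `x` is the only boundary point fixed by `ν`. -/
theorem IsParabolicSubgroup.smul_eq {Ω : Set (PSpace 3)} (hΩ : IsProperlyConvex Ω)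
    (hs : IsStrictlyConvex Ω) (hC1 : HasC1Boundary Ω) {P : Subgroup (SL 3)} {x : PSpace 3}
    (hP : IsParabolicSubgroup Ω P x) {γ : SL 3} (hγ : γ ∈ P) : γ • x = x := by
  obtain ⟨C, k, hC⟩ := hΩ.exists_isConeOver
  obtain ⟨p, f, b, h⟩ := exists_isCuspOf hs hC1 hC hP.mem_frontier
  obtain ⟨H, hH, hpar⟩ := hP.exists_finiteIndex
  have hinf := hP.infinite
  obtain ⟨ν, hν, hν1⟩ : ∃ ν ∈ H.normalCore, ν ≠ 1 := by
    by_contra! hno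
    have hbot : H.normalCore = ⊥ := (Subgroup.eq_bot_iff_forall _).2 hno
    have hfi : (⊥ : Subgroup P).FiniteIndex := hbot ▸ inferInstance
    have := Subgroup.index_bot (G := P)
    rw [Nat.card_eq_zero_of_infinite] at this
    exact hfi.index_ne_zero this
  obtain ⟨hνpar, hνx⟩ := hpar ν (H.normalCore_le hν) hν1
  obtain ⟨T, hT⟩ := h.exists_normalization hνpar.1 hνx
  have hconj := H.normalCore_le (H.normalCore_normal.conj_mem ν hν ⟨γ⁻¹, P.inv_mem hγ⟩)
  have hfix : (γ⁻¹ * ν * γ) • x = x := by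
    by_cases h1 : (⟨γ⁻¹, P.inv_mem hγ⟩ : P) * ν * (⟨γ⁻¹, P.inv_mem hγ⟩ : P)⁻¹ = 1
    · have h2 := congrArg (fun z : P => (z : SL 3)) h1
      simp only [Subgroup.coe_mul, Subgroup.coe_inv, inv_inv, Subgroup.coe_one] at h2
      rw [h2, one_smul]
    · have := (hpar _ hconj h1).2
      simpa only [Subgroup.coe_mul, Subgroup.coe_inv, inv_inv] using this
  refine h.eq_of_smul_eq_of_isParabolic hT hνpar ?_ ?_
  · have h1 : γ • Ω = Ω := hP.le_aut hγ
    have h2 : γ • frontier Ω = frontier Ω := by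
      rw [hC.isOpen_domain.frontier_eq, Set.smul_set_sdiff, ← closure_smul, h1]
    rw [← h2]
    exact Set.smul_mem_smul_set hP.mem_frontier
  · rw [mul_smul, mul_smul, inv_smul_eq_iff] at hfix
    exact hfix

/-! ### Translations induced by parabolic elements -/

namespace IsCuspOf

variable {Ω : Set (PSpace 3)} {x : PSpace 3} {C : Set (Vec 3)} {k : Vec 3 →ₗ[ℝ] ℝ}
  {p : Vec 3} {f : Vec 3 →ₗ[ℝ] ℝ} {b : Module.Basis (Fin 4) ℝ (Vec 3)} {g : SL 3}
  {T : Vec 3 ≃ₗ[ℝ] Vec 3}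

theorem exists_normalizationHom (h : IsCuspOf Ω x C k p f b) {P : Subgroup (SL 3)}
    (hP : P ≤ Aut Ω) (hx : ∀ γ ∈ P, γ • x = x) :
    ∃ ρ : P →* (Vec 3 ≃ₗ[ℝ] Vec 3), ∀ γ : P, IsNormalization C p f (γ : SL 3) (ρ γ) := by
  choose ρ hρ using fun γ : P => h.exists_normalization (hP γ.2) (hx γ.1 γ.2)
  exact ⟨MonoidHom.mk' ρ fun γ δ => (hρ (γ * δ)).ext h.f_ne_zero ((hρ γ).mul (hρ δ)), hρ⟩

theorem mat_pow_zero_zero (h : IsCuspOf Ω x C k p f b) (hT : IsCuspAut C p f T) (m : ℕ) :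
    mat b (T ^ m) 0 0 = mat b T 0 0 ^ m := by
  have h1 : (T ^ m) p = mat b T 0 0 ^ m • p := by
    induction m with
    | zero => simp
    | succ m ih =>
      rw [pow_succ', LinearEquiv.mul_apply, ih, map_smul, (hT.mat_zero h.basis).2.2.2.2, smul_smul,
        pow_succ]
  rw [((hT.pow m).mat_zero h.basis).2.2.2.2] at h1
  exact smul_left_injective ℝ h.p_ne_zero h1

/-- Over the plane, a unipotent automorphism whose action on the plane is a translation. -/
theorem apply_planeVec (h : IsCuspOf Ω x C k p f b) (hT : IsCuspAut C p f T)
    (ha : mat b T 0 0 = 1) (hA : linPart b T = 1) (y : Fin 2 → ℝ) (s : ℝ) :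
    T (planeVec b y + s • p) = planeVec b (y + transPart b T)
      + (s + (mat b T 0 1 * y 0 + mat b T 0 2 * y 1 + mat b T 0 3)) • p := by
  have h1 := h.basis.f_planeVec_add y s
  have h2 := h.basis.eq_planeVec_of_f_eq_one (v := T (planeVec b y + s • p)) (by rw [hT.map_f, h1])
  rw [hT.planePt_apply h.basis (by rw [h1]; exact one_ne_zero), h.basis.planePt_planeVec, hA,
    Matrix.one_mulVec] at h2
  rw [h2]
  congr 2
  obtain ⟨k0, k1, k2, -⟩ := repr_planeVec b y
  obtain ⟨l0, l1, l2⟩ := h.basis.repr_p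
  rw [IsCuspAut.repr_zero h.basis, h1, ha]
  simp only [map_add, map_smul, Finsupp.add_apply, Finsupp.smul_apply, k0, k1, k2, l0, l1, l2,
    smul_eq_mul]
  ring

/-- `T` maps the region above the graph onto itself. -/
theorem height_add (h : IsCuspOf Ω x C k p f b) (hT : IsCuspAut C p f T)
    (ha : mat b T 0 0 = 1) (hA : linPart b T = 1) (y : Fin 2 → ℝ) :
    height C p b (y + transPart b T)
      = height C p b y + (mat b T 0 1 * y 0 + mat b T 0 2 * y 1 + mat b T 0 3) := by
  have key : ∀ s, height C p b y < s ↔ height C p b (y + transPart b T)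
      < s + (mat b T 0 1 * y 0 + mat b T 0 2 * y 1 + mat b T 0 3) := by
    intro s
    rw [← h.planeVec_mem_iff, ← h.planeVec_mem_iff, ← h.apply_planeVec hT ha hA]
    refine ⟨hT.map_mem _, fun hm => ?_⟩
    have := hT.symm_mem _ hm
    rwa [T.symm_apply_apply] at this
  apply le_antisymm
  · refine le_of_forall_gt fun r hr => ?_
    have := (key (r - (mat b T 0 1 * y 0 + mat b T 0 2 * y 1 + mat b T 0 3))).1 (by linarith)
    linarith
  · rw [← le_sub_iff_add_le]
    refine le_of_forall_gt fun r hr => ?_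
    exact (key r).2 (by linarith)

/-- The matrix of the automorphism acting on the plane by the translation by `t`. -/
def translationMatrix (C : Set (Vec 3)) (p : Vec 3) (b : Module.Basis (Fin 4) ℝ (Vec 3))
    (t : Fin 2 → ℝ) : Matrix (Fin 4) (Fin 4) ℝ :=
  -- The first row is obtained by solving `height_add` at the points `0`, `(1, 0)` and `(0, 1)`.
  -- This makes the matrix a continuous function of the translation.
  !![1, height C p b (![1, 0] + t) - height C p b ![1, 0] - (height C p b t - height C p b 0),
      height C p b (![0, 1] + t) - height C p b ![0, 1] - (height C p b t - height C p b 0),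
      height C p b t - height C p b 0;
    0, 1, 0, t 0; 0, 0, 1, t 1; 0, 0, 0, 1]

theorem continuous_translationMatrix (h : IsCuspOf Ω x C k p f b) :
    Continuous (translationMatrix C p b) := by
  have hh := h.continuous_height
  have h1 : Continuous fun t : Fin 2 → ℝ => height C p b (![1, 0] + t) :=
    hh.comp (continuous_const.add continuous_id)
  have h2 : Continuous fun t : Fin 2 → ℝ => height C p b (![0, 1] + t) :=
    hh.comp (continuous_const.add continuous_id)
  refine continuous_matrix fun i j => ?_
  fin_cases i <;> fin_cases j <;>
    first
    | exact (h1.sub continuous_const).sub (hh.sub continuous_const)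
    | exact (h2.sub continuous_const).sub (hh.sub continuous_const)
    | exact hh.sub continuous_const
    | exact continuous_apply (0 : Fin 2)
    | exact continuous_apply (1 : Fin 2)
    | exact continuous_const (y := (0 : ℝ))
    | exact continuous_const (y := (1 : ℝ))

theorem mat_eq_translationMatrix (h : IsCuspOf Ω x C k p f b) (hT : IsCuspAut C p f T)
    (ha : mat b T 0 0 = 1) (hA : linPart b T = 1) :
    mat b T = translationMatrix C p b (transPart b T) := by
  obtain ⟨m10, m20, m30, -⟩ := hT.mat_zero h.basis
  obtain ⟨m31, m32, m33⟩ := hT.mat_three h.basis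
  have m11 := congrFun (congrFun hA 0) 0
  have m12 := congrFun (congrFun hA 0) 1
  have m21 := congrFun (congrFun hA 1) 0
  have m22 := congrFun (congrFun hA 1) 1
  simp only [linPart, Matrix.of_apply, Matrix.cons_val', Matrix.cons_val_zero, Matrix.cons_val_one,
    Matrix.cons_val_fin_one, Matrix.one_apply_eq, ne_eq, zero_ne_one, one_ne_zero,
    not_false_eq_true, Matrix.one_apply_ne] at m11 m12 m21 m22
  have h0 := h.height_add hT ha hA 0
  have h1 := h.height_add hT ha hA ![1, 0]
  have h2 := h.height_add hT ha hA ![0, 1]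
  simp only [zero_add, Pi.zero_apply, Matrix.cons_val_zero, Matrix.cons_val_one,
    Matrix.cons_val_fin_one, mul_zero, mul_one, add_zero] at h0 h1 h2
  ext i j
  fin_cases i <;> fin_cases j <;>
    simp only [translationMatrix, Matrix.of_apply, Matrix.cons_val', Matrix.cons_val_zero,
      Matrix.cons_val_one, Matrix.cons_val, Matrix.cons_val_fin_one, Fin.zero_eta, Fin.mk_one,
      Fin.reduceFinMk, h0, h1, h2, ha, m10, m20, m30, m31, m32, m33, m11, m12, m21, m22] <;>
    first
    | ring
    | rfl

/-- Comparing determinants gives `r ^ 4 = 1`: in the unipotent case the normalization is `g` up to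
sign. -/
theorem sq_smul_eq (h : IsCuspOf Ω x C k p f b) (hT : IsNormalization C p f g T)
    (ha : mat b T 0 0 = 1) (hA : (linPart b T).det = 1) {r : ℝ} (hr : ∀ v, T v = r • (g • v)) :
    r ^ 2 = 1 := by
  have h1 := hT.det_eq h.basis
  have h2 : (T : Vec 3 →ₗ[ℝ] Vec 3) = r • Matrix.toLin' g.1 := by
    ext1 i
    ext1
    exact hr _
  rw [ha, hA, h2, LinearMap.det_smul, LinearMap.det_toLin', g.2, Module.finrank_fin_fun] at h1
  have h3 : (r ^ 2 - 1) * (r ^ 2 + 1) = 0 := by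
    have h4 : r ^ 4 = 1 := by simpa using h1
    linear_combination h4
  rcases mul_eq_zero.1 h3 with h4 | h4
  · linarith
  · nlinarith [sq_nonneg r]

/-- Squaring removes the sign ambiguity between `g` and its normalization, so `g ^ 2` depends
continuously on the translation. -/
theorem pow_two_val_eq (h : IsCuspOf Ω x C k p f b) (hT : IsNormalization C p f g T)
    (ha : mat b T 0 0 = 1) (hA : linPart b T = 1) :
    (g ^ 2).1 = LinearMap.toMatrix' (Matrix.toLin b b (translationMatrix C p b (transPart b T) ^ 2)) := by
  obtain ⟨r, -, hr⟩ := hT.exists_smul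
  have h1 := h.sq_smul_eq hT ha (by rw [hA, Matrix.det_one]) hr
  rw [← h.mat_eq_translationMatrix hT.toIsCuspAut ha hA, pow_two (mat b T), ← IsCuspAut.mat_mul,
    Matrix.toLin_toMatrix]
  have h2 : ((T * T : Vec 3 ≃ₗ[ℝ] Vec 3) : Vec 3 →ₗ[ℝ] Vec 3) = Matrix.toLin' (g ^ 2).1 := by
    ext1 i
    ext1
    change T (T _) = (g ^ 2) • _
    rw [hr, hr, smul_comm g r, smul_smul, ← pow_two, h1, one_smul, pow_two, mul_smul]
  rw [h2, LinearMap.toMatrix'_toLin']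

theorem transPart_ne_zero (h : IsCuspOf Ω x C k p f b) (hT : IsNormalization C p f g T)
    (hg : IsParabolic Ω g) : transPart b T ≠ 0 := by
  intro h0
  obtain ⟨ha, hA⟩ := h.unipotent_of_isParabolic hT hg
  have h1 := h.apply_planeVec hT.toIsCuspAut ha hA 0 0
  rw [h0, zero_smul, add_zero, add_zero] at h1
  exact h.apply_ne_of_isParabolic hT hg (h.basis.f_planeVec 0) _ h1

end IsCuspOf

/-- A group fixing the boundary point `x`, with its normalized action, and a subgroup of finite
index all of whose nontrivial elements are parabolic. -/
structure IsParabolicAction (Ω : Set (PSpace 3)) (C : Set (Vec 3)) (p : Vec 3)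
    (f : Vec 3 →ₗ[ℝ] ℝ) (P : Subgroup (SL 3)) (ρ : P →* (Vec 3 ≃ₗ[ℝ] Vec 3)) (H : Subgroup P) :
    Prop where
  discrete : DiscreteTopology P
  infinite : Infinite P
  finiteIndex : H.FiniteIndex
  norm : ∀ γ : P, IsNormalization C p f (γ : SL 3) (ρ γ)
  parabolic : ∀ γ ∈ H, γ ≠ 1 → IsParabolic Ω (γ : SL 3)

namespace IsParabolicAction

variable {Ω : Set (PSpace 3)} {x : PSpace 3} {C : Set (Vec 3)} {k : Vec 3 →ₗ[ℝ] ℝ}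
  {p : Vec 3} {f : Vec 3 →ₗ[ℝ] ℝ} {b : Module.Basis (Fin 4) ℝ (Vec 3)}
  {P : Subgroup (SL 3)} {ρ : P →* (Vec 3 ≃ₗ[ℝ] Vec 3)} {H : Subgroup P}

theorem unipotent (hP : IsParabolicAction Ω C p f P ρ H) (h : IsCuspOf Ω x C k p f b) {γ : P}
    (hγ : γ ∈ H) : mat b (ρ γ) 0 0 = 1 ∧ linPart b (ρ γ) = 1 := by
  by_cases h1 : γ = 1
  · rw [h1, map_one, IsCuspAut.linPart_one, IsCuspAut.mat_one]
    exact ⟨rfl, rfl⟩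
  · exact h.unipotent_of_isParabolic (hP.norm γ) (hP.parabolic γ hγ h1)

/-- Some power of `γ` lies in `H`, and the positive number `a` has that power equal to `1`. -/
theorem mat_zero_zero (hP : IsParabolicAction Ω C p f P ρ H) (h : IsCuspOf Ω x C k p f b) (γ : P) :
    mat b (ρ γ) 0 0 = 1 := by
  obtain ⟨m, hm, -, hmH⟩ := Subgroup.exists_pow_mem_of_index_ne_zero hP.finiteIndex.index_ne_zero γ
  have h1 := (hP.unipotent h hmH).1
  rw [map_pow, h.mat_pow_zero_zero (hP.norm γ).toIsCuspAut] at h1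
  exact (pow_eq_one_iff_of_nonneg ((hP.norm γ).mat_zero h.basis).2.2.2.1.le hm.ne').1 h1

/-- The translations of the plane induced by the elements of `H`. -/
def translationHom (hP : IsParabolicAction Ω C p f P ρ H) (h : IsCuspOf Ω x C k p f b) :
    Additive H →+ (Fin 2 → ℝ) where
  toFun γ := transPart b (ρ γ.toMul)
  map_zero' := by
    change transPart b (ρ 1) = 0
    rw [map_one, transPart_one]
  map_add' γ δ := by
    change transPart b (ρ (γ.toMul * δ.toMul : H)) = _
    rw [Subgroup.coe_mul, map_mul, (hP.norm _).transPart_mul (hP.norm _).toIsCuspAut h.basis,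
      (hP.unipotent h γ.toMul.2).2, Matrix.one_mulVec, add_comm]

theorem translationHom_injective (hP : IsParabolicAction Ω C p f P ρ H)
    (h : IsCuspOf Ω x C k p f b) : Function.Injective (hP.translationHom h) := by
  rw [injective_iff_map_eq_zero]
  intro γ hγ
  by_contra h1
  exact h.transPart_ne_zero (hP.norm _) (hP.parabolic _ γ.toMul.2 fun h2 => h1 (Subtype.ext h2)) hγ

/-- If the translation of `γ` is close to `0`, then `γ ^ 2` is close to `1`, hence equal to `1` by
discreteness. So twice the translation is zero. -/
theorem discreteTopology_range (hP : IsParabolicAction Ω C p f P ρ H)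
    (h : IsCuspOf Ω x C k p f b) : DiscreteTopology (hP.translationHom h).range := by
  have hd := hP.discrete
  obtain ⟨W, hW, hW1⟩ : ∃ W : Set (Matrix (Fin 4) (Fin 4) ℝ), IsOpen W ∧
      ∀ γ : P, (γ : SL 3).1 ∈ W ↔ γ = 1 := by
    obtain ⟨U, hU, hU1⟩ := isOpen_induced_iff.1 (isOpen_discrete ({1} : Set P))
    obtain ⟨W, hW, rfl⟩ := isOpen_induced_iff.1 hU
    refine ⟨W, hW, fun γ => ?_⟩
    exact Set.ext_iff.1 hU1 γ
  set Ψ : (Fin 2 → ℝ) → Matrix (Fin 4) (Fin 4) ℝ := fun t =>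
    LinearMap.toMatrix' (Matrix.toLin b b (IsCuspOf.translationMatrix C p b t ^ 2)) with hΨ
  have hΨc : Continuous Ψ := by
    have h1 : Continuous fun M : Matrix (Fin 4) (Fin 4) ℝ =>
        LinearMap.toMatrix' (Matrix.toLin b b M) :=
      LinearMap.continuous_of_finiteDimensional
        ((Matrix.toLin b b).trans LinearMap.toMatrix').toLinearMap
    exact h1.comp (h.continuous_translationMatrix.pow 2)
  rw [discreteTopology_iff_isOpen_singleton_zero]
  have : ({0} : Set (hP.translationHom h).range) = (fun t => Ψ t.1) ⁻¹' W := by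
    ext ⟨t, ht⟩
    obtain ⟨γ, rfl⟩ := ht
    have h1 := h.pow_two_val_eq (hP.norm γ.toMul) (hP.unipotent h γ.toMul.2).1
      (hP.unipotent h γ.toMul.2).2
    have h2 : Ψ (hP.translationHom h γ) = (((γ.toMul : P) ^ 2 : P) : SL 3).1 := h1.symm
    rw [mem_preimage, h2, hW1, mem_singleton_iff, Subtype.ext_iff]
    constructor
    · intro h3
      have h4 : γ = 0 := hP.translationHom_injective h (by rw [map_zero]; exact h3)
      rw [h4]
      exact one_pow 2
    · intro h3
      have h4 : 2 • γ = 0 := Subtype.ext h3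
      have h5 := congrArg (hP.translationHom h) h4
      rw [map_nsmul, map_zero, smul_eq_zero] at h5
      exact h5.resolve_left (by norm_num)
  rw [this]
  exact hW.preimage (hΨc.comp continuous_subtype_val)

theorem exists_ne_one (hP : IsParabolicAction Ω C p f P ρ H) : ∃ γ ∈ H, γ ≠ 1 := by
  by_contra! hno
  have hbot : H = ⊥ := (Subgroup.eq_bot_iff_forall _).2 hno
  have hinf := hP.infinite
  have := Subgroup.index_bot (G := P)
  rw [Nat.card_eq_zero_of_infinite, ← hbot] at this
  exact hP.finiteIndex.index_ne_zero this

/-- The subgroup `H` is generated by one translation or by two independent translations. -/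
theorem exists_generators (hP : IsParabolicAction Ω C p f P ρ H) (h : IsCuspOf Ω x C k p f b) :
    (Nonempty (H ≃* Multiplicative ℤ) ∧ ∃ γ ∈ H, transPart b (ρ γ) ≠ 0 ∧
      ∀ δ ∈ H, ∃ m : ℤ, δ = γ ^ m) ∨
    (Nonempty (H ≃* Multiplicative (ℤ × ℤ)) ∧ ∃ γ ∈ H, ∃ δ ∈ H,
      LinearIndependent ℝ ![transPart b (ρ γ), transPart b (ρ δ)] ∧ γ * δ = δ * γ ∧
      ∀ η ∈ H, ∃ m l : ℤ, η = γ ^ m * δ ^ l) := by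
  set φ := hP.translationHom h with hφ
  have hφi := hP.translationHom_injective h
  have hφv : ∀ γ : Additive H, φ γ = transPart b (ρ γ.toMul) := fun _ => rfl
  have hd := hP.discreteTopology_range h
  set L : Submodule ℤ (Fin 2 → ℝ) := AddSubgroup.toIntSubmodule φ.range with hL
  have hdL : DiscreteTopology L := hd
  have hLm : ∀ t, t ∈ L ↔ ∃ γ, φ γ = t := fun t => Iff.rfl
  have hne : L ≠ ⊥ := by
    obtain ⟨γ, hγ, hγ1⟩ := hP.exists_ne_one
    intro h0
    have h1 : φ (Additive.ofMul ⟨γ, hγ⟩) ∈ L := ⟨_, rfl⟩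
    rw [h0, Submodule.mem_bot, ← map_zero φ] at h1
    exact hγ1 (congrArg Subtype.val (hφi h1))
  have e : Additive H ≃+ L := AddMonoidHom.ofInjective hφi
  rcases exists_basis_of_discrete L hne with ⟨⟨e'⟩, c, hc, hc0, hgen⟩ |
    ⟨⟨e'⟩, c, hc, d, hd, hli, hgen⟩
  · obtain ⟨γ, rfl⟩ := (hLm _).1 hc
    refine Or.inl ⟨⟨AddEquiv.toMultiplicativeRight (e.trans e')⟩, γ.toMul, γ.toMul.2, hc0,
      fun δ hδ => ?_⟩
    obtain ⟨m, hm⟩ := hgen (φ (Additive.ofMul ⟨δ, hδ⟩)) ⟨_, rfl⟩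
    rw [← map_zsmul] at hm
    exact ⟨m, congrArg Subtype.val (hφi hm)⟩
  · obtain ⟨γ, rfl⟩ := (hLm _).1 hc
    obtain ⟨δ, rfl⟩ := (hLm _).1 hd
    refine Or.inr ⟨⟨AddEquiv.toMultiplicativeRight (e.trans e')⟩, γ.toMul, γ.toMul.2, δ.toMul,
      δ.toMul.2, hli, ?_, fun η hη => ?_⟩
    · have h1 : γ + δ = δ + γ := hφi (by rw [map_add, map_add, add_comm])
      exact congrArg Subtype.val h1
    · obtain ⟨m, l, hm⟩ := hgen (φ (Additive.ofMul ⟨η, hη⟩)) ⟨_, rfl⟩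
      rw [← map_zsmul, ← map_zsmul, ← map_add] at hm
      exact ⟨m, l, congrArg Subtype.val (hφi hm)⟩

end IsParabolicAction


/-! ### Invariant quadratic forms -/

/-- Symmetric bilinear forms with isotropic vector `p`, with `p^⊥ = ker f`, and positive definite on
`ker f / p`. -/
structure IsCuspForm (p : Vec 3) (f : Vec 3 →ₗ[ℝ] ℝ) (B : LinearMap.BilinForm ℝ (Vec 3)) :
    Prop where
  symm : ∀ v w, B v w = B w v
  map_p : ∀ v, B p v = -f v
  pos : ∀ v, f v = 0 → (∀ r : ℝ, v ≠ r • p) → 0 < B v v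

/-- The group of the linear automorphisms that preserve `B`. -/
def formGroup (B : LinearMap.BilinForm ℝ (Vec 3)) : Subgroup (Vec 3 ≃ₗ[ℝ] Vec 3) where
  carrier := {T | ∀ v w, B (T v) (T w) = B v w}
  one_mem' _ _ := rfl
  mul_mem' {T S} hT hS v w := by
    rw [LinearEquiv.mul_apply, LinearEquiv.mul_apply, hT, hS]
  inv_mem' {T} hT v w := by
    have := hT (T.symm v) (T.symm w)
    rw [T.apply_symm_apply, T.apply_symm_apply] at this
    exact this.symm

/-- Averaging over a finite index subgroup. -/
theorem IsCuspForm.exists_invariant {p : Vec 3} {f : Vec 3 →ₗ[ℝ] ℝ}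
    {B : LinearMap.BilinForm ℝ (Vec 3)} (hB : IsCuspForm p f B) {G : Type*} [Group G]
    (ρ : G →* (Vec 3 ≃ₗ[ℝ] Vec 3)) (hf : ∀ γ v, f (ρ γ v) = f v) (hp : ∀ γ, ρ γ p = p)
    (H : Subgroup G) [H.FiniteIndex] (hH : ∀ γ ∈ H, ρ γ ∈ formGroup B) :
    ∃ B', IsCuspForm p f B' ∧ ∀ γ, ρ γ ∈ formGroup B' := by
  have hfin : Fintype (G ⧸ H) := Fintype.ofFinite _
  set N : ℝ := (Fintype.card (G ⧸ H) : ℝ) with hN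
  have hNpos : 0 < N := by
    rw [hN]
    exact_mod_cast Fintype.card_pos
  set B' : LinearMap.BilinForm ℝ (Vec 3) := N⁻¹ • ∑ q : G ⧸ H,
    B.comp (ρ q.out⁻¹ : Vec 3 →ₗ[ℝ] Vec 3) (ρ q.out⁻¹ : Vec 3 →ₗ[ℝ] Vec 3) with hB'
  have hB'v : ∀ v w, B' v w = N⁻¹ * ∑ q : G ⧸ H, B (ρ q.out⁻¹ v) (ρ q.out⁻¹ w) := by
    intro v w
    simp [hB', LinearMap.sum_apply]
  refine ⟨B', ⟨fun v w => ?_, fun v => ?_, fun v hv hvp => ?_⟩, fun δ v w => ?_⟩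
  · rw [hB'v, hB'v]
    simp only [hB.symm]
  · rw [hB'v]
    simp only [hp, hB.map_p, hf, Finset.sum_const, Finset.card_univ, nsmul_eq_mul]
    rw [← hN]
    field_simp
  · rw [hB'v]
    refine mul_pos (inv_pos.2 hNpos) (Finset.sum_pos (fun q _ => ?_) Finset.univ_nonempty)
    refine hB.pos _ (by rw [hf, hv]) fun r hr => hvp r ?_
    have h1 := hp q.out⁻¹
    apply (ρ q.out⁻¹).injective
    rw [hr, map_smul, h1]
  · rw [hB'v, hB'v]
    congr 1
    rw [← Equiv.sum_comp (MulAction.toPerm (δ⁻¹ : G)) fun q : G ⧸ H =>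
      B (ρ q.out⁻¹ v) (ρ q.out⁻¹ w)]
    refine Finset.sum_congr rfl fun q _ => ?_
    rw [MulAction.toPerm_apply]
    -- Translating the cosets permutes the terms of the average; the chosen representatives change
    -- by elements of `H`, which preserve `B`.
    obtain ⟨η, hη⟩ := QuotientGroup.mk_out_eq_mul H (δ⁻¹ * q.out)
    have h1 : δ⁻¹ • q = ((δ⁻¹ * q.out : G) : G ⧸ H) := by
      conv_lhs => rw [← QuotientGroup.out_eq' q]
      rfl
    have h2 : ρ q.out⁻¹ * ρ δ = ρ (η : G) * ρ (δ⁻¹ • q).out⁻¹ := by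
      rw [h1, hη, ← map_mul, ← map_mul]
      congr 1
      group
    have h3 : ∀ v, ρ q.out⁻¹ (ρ δ v) = ρ (η : G) (ρ (δ⁻¹ • q).out⁻¹ v) := fun v =>
      LinearEquiv.congr_fun h2 v
    rw [h3, h3, hH η η.2]

/-- The bilinear form with given values on a cusp basis. -/
def cuspForm (b : Module.Basis (Fin 4) ℝ (Vec 3)) (a β δ : ℝ) : LinearMap.BilinForm ℝ (Vec 3) :=
  -- The entries `-a / 2` and `-δ / 2` are those for which `b 3 + b 1` and `b 3 + b 2` are isotropic
  -- like `b 3`.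
  Matrix.toBilin b !![0, 0, 0, -1; 0, a, β, -(a / 2); 0, β, δ, -(δ / 2); -1, -(a / 2), -(δ / 2), 0]

theorem cuspForm_apply (b : Module.Basis (Fin 4) ℝ (Vec 3)) (a β δ : ℝ) (v w : Vec 3) :
    cuspForm b a β δ v w = -(b.repr v 0 * b.repr w 3 + b.repr v 3 * b.repr w 0)
      + a * (b.repr v 1 * b.repr w 1) + β * (b.repr v 1 * b.repr w 2 + b.repr v 2 * b.repr w 1)
      + δ * (b.repr v 2 * b.repr w 2) - a / 2 * (b.repr v 1 * b.repr w 3 + b.repr v 3 * b.repr w 1)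
      - δ / 2 * (b.repr v 2 * b.repr w 3 + b.repr v 3 * b.repr w 2) := by
  rw [cuspForm, Matrix.toBilin_apply]
  simp only [Fin.sum_univ_four, Matrix.of_apply, Matrix.cons_val', Matrix.cons_val_zero,
    Matrix.cons_val_one, Matrix.cons_val, Matrix.cons_val_fin_one]
  ring

theorem isCuspForm_cuspForm {p : Vec 3} {f : Vec 3 →ₗ[ℝ] ℝ} {b : Module.Basis (Fin 4) ℝ (Vec 3)}
    (hb : IsCuspBasis p f b) {a β δ : ℝ} (ha : 0 < a) (h : β ^ 2 < a * δ) :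
    IsCuspForm p f (cuspForm b a β δ) := by
  refine ⟨fun v w => ?_, fun v => ?_, fun v hv hvp => ?_⟩
  · rw [cuspForm_apply, cuspForm_apply]
    ring
  · rw [cuspForm_apply, ← hb.zero, ← hb.coord]
    simp
  · rw [← hb.coord] at hv
    rw [cuspForm_apply, hv]
    by_contra! hle
    have h1 : (a * b.repr v 1 + β * b.repr v 2) ^ 2 + (a * δ - β ^ 2) * b.repr v 2 ^ 2 ≤ 0 := by
      nlinarith
    have h2 : b.repr v 2 = 0 := by
      by_contra h2
      have : 0 < (a * δ - β ^ 2) * b.repr v 2 ^ 2 := mul_pos (by linarith) (by positivity)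
      nlinarith [sq_nonneg (a * b.repr v 1 + β * b.repr v 2)]
    have h3 : b.repr v 1 = 0 := by
      rw [h2] at h1
      have : a * b.repr v 1 = 0 := by nlinarith [sq_nonneg (a * b.repr v 1)]
      exact (mul_eq_zero.1 this).resolve_left ha.ne'
    refine hvp (b.repr v 0) (b.ext_elem fun i => ?_)
    rw [← hb.zero]
    fin_cases i <;> simp [h2, h3, hv]

/-- `T` acts on the basis `b` as a unipotent automorphism inducing the translation by the `i`-th
basis vector. -/
structure IsUnitTranslation (b : Module.Basis (Fin 4) ℝ (Vec 3)) (T : Vec 3 ≃ₗ[ℝ] Vec 3) (i : Fin 4)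
    (l₁ l₂ : ℝ) : Prop where
  zero : T (b 0) = b 0
  one : T (b 1) = b 1 + l₁ • b 0
  two : T (b 2) = b 2 + l₂ • b 0
  three : T (b 3) = b 3 + b i

namespace IsUnitTranslation

variable {C : Set (Vec 3)} {p : Vec 3} {f : Vec 3 →ₗ[ℝ] ℝ} {b : Module.Basis (Fin 4) ℝ (Vec 3)}
  {T S : Vec 3 ≃ₗ[ℝ] Vec 3}

theorem apply {i : Fin 4} {l₁ l₂ : ℝ} (hT : IsUnitTranslation b T i l₁ l₂) (v : Vec 3) :
    T v = v + (l₁ * b.repr v 1 + l₂ * b.repr v 2) • b 0 + b.repr v 3 • b i := by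
  conv_lhs => rw [← b.sum_repr v]
  conv_rhs => rw [← b.sum_repr v]
  rw [Fin.sum_univ_four, map_add, map_add, map_add, map_smul, map_smul, map_smul, map_smul,
    hT.zero, hT.one, hT.two, hT.three]
  simp only [map_add, map_smul, Module.Basis.repr_self, Finsupp.add_apply, Finsupp.smul_apply,
    smul_eq_mul]
  simp
  module

theorem mem_formGroup_one {a β δ : ℝ} (hT : IsUnitTranslation b T 1 a β) :
    T ∈ formGroup (cuspForm b a β δ) := by
  intro v w
  rw [cuspForm_apply, cuspForm_apply, hT.apply v, hT.apply w]
  simp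
  ring

theorem mem_formGroup_two {a β δ : ℝ} (hT : IsUnitTranslation b T 2 β δ) :
    T ∈ formGroup (cuspForm b a β δ) := by
  intro v w
  rw [cuspForm_apply, cuspForm_apply, hT.apply v, hT.apply w]
  simp
  ring

/-- After `m` steps the orbit of `b 3 + s b 0` has horizontal coordinate `m` and height `s + a m (m
- 1) / 2`, which for `a ≤ 0` would not outgrow `m`. -/
theorem pos (hC : IsCusp C p f) (hb : IsCuspBasis p f b) {i : Fin 4} (hi0 : i ≠ 0) (hi3 : i ≠ 3)
    (hTC : ∀ v ∈ C, T v ∈ C) {a : ℝ} (h0 : T (b 0) = b 0) (hi : T (b i) = b i + a • b 0)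
    (h3 : T (b 3) = b 3 + b i) : 0 < a := by
  have hf3 : f (b 3) = 1 := by rw [← hb.coord]; simp
  have hfi : f (b i) = 0 := by rw [← hb.coord]; simp [hi3]
  obtain ⟨s, hs⟩ := hC.full (b 3) (by rw [hf3]; exact one_pos)
  rw [← hb.zero] at hs
  have horb : ∀ m : ℕ, b 3 + (m : ℝ) • b i + (s + a * (m * (m - 1) / 2)) • b 0 ∈ C := by
    intro m
    induction m with
    | zero => simpa using hs
    | succ m ih =>
      have := hTC _ ih
      rw [map_add, map_add, map_smul, map_smul, h0, hi, h3] at this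
      convert this using 1
      push_cast
      module
  obtain ⟨c, hc⟩ := hC.superlinear (b.coord 0 - b.coord i) (by
    rw [← hb.zero]
    simp [hi0.symm])
  by_contra! ha
  obtain ⟨m, hm⟩ := exists_nat_gt (s + c + 1)
  have h1 := hc _ (horb (m + 1))
  simp only [map_add, map_smul, LinearMap.sub_apply, Module.Basis.coord_apply, hf3, hfi,
    hb.zero ▸ hC.map_p, Module.Basis.repr_self] at h1
  simp [hi0, hi0.symm, hi3.symm] at h1
  have h2 : a * ((m + 1 : ℝ) * m / 2) ≤ 0 := mul_nonpos_of_nonpos_of_nonneg ha (by positivity)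
  linarith

/-- The orbit under `T` and `S` has height equal to half the quadratic form with coefficients `a, β,
δ`, plus an affine term. If the form were not positive definite, lattice points near its nonpositive
direction would have height bounded by a linear function. -/
theorem sq_lt (hC : IsCusp C p f) (hb : IsCuspBasis p f b) (hT' : IsCuspAut C p f T)
    (hS' : IsCuspAut C p f S) {a β δ : ℝ} (hT : IsUnitTranslation b T 1 a β)
    (hS : IsUnitTranslation b S 2 β δ) : β ^ 2 < a * δ := by
  have ha : 0 < a := pos hC hb (by decide) (by decide) hT'.map_mem hT.zero hT.one hT.three
  have hδ : 0 < δ := pos hC hb (by decide) (by decide) hS'.map_mem hS.zero hS.two hS.three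
  have hf3 : f (b 3) = 1 := by rw [← hb.coord]; simp
  have hf1 : f (b 1) = 0 := by rw [← hb.coord]; simp
  have hf2 : f (b 2) = 0 := by rw [← hb.coord]; simp
  have hf0 : f (b 0) = 0 := by rw [← hb.coord]; simp
  obtain ⟨s, hs⟩ := hC.full (b 3) (by rw [hf3]; exact one_pos)
  rw [← hb.zero] at hs
  set V : ℤ → ℤ → Vec 3 := fun m l => b 3 + (m : ℝ) • b 1 + (l : ℝ) • b 2
    + (s + (a * (m * (m - 1)) + 2 * β * (m * l) + δ * (l * (l - 1))) / 2) • b 0 with hV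
  have hiff : ∀ {R : Vec 3 ≃ₗ[ℝ] Vec 3}, IsCuspAut C p f R → ∀ {v w}, R v = w → (v ∈ C ↔ w ∈ C) := by
    rintro R hR v _ rfl
    refine ⟨hR.map_mem v, fun h => ?_⟩
    have := hR.symm_mem _ h
    rwa [R.symm_apply_apply] at this
  have hTV : ∀ m l, V m l ∈ C ↔ V (m + 1) l ∈ C := by
    intro m l
    refine hiff hT' ?_
    simp only [hV, map_add, map_smul, hT.zero, hT.one, hT.two, hT.three]
    push_cast
    module
  have hSV : ∀ m l, V m l ∈ C ↔ V m (l + 1) ∈ C := by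
    intro m l
    refine hiff hS' ?_
    simp only [hV, map_add, map_smul, hS.zero, hS.one, hS.two, hS.three]
    push_cast
    module
  have hmem : ∀ m l, V m l ∈ C := by
    intro m l
    induction m using Int.induction_on with
    | zero =>
      induction l using Int.induction_on with
      | zero => simpa [hV] using hs
      | succ l ih => exact (hSV _ _).1 ih
      | pred l ih => exact (hSV _ _).2 (by rwa [sub_add_cancel])
    | succ m ih => exact (hTV _ _).1 ih
    | pred m ih => exact (hTV _ _).2 (by rwa [sub_add_cancel])
  -- The slope `|β| + 1` in the second coordinate dominates the term `-a m / 2`, which is about `β l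
  -- / 2` at the chosen lattice points.
  obtain ⟨c, hc⟩ := hC.superlinear (b.coord 0 - (|β| + 1) • b.coord 2) (by
    rw [← hb.zero]
    simp)
  by_contra! hle
  obtain ⟨l, hl⟩ := exists_nat_gt (s + c + a)
  -- For this `m`, the quadratic form at `(m, l)` is at most `a / 4`.
  set m : ℤ := round (-(β * l / a)) with hm
  have hround := abs_le.1 (abs_sub_round (-(β * l / a)))
  have h1 := hc _ (hmem m l)
  simp only [hV, map_add, map_smul, LinearMap.sub_apply, LinearMap.smul_apply,
    Module.Basis.coord_apply, hf3, hf1, hf2, hf0, Module.Basis.repr_self, Int.cast_natCast] at h1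
  simp at h1
  rw [← hm] at hround
  set μ : ℝ := (m : ℝ) with hμ
  set ε : ℝ := μ + β * l / a with hε
  have hε1 : -(1 / 2) ≤ ε ∧ ε ≤ 1 / 2 := by constructor <;> linarith [hround.1, hround.2]
  have hμε : μ = ε - β * l / a := by rw [hε]; ring
  have h2 : a * μ ^ 2 + 2 * β * (μ * l) + δ * l ^ 2 = a * ε ^ 2 + (a * δ - β ^ 2) / a * l ^ 2 := by
    rw [hμε]
    field_simp
    ring
  have h3 : (a * δ - β ^ 2) / a * (l : ℝ) ^ 2 ≤ 0 := by
    refine mul_nonpos_of_nonpos_of_nonneg ?_ (by positivity)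
    exact div_nonpos_of_nonpos_of_nonneg (by linarith) ha.le
  have h4 : a * ε ^ 2 ≤ a * (1 / 4) := by
    refine mul_le_mul_of_nonneg_left ?_ ha.le
    nlinarith
  have h5 : -(a * μ) ≤ β * l + a / 2 := by
    have : a * μ = a * ε - β * l := by rw [hμε]; field_simp
    rw [this]
    nlinarith
  have h6 : β * l ≤ |β| * l := mul_le_mul_of_nonneg_right (le_abs_self β) (Nat.cast_nonneg l)
  have h7 : 0 ≤ |β| * (l : ℝ) := by positivity
  have h8 : 0 ≤ δ * (l : ℝ) := by positivity
  nlinarith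

end IsUnitTranslation


/-! ### The quadratic form preserved by a parabolic subgroup -/

namespace IsCuspOf

variable {Ω : Set (PSpace 3)} {x : PSpace 3} {C : Set (Vec 3)} {k : Vec 3 →ₗ[ℝ] ℝ}
  {p : Vec 3} {f : Vec 3 →ₗ[ℝ] ℝ} {b : Module.Basis (Fin 4) ℝ (Vec 3)}
  {T S : Vec 3 ≃ₗ[ℝ] Vec 3}

theorem exists_apply_eq_add (h : IsCuspOf Ω x C k p f b) (hT : IsCuspAut C p f T)
    (hA : linPart b T = 1) {v : Vec 3} (hv : f v = 0) : ∃ l : ℝ, T v = v + l • b 0 := by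
  have m11 := congrFun (congrFun hA 0) 0
  have m12 := congrFun (congrFun hA 0) 1
  have m21 := congrFun (congrFun hA 1) 0
  have m22 := congrFun (congrFun hA 1) 1
  simp only [linPart, Matrix.of_apply, Matrix.cons_val', Matrix.cons_val_zero, Matrix.cons_val_one,
    Matrix.cons_val_fin_one, Matrix.one_apply_eq, ne_eq, zero_ne_one, one_ne_zero,
    not_false_eq_true, Matrix.one_apply_ne] at m11 m12 m21 m22
  have h1 := hT.repr_one h.basis v
  have h2 := hT.repr_two h.basis v
  have h3 : b.repr (T v) 3 = b.repr v 3 := by rw [h.basis.coord, h.basis.coord, hT.map_f]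
  rw [m11, m12, hv] at h1
  rw [m21, m22, hv] at h2
  refine ⟨b.repr (T v) 0 - b.repr v 0, b.ext_elem fun i => ?_⟩
  fin_cases i
  · simp
  · simpa using h1
  · simpa using h2
  · simpa using h3

theorem repr_apply_sub (h : IsCuspOf Ω x C k p f b) (hT : IsCuspAut C p f T) :
    b.repr (T (b 3) - b 3) 1 = transPart b T 0 ∧ b.repr (T (b 3) - b 3) 2 = transPart b T 1 ∧
      f (T (b 3) - b 3) = 0 := by
  have hf3 : f (b 3) = 1 := by rw [← h.basis.coord]; simp
  refine ⟨?_, ?_, ?_⟩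
  · rw [map_sub, Finsupp.sub_apply, hT.repr_one h.basis, hf3]
    simp [transPart]
  · rw [map_sub, Finsupp.sub_apply, hT.repr_two h.basis, hf3]
    simp [transPart]
  · rw [map_sub, hT.map_f, sub_self]

/-- Two vectors of `ker f` with independent classes modulo `p` belong to a cusp basis. -/
theorem exists_basis (h : IsCuspOf Ω x C k p f b) {d e : Vec 3} (hd : f d = 0) (he : f e = 0)
    (hli : ∀ y z : ℝ, y * b.repr d 1 + z * b.repr e 1 = 0 → y * b.repr d 2 + z * b.repr e 2 = 0 →
      y = 0 ∧ z = 0) :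
    ∃ b', IsCuspBasis p f b' ∧ b' 1 = d ∧ b' 2 = e ∧ b' 3 = b 3 := by
  have hf3 : f (b 3) = 1 := by rw [← h.basis.coord]; simp
  refine exists_isCuspBasis_of_independent h.cusp.map_p hd he hf3 fun w y z h0 => ?_
  obtain ⟨-, r1, r2⟩ := h.basis.repr_p
  have e1 := congrArg (fun v => b.repr v 1) h0
  have e2 := congrArg (fun v => b.repr v 2) h0
  simp only [map_add, map_smul, Finsupp.add_apply, Finsupp.smul_apply, r1, r2, smul_eq_mul,
    mul_zero, zero_add, map_zero, Finsupp.zero_apply] at e1 e2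
  obtain ⟨rfl, rfl⟩ := hli y z e1 e2
  rw [zero_smul, zero_smul, add_zero, add_zero, smul_eq_zero] at h0
  exact ⟨h0.resolve_right h.p_ne_zero, rfl, rfl⟩

theorem exists_isUnitTranslation (h : IsCuspOf Ω x C k p f b) (hT : IsCuspAut C p f T)
    (ha : mat b T 0 0 = 1) (hA : linPart b T = 1) {b' : Module.Basis (Fin 4) ℝ (Vec 3)}
    (hb' : IsCuspBasis p f b') (h3 : b' 3 = b 3) {i : Fin 4} (hi : b' i = T (b 3) - b 3) :
    ∃ l₁ l₂, IsUnitTranslation b' T i l₁ l₂ := by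
  have h0 : T (b' 0) = b' 0 := by
    rw [hb'.zero, (hT.mat_zero h.basis).2.2.2.2, ha, one_smul]
  have hb0 : b 0 = b' 0 := by rw [h.basis.zero, hb'.zero]
  obtain ⟨l₁, hl₁⟩ := h.exists_apply_eq_add hT hA (v := b' 1) (by rw [← hb'.coord]; simp)
  obtain ⟨l₂, hl₂⟩ := h.exists_apply_eq_add hT hA (v := b' 2) (by rw [← hb'.coord]; simp)
  refine ⟨l₁, l₂, h0, by rw [hl₁, hb0], by rw [hl₂, hb0], ?_⟩
  rw [hi, h3, add_sub_cancel]

/-- With a single translation the coefficient `δ` is free, and it is chosen to make the form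
positive definite. -/
theorem exists_cuspForm_of_translation (h : IsCuspOf Ω x C k p f b) (hT : IsCuspAut C p f T)
    (ha : mat b T 0 0 = 1) (hA : linPart b T = 1) (ht : transPart b T ≠ 0) :
    ∃ B, IsCuspForm p f B ∧ T ∈ formGroup B := by
  obtain ⟨r1, r2, hd⟩ := h.repr_apply_sub hT
  set τ := transPart b T with hτ
  obtain ⟨b', hb', h1, -, h3⟩ := h.exists_basis (d := T (b 3) - b 3)
    -- The basis is completed by the quarter turn of the translation vector.
    (e := (-τ 1) • b 1 + τ 0 • b 2) hd (by
      rw [← h.basis.coord]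
      simp) (by
      intro y z e1 e2
      rw [r1] at e1
      rw [r2] at e2
      simp at e1 e2
      have hpos : τ 0 ^ 2 + τ 1 ^ 2 ≠ 0 := by
        intro h0
        have t0 : τ 0 = 0 := by nlinarith [sq_nonneg (τ 0), sq_nonneg (τ 1)]
        have t1 : τ 1 = 0 := by nlinarith [sq_nonneg (τ 0), sq_nonneg (τ 1)]
        apply ht
        ext i
        fin_cases i
        · exact t0
        · exact t1
      constructor
      · apply (mul_eq_zero.1 (_ : y * (τ 0 ^ 2 + τ 1 ^ 2) = 0)).resolve_right hpos
        linear_combination τ 0 * e1 + τ 1 * e2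
      · apply (mul_eq_zero.1 (_ : z * (τ 0 ^ 2 + τ 1 ^ 2) = 0)).resolve_right hpos
        linear_combination τ 0 * e2 - τ 1 * e1)
  obtain ⟨l₁, l₂, hl⟩ := h.exists_isUnitTranslation hT ha hA hb' h3 h1
  have hpos : 0 < l₁ := IsUnitTranslation.pos h.cusp hb' (by decide) (by decide) hT.map_mem hl.zero
    hl.one hl.three
  refine ⟨cuspForm b' l₁ l₂ ((l₂ ^ 2 + 1) / l₁), isCuspForm_cuspForm hb' hpos ?_,
    hl.mem_formGroup_one⟩
  rw [mul_div_cancel₀ _ hpos.ne']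
  linarith

theorem exists_cuspForm_of_translations (h : IsCuspOf Ω x C k p f b) (hT : IsCuspAut C p f T)
    (ha : mat b T 0 0 = 1) (hA : linPart b T = 1) (hS : IsCuspAut C p f S)
    (ha' : mat b S 0 0 = 1) (hA' : linPart b S = 1)
    (hli : LinearIndependent ℝ ![transPart b T, transPart b S]) (hTS : T * S = S * T) :
    ∃ B, IsCuspForm p f B ∧ T ∈ formGroup B ∧ S ∈ formGroup B := by
  obtain ⟨r1, r2, hd⟩ := h.repr_apply_sub hT
  obtain ⟨s1, s2, he⟩ := h.repr_apply_sub hS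
  obtain ⟨b', hb', h1, h2, h3⟩ := h.exists_basis hd he (by
    intro y z e1 e2
    rw [r1, s1] at e1
    rw [r2, s2] at e2
    refine LinearIndependent.pair_iff.1 hli y z ?_
    ext i
    fin_cases i
    · simpa using e1
    · simpa using e2)
  obtain ⟨a, β, hl⟩ := h.exists_isUnitTranslation hT ha hA hb' h3 h1
  obtain ⟨β', δ, hl'⟩ := h.exists_isUnitTranslation hS ha' hA' hb' h3 h2
  -- Comparing the `p`-coordinates of `T S (b 3)` and `S T (b 3)` shows that the quadratic part is
  -- symmetric.
  have hβ : β' = β := by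
    have h4 := LinearEquiv.congr_fun hTS (b' 3)
    rw [LinearEquiv.mul_apply, LinearEquiv.mul_apply, hl'.three, map_add, hl.three, hl.two, map_add,
      hl'.three, hl'.one] at h4
    have h5 := congrArg (fun v => b'.repr v 0) h4
    simpa using h5.symm
  subst hβ
  have hlt := hl.sq_lt h.cusp hb' hT hS hl'
  have hpos : 0 < a := IsUnitTranslation.pos h.cusp hb' (by decide) (by decide) hT.map_mem hl.zero
    hl.one hl.three
  exact ⟨cuspForm b' a _ δ, isCuspForm_cuspForm hb' hpos hlt, hl.mem_formGroup_one,
    hl'.mem_formGroup_two⟩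

end IsCuspOf

namespace IsParabolicAction

variable {Ω : Set (PSpace 3)} {x : PSpace 3} {C : Set (Vec 3)} {k : Vec 3 →ₗ[ℝ] ℝ}
  {p : Vec 3} {f : Vec 3 →ₗ[ℝ] ℝ} {b : Module.Basis (Fin 4) ℝ (Vec 3)}
  {P : Subgroup (SL 3)} {ρ : P →* (Vec 3 ≃ₗ[ℝ] Vec 3)} {H : Subgroup P}

/-- A parabolic subgroup preserves a Lorentzian form with isotropic line `x`. -/
theorem exists_cuspForm (hP : IsParabolicAction Ω C p f P ρ H) (h : IsCuspOf Ω x C k p f b) :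
    ∃ B, IsCuspForm p f B ∧ ∀ γ, ρ γ ∈ formGroup B := by
  have hfi := hP.finiteIndex
  have haut : ∀ γ, IsCuspAut C p f (ρ γ) := fun γ => (hP.norm γ).toIsCuspAut
  obtain ⟨B, hB, hH⟩ : ∃ B, IsCuspForm p f B ∧ ∀ γ ∈ H, ρ γ ∈ formGroup B := by
    rcases hP.exists_generators h with ⟨-, γ, hγ, ht, hgen⟩ | ⟨-, γ, hγ, δ, hδ, hli, hcomm, hgen⟩
    · obtain ⟨ha, hA⟩ := hP.unipotent h hγ
      obtain ⟨B, hB, hT⟩ := h.exists_cuspForm_of_translation (haut γ) ha hA ht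
      refine ⟨B, hB, fun η hη => ?_⟩
      obtain ⟨m, rfl⟩ := hgen η hη
      rw [map_zpow]
      exact (formGroup B).zpow_mem hT m
    · obtain ⟨ha, hA⟩ := hP.unipotent h hγ
      obtain ⟨ha', hA'⟩ := hP.unipotent h hδ
      obtain ⟨B, hB, hT, hS⟩ := h.exists_cuspForm_of_translations (haut γ) ha hA (haut δ) ha' hA'
        hli (by rw [← map_mul, hcomm, map_mul])
      refine ⟨B, hB, fun η hη => ?_⟩
      obtain ⟨m, l, rfl⟩ := hgen η hη
      rw [map_mul, map_zpow, map_zpow]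
      exact (formGroup B).mul_mem ((formGroup B).zpow_mem hT m) ((formGroup B).zpow_mem hS l)
  refine hB.exists_invariant ρ (fun γ v => (haut γ).map_f v) (fun γ => ?_) H hH
  rw [((haut γ).mat_zero h.basis).2.2.2.2, hP.mat_zero_zero h, one_smul]

/-- The normalization differs from `γ` by a scalar of square `1`, which a bilinear form does not
see. -/
theorem smul_smul_eq (hP : IsParabolicAction Ω C p f P ρ H) (h : IsCuspOf Ω x C k p f b)
    {B : LinearMap.BilinForm ℝ (Vec 3)} {γ : P} (hB : ρ γ ∈ formGroup B) (v w : Vec 3) :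
    B ((γ : SL 3) • v) ((γ : SL 3) • w) = B v w := by
  obtain ⟨r, -, hr⟩ := (hP.norm γ).exists_smul
  have ha := hP.mat_zero_zero h γ
  have h1 := h.sq_smul_eq (hP.norm γ) ha
    ((hP.norm γ).linPart_of_unipotent h.cusp h.basis ha).1 hr
  have h2 := hB v w
  rw [hr, hr, LinearMap.map_smul₂, LinearMap.map_smul, smul_smul, ← pow_two, h1, one_smul] at h2
  exact h2

end IsParabolicAction

/-! ### Lorentz bases -/

theorem lorentzMatrix_apply (i j : Fin 4) :
    lorentzMatrix 3 i j = if i = j then (if i = 0 then -1 else 1) else 0 := by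
  rw [lorentzMatrix, Matrix.diagonal_apply]
  congr 1
  refine Fin.cases (by simp) (fun i => ?_) i
  simp [Fin.succ_ne_zero]

/-- Correct `b 3` by a multiple of `p` to an isotropic `u`. Then `p, u` span a hyperbolic plane, and
Gram–Schmidt on its orthogonal, where the form is positive, provides the other two vectors. -/
theorem IsCuspForm.exists_lorentz {p : Vec 3} {f : Vec 3 →ₗ[ℝ] ℝ}
    {B : LinearMap.BilinForm ℝ (Vec 3)} (hB : IsCuspForm p f B)
    {b : Module.Basis (Fin 4) ℝ (Vec 3)} (hb : IsCuspBasis p f b) :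
    ∃ e : Fin 4 → Vec 3, ∀ i j, B (e i) (e j) = lorentzMatrix 3 i j := by
  have hfp : f p = 0 := hb.f_p
  have hf1 : f (b 1) = 0 := by rw [← hb.coord]; simp
  have hf2 : f (b 2) = 0 := by rw [← hb.coord]; simp
  have hf3 : f (b 3) = 1 := by rw [← hb.coord]; simp
  have hBp : ∀ v, B v p = -f v := fun v => by rw [hB.symm, hB.map_p]
  set u := b 3 + (B (b 3) (b 3) / 2) • p with hu
  have hfu : f u = 1 := by simp [hu, hf3, hfp]
  have huu : B u u = 0 := by
    simp only [hu, map_add, map_smul, LinearMap.add_apply, LinearMap.smul_apply, hBp, hB.map_p, hf3,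
      hfp, smul_eq_mul]
    ring
  have hproj : ∀ v, f v = 0 → f (v + B v u • p) = 0 ∧ B (v + B v u • p) u = 0 := by
    intro v hv
    constructor
    · simp [hv, hfp]
    · simp [hB.map_p, hfu]
  have hnotp : ∀ y z : ℝ, (y ≠ 0 ∨ z ≠ 0) → ∀ s r : ℝ, y • b 1 + z • b 2 + s • p ≠ r • p := by
    intro y z hyz s r h0
    have e1 := congrArg (fun v => b.repr v 1) h0
    have e2 := congrArg (fun v => b.repr v 2) h0
    rw [← hb.zero] at e1 e2
    simp at e1 e2
    rcases hyz with h1 | h1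
    · exact h1 e1
    · exact h1 e2
  have hposd : ∀ y z : ℝ, (y ≠ 0 ∨ z ≠ 0) → ∀ s : ℝ,
      0 < B (y • b 1 + z • b 2 + s • p) (y • b 1 + z • b 2 + s • p) := fun y z hyz s =>
    hB.pos _ (by simp [hf1, hf2, hfp]) (hnotp y z hyz s)
  obtain ⟨g1, g2⟩ := hproj (b 1) hf1
  obtain ⟨k1, k2⟩ := hproj (b 2) hf2
  set w₁ := b 1 + B (b 1) u • p with hw₁
  set w₂ := b 2 + B (b 2) u • p with hw₂
  have hw₁pos : 0 < B w₁ w₁ := by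
    have := hposd 1 0 (Or.inl one_ne_zero) (B (b 1) u)
    rwa [one_smul, zero_smul, add_zero] at this
  set e₁ := (√(B w₁ w₁))⁻¹ • w₁ with he₁
  have hs1 : √(B w₁ w₁) ^ 2 = B w₁ w₁ := Real.sq_sqrt hw₁pos.le
  have hs1' : 0 < √(B w₁ w₁) := Real.sqrt_pos.2 hw₁pos
  have he₁e₁ : B e₁ e₁ = 1 := by
    rw [he₁, map_smul, LinearMap.map_smul, LinearMap.smul_apply, smul_eq_mul, smul_eq_mul]
    field_simp
    exact hs1.symm
  have he₁p : f e₁ = 0 := by rw [he₁, map_smul, g1, smul_zero]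
  have he₁u : B e₁ u = 0 := by rw [he₁, map_smul, LinearMap.smul_apply, g2, smul_zero]
  set w₃ := w₂ - B w₂ e₁ • e₁ with hw₃
  have hw₃e₁ : B w₃ e₁ = 0 := by
    rw [hw₃, LinearMap.map_sub₂, LinearMap.map_smul₂, he₁e₁, smul_eq_mul,
      mul_one, sub_self]
  have hw₃p : f w₃ = 0 := by rw [hw₃, map_sub, map_smul, k1, he₁p, smul_zero, sub_zero]
  have hw₃u : B w₃ u = 0 := by
    rw [hw₃, map_sub, map_smul, LinearMap.sub_apply, LinearMap.smul_apply, k2, he₁u, smul_zero,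
      sub_zero]
  have hw₃pos : 0 < B w₃ w₃ := by
    have := hposd (-(B w₂ e₁ * (√(B w₁ w₁))⁻¹)) 1 (Or.inr one_ne_zero)
      (B (b 2) u - B w₂ e₁ * (√(B w₁ w₁))⁻¹ * B (b 1) u)
    have h1 : -(B w₂ e₁ * (√(B w₁ w₁))⁻¹) • b 1 + (1 : ℝ) • b 2
        + (B (b 2) u - B w₂ e₁ * (√(B w₁ w₁))⁻¹ * B (b 1) u) • p = w₃ := by
      rw [hw₃]
      generalize hr : B w₂ e₁ = r
      rw [he₁]
      generalize (√(B w₁ w₁))⁻¹ = q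
      rw [hw₁, hw₂]
      module
    rwa [h1] at this
  set e₂ := (√(B w₃ w₃))⁻¹ • w₃ with he₂
  have hs2 : √(B w₃ w₃) ^ 2 = B w₃ w₃ := Real.sq_sqrt hw₃pos.le
  have hs2' : 0 < √(B w₃ w₃) := Real.sqrt_pos.2 hw₃pos
  have he₂e₂ : B e₂ e₂ = 1 := by
    rw [he₂, map_smul, LinearMap.map_smul, LinearMap.smul_apply, smul_eq_mul, smul_eq_mul]
    field_simp
    exact hs2.symm
  have he₂e₁ : B e₂ e₁ = 0 := by rw [he₂, LinearMap.map_smul₂, hw₃e₁, smul_zero]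
  have he₂p : f e₂ = 0 := by rw [he₂, map_smul, hw₃p, smul_zero]
  have he₂u : B e₂ u = 0 := by rw [he₂, map_smul, LinearMap.smul_apply, hw₃u, smul_zero]
  have he₁e₂ : B e₁ e₂ = 0 := by rw [hB.symm, he₂e₁]
  have hue₁ : B u e₁ = 0 := by rw [hB.symm, he₁u]
  have hue₂ : B u e₂ = 0 := by rw [hB.symm, he₂u]
  -- Since `B u p = -1`, the vectors `u / 2 + p` and `u / 2 - p` have squares `-1` and `1` and are
  -- orthogonal.
  refine ⟨![(2 : ℝ)⁻¹ • u + p, e₁, e₂, (2 : ℝ)⁻¹ • u - p], fun i j => ?_⟩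
  rw [lorentzMatrix_apply]
  fin_cases i <;> fin_cases j <;>
    simp [huu, hfp, hB.map_p, hBp, hfu, he₁p, he₂p, he₁e₁, he₂e₂, he₁e₂, he₂e₁, he₁u, he₂u, hue₁,
      hue₂] <;> norm_num


/-! ### The invariant ellipsoid -/

theorem bilin_eq_dotProduct (B : LinearMap.BilinForm ℝ (Vec n)) (v w : Vec n) :
    B v w = v ⬝ᵥ (LinearMap.BilinForm.toMatrix' B).mulVec w := by
  conv_lhs => rw [← Matrix.toBilin'_toMatrix' B]
  rw [Matrix.toBilin'_apply']

theorem mem_cone_unitBall {v : Vec n} :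
    v ∈ cone (unitBall n) ↔ v ⬝ᵥ (lorentzMatrix n).mulVec v < 0 := by
  have hq : ∀ w : Vec n, w ⬝ᵥ (lorentzMatrix n).mulVec w = ∑ i : Fin n, w i.succ ^ 2 - w 0 ^ 2 := by
    intro w
    rw [lorentzMatrix, dotProduct, Fin.sum_univ_succ]
    simp only [Matrix.mulVec_diagonal, Fin.cons_zero, Fin.cons_succ]
    simp only [one_mul, ← pow_two]
    ring
  rw [hq, sub_neg]
  constructor
  · rintro ⟨hv, w, hw, hlt⟩
    obtain ⟨r, hr, rfl⟩ := (mem_cone_singleton_mk hv).1 hw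
    simp only [Pi.smul_apply, smul_eq_mul, mul_pow, ← Finset.mul_sum] at hlt
    exact lt_of_mul_lt_mul_left hlt (sq_nonneg r)
  · intro h
    have hv : v ≠ 0 := by
      rintro rfl
      simp at h
    exact ⟨hv, v, ⟨hv, rfl⟩, h⟩

theorem exists_SL_of_lorentz {M : Matrix (Fin 4) (Fin 4) ℝ} {e : Matrix (Fin 4) (Fin 4) ℝ}
    (h : e.transpose * M * e = lorentzMatrix 3) :
    ∃ g : SL 3, ∃ c : ℝ, 0 < c ∧ g.1.transpose * M * g.1 = c • lorentzMatrix 3 := by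
  have hdet : e.det ≠ 0 := by
    intro h0
    have := congrArg Matrix.det h
    rw [Matrix.det_mul, h0, mul_zero, lorentzMatrix, Matrix.det_diagonal, Fin.prod_univ_succ] at this
    simp at this
  obtain ⟨e', h', hpos⟩ : ∃ e' : Matrix (Fin 4) (Fin 4) ℝ,
      e'.transpose * M * e' = lorentzMatrix 3 ∧ 0 < e'.det := by
    rcases hdet.lt_or_gt with hlt | hgt
    -- Composing with the reflection `diag(-1, 1, 1, 1)` makes the determinant positive without
    -- changing the form.
    · refine ⟨e * lorentzMatrix 3, ?_, ?_⟩
      · have h1 : (lorentzMatrix 3).transpose = lorentzMatrix 3 := by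
          rw [lorentzMatrix, Matrix.diagonal_transpose]
        have h2 : lorentzMatrix 3 * lorentzMatrix 3 = 1 := by
          rw [lorentzMatrix, Matrix.diagonal_mul_diagonal, ← Matrix.diagonal_one]
          congr 1
          ext i
          refine Fin.cases (by simp) (fun i => by simp) i
        rw [Matrix.transpose_mul, h1]
        calc lorentzMatrix 3 * e.transpose * M * (e * lorentzMatrix 3)
            -- The reflection is its own transpose and inverse.
            = lorentzMatrix 3 * (e.transpose * M * e) * lorentzMatrix 3 := by
              simp only [Matrix.mul_assoc]
          _ = _ := by rw [h, h2, Matrix.one_mul]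
      · rw [Matrix.det_mul, lorentzMatrix, Matrix.det_diagonal, Fin.prod_univ_succ]
        simpa using hlt
    · exact ⟨e, h, hgt⟩
  set r : ℝ := e'.det ^ (-(1 / 4) : ℝ) with hr
  have hrpos : 0 < r := Real.rpow_pos_of_pos hpos _
  have hr4 : r ^ 4 * e'.det = 1 := by
    rw [hr, ← Real.rpow_natCast, ← Real.rpow_mul hpos.le]
    norm_num
    rw [Real.rpow_neg_one, inv_mul_cancel₀ hpos.ne']
  refine ⟨⟨r • e', ?_⟩, r ^ 2, by positivity, ?_⟩
  · rw [Matrix.det_smul, Fintype.card_fin]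
    exact hr4
  · change (r • e').transpose * M * (r • e') = _
    rw [Matrix.transpose_smul, Matrix.smul_mul, Matrix.smul_mul, Matrix.mul_smul, h', smul_smul,
      pow_two]

theorem IsCuspForm.exists_SL {p : Vec 3} {f : Vec 3 →ₗ[ℝ] ℝ}
    {B : LinearMap.BilinForm ℝ (Vec 3)} (hB : IsCuspForm p f B)
    {b : Module.Basis (Fin 4) ℝ (Vec 3)} (hb : IsCuspBasis p f b) :
    ∃ g : SL 3, ∃ c : ℝ, 0 < c ∧ g.1.transpose * LinearMap.BilinForm.toMatrix' B * g.1
      = c • lorentzMatrix 3 := by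
  obtain ⟨e, he⟩ := hB.exists_lorentz hb
  refine exists_SL_of_lorentz (e := (Matrix.of e).transpose) ?_
  ext i j
  rw [← he, bilin_eq_dotProduct, Matrix.transpose_transpose, Matrix.mul_assoc, Matrix.mul_apply]
  rfl

section

variable {B : LinearMap.BilinForm ℝ (Vec 3)} {g : SL 3} {c : ℝ}

theorem mem_cone_smul_unitBall (hc : 0 < c)
    (hg : g.1.transpose * LinearMap.BilinForm.toMatrix' B * g.1 = c • lorentzMatrix 3) {v : Vec 3} :
    v ∈ cone (g • unitBall 3) ↔ B v v < 0 := by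
  obtain ⟨w, rfl⟩ : ∃ w, g • w = v := ⟨g⁻¹ • v, smul_inv_smul g v⟩
  rw [smul_mem_cone_smul, mem_cone_unitBall, bilin_eq_dotProduct, SL_smul_eq, Matrix.mulVec_mulVec,
    Matrix.dotProduct_mulVec (g.1.mulVec w), ← Matrix.dotProduct_mulVec,
    ← Matrix.vecMul_transpose g.1 w, ← Matrix.dotProduct_mulVec, Matrix.mulVec_mulVec,
    ← Matrix.mul_assoc, hg, Matrix.smul_mulVec, dotProduct_smul, smul_eq_mul]
  constructor
  · intro h
    exact mul_neg_of_pos_of_neg hc h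
  · intro h
    exact (pos_iff_neg_of_mul_neg h).1 hc

theorem mem_Aut_smul_unitBall (hc : 0 < c)
    (hg : g.1.transpose * LinearMap.BilinForm.toMatrix' B * g.1 = c • lorentzMatrix 3) {γ : SL 3}
    (hγ : ∀ v w, B (γ • v) (γ • w) = B v w) : γ ∈ Aut (g • unitBall 3) := by
  rw [mem_Aut_iff]
  ext z
  have hz := rep_mem_cone z
  rw [Set.mem_smul_set_iff_inv_smul_mem, mem_iff_cone hz,
    mem_iff_cone (smul_mem_cone_singleton (g := γ⁻¹) hz), mem_cone_smul_unitBall hc hg,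
    mem_cone_smul_unitBall hc hg, ← hγ, smul_inv_smul]

theorem conj_mem_SOn1 (hc : 0 < c)
    (hg : g.1.transpose * LinearMap.BilinForm.toMatrix' B * g.1 = c • lorentzMatrix 3) {γ : SL 3}
    (hγ : ∀ v w, B (γ • v) (γ • w) = B v w) : g⁻¹ * γ * g ∈ SOn1 3 := by
  set M := LinearMap.BilinForm.toMatrix' B with hM
  have hMγ : γ.1.transpose * M * γ.1 = M := by
    have h1 := LinearMap.BilinForm.toMatrix'_comp B (Matrix.toLin' γ.1) (Matrix.toLin' γ.1)
    have h2 : B.comp (Matrix.toLin' γ.1) (Matrix.toLin' γ.1) = B :=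
      LinearMap.ext₂ fun v w => hγ v w
    rw [h2, LinearMap.toMatrix'_toLin'] at h1
    exact h1.symm
  set δ : SL 3 := g⁻¹ * γ * g with hδ
  have h1 : g.1 * δ.1 = γ.1 * g.1 := by
    have h0 : g * δ = γ * g := by rw [hδ, mul_assoc, mul_inv_cancel_left]
    rw [← Matrix.SpecialLinearGroup.coe_mul, ← Matrix.SpecialLinearGroup.coe_mul, h0]
  change δ.1.transpose * lorentzMatrix 3 * δ.1 = lorentzMatrix 3
  have h2 : c • (δ.1.transpose * lorentzMatrix 3 * δ.1) = c • lorentzMatrix 3 := by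
    calc c • (δ.1.transpose * lorentzMatrix 3 * δ.1)
        = δ.1.transpose * (c • lorentzMatrix 3) * δ.1 := by
          rw [Matrix.mul_smul, Matrix.smul_mul]
      _ = (g.1 * δ.1).transpose * M * (g.1 * δ.1) := by
          rw [← hg, Matrix.transpose_mul]
          simp only [Matrix.mul_assoc]
      _ = g.1.transpose * (γ.1.transpose * M * γ.1) * g.1 := by
          rw [h1, Matrix.transpose_mul]
          simp only [Matrix.mul_assoc]
      _ = c • lorentzMatrix 3 := by rw [hMγ, hg]
  exact smul_right_injective _ hc.ne' h2

end

namespace IsCuspOf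

variable {Ω : Set (PSpace 3)} {x : PSpace 3} {C : Set (Vec 3)} {k : Vec 3 →ₗ[ℝ] ℝ}
  {p : Vec 3} {f : Vec 3 →ₗ[ℝ] ℝ} {b : Module.Basis (Fin 4) ℝ (Vec 3)}

theorem map_eq_zero (h : IsCuspOf Ω x C k p f b) {v : Vec 3} (hv : v ∈ cone {x}) : f v = 0 := by
  rw [eq_mk_of_mem_cone h.mem, mem_cone_singleton_mk] at hv
  obtain ⟨r, -, rfl⟩ := hv
  rw [map_smul, h.cusp.map_p, smul_zero]

theorem isTangentHyperplane (h : IsCuspOf Ω x C k p f b) : IsTangentHyperplane Ω x f := by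
  refine ⟨?_, h.f_ne_zero, fun v hv => h.map_eq_zero hv, fun v hv => ?_⟩
  · rw [mem_iff_cone h.mem, h.isCone.mem_cone_frontier_iff h.p_ne_zero]
    exact Or.inl ⟨h.mem_closure, h.notMem⟩
  · rcases (h.isCone.mem_cone v).1 hv with h1 | h1
    · exact (h.cusp.pos v h1).ne'
    · have := h.cusp.pos _ h1
      rw [map_neg] at this
      linarith

theorem isTangentHyperplane_smul_unitBall (h : IsCuspOf Ω x C k p f b)
    {B : LinearMap.BilinForm ℝ (Vec 3)} (hB : IsCuspForm p f B) {g : SL 3} {c : ℝ} (hc : 0 < c)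
    (hg : g.1.transpose * LinearMap.BilinForm.toMatrix' B * g.1 = c • lorentzMatrix 3) :
    IsTangentHyperplane (g • unitBall 3) x f := by
  have hpp : B p p = 0 := by rw [hB.map_p, h.cusp.map_p, neg_zero]
  have hcone : cone (g • unitBall 3) = {v | B v v < 0} := by
    ext v
    exact mem_cone_smul_unitBall hc hg
  have hcont : Continuous fun v : Vec 3 => B v v := by
    simp only [bilin_eq_dotProduct]
    fun_prop
  have hopen : IsOpen (g • unitBall 3) := by
    rw [isOpen_iff_cone, hcone]
    exact isOpen_lt hcont continuous_const
  refine ⟨?_, h.f_ne_zero, fun v hv => h.map_eq_zero hv, fun v hv hf => ?_⟩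
  · rw [mem_iff_cone h.mem, mem_cone_frontier hopen h.p_ne_zero, hcone]
    refine ⟨?_, fun hlt => (show B p p < 0 from hlt).ne hpp⟩
    -- Moving from `p` towards `u` makes the form negative to first order, `B(p + ε u, p + ε u) = ε
    -- (-2 + ε B(u, u))`, so `p` is in the closure of the ellipsoid.
    obtain ⟨u, hu⟩ : ∃ u, f u = 1 := ⟨b 3, by rw [← h.basis.coord]; simp⟩
    have hlim : Tendsto (fun ε : ℝ => p + ε • u) (𝓝[>] 0) (𝓝 p) := by
      have : Continuous fun ε : ℝ => p + ε • u := by fun_prop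
      simpa using (this.tendsto 0).mono_left nhdsWithin_le_nhds
    have hlim2 : Tendsto (fun ε : ℝ => -2 + ε * B u u) (𝓝[>] 0) (𝓝 (-2)) := by
      have : Continuous fun ε : ℝ => -2 + ε * B u u := by fun_prop
      simpa using (this.tendsto 0).mono_left nhdsWithin_le_nhds
    refine mem_closure_of_tendsto hlim ?_
    filter_upwards [self_mem_nhdsWithin, hlim2.eventually_lt_const (by norm_num : (-2 : ℝ) < 0)]
      with ε hε hneg
    have h1 : B (p + ε • u) (p + ε • u) = ε * (-2 + ε * B u u) := by
      simp only [map_add, map_smul, LinearMap.add_apply, LinearMap.smul_apply, hpp, hB.map_p,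
        hB.symm u p, hu, smul_eq_mul]
      ring
    change B (p + ε • u) (p + ε • u) < 0
    rw [h1]
    exact mul_neg_of_pos_of_neg hε hneg
  · rw [mem_cone_smul_unitBall hc hg] at hv
    by_cases hvp : ∃ r : ℝ, v = r • p
    · obtain ⟨r, rfl⟩ := hvp
      simp [hpp] at hv
    · push Not at hvp
      exact lt_asymm hv (hB.pos v hf hvp)

end IsCuspOf

theorem IsParabolicSubgroup.exists_ellipsoid {Ω : Set (PSpace 3)} (hΩ : IsProperlyConvex Ω)
    (hs : IsStrictlyConvex Ω) (hC1 : HasC1Boundary Ω) {P : Subgroup (SL 3)} {x : PSpace 3}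
    (hP : IsParabolicSubgroup Ω P x) :
    (∃ E : Set (PSpace 3), IsEllipsoid E ∧ AreTangentAt E Ω x ∧ P ≤ Aut E) ∧
      (∃ g : SL 3, P.map (MulAut.conj g).toMonoidHom ≤ SOn1 3) ∧ IsVirtuallyZOrZ2 P := by
  obtain ⟨C, k, hC⟩ := hΩ.exists_isConeOver
  obtain ⟨p, f, b, h⟩ := exists_isCuspOf hs hC1 hC hP.mem_frontier
  obtain ⟨ρ, hρ⟩ := h.exists_normalizationHom hP.le_aut fun γ hγ => hP.smul_eq hΩ hs hC1 hγ
  obtain ⟨H, hH, hpar⟩ := hP.exists_finiteIndex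
  have hA : IsParabolicAction Ω C p f P ρ H :=
    ⟨hP.discrete, hP.infinite, hH, hρ, fun γ hγ hγ1 => (hpar γ hγ hγ1).1⟩
  obtain ⟨B, hB, hinv⟩ := hA.exists_cuspForm h
  have hBinv : ∀ γ ∈ P, ∀ v w, B (γ • v) (γ • w) = B v w := fun γ hγ =>
    hA.smul_smul_eq h (γ := ⟨γ, hγ⟩) (hinv _)
  obtain ⟨g, c, hc, hg⟩ := hB.exists_SL h.basis
  refine ⟨⟨g • unitBall 3, ⟨g, rfl⟩, ⟨f, h.isTangentHyperplane_smul_unitBall hB hc hg,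
    h.isTangentHyperplane⟩, fun γ hγ => mem_Aut_smul_unitBall hc hg (hBinv γ hγ)⟩, ⟨g⁻¹, ?_⟩,
    H, hH, ?_⟩
  · rintro _ ⟨γ, hγ, rfl⟩
    have := conj_mem_SOn1 hc hg (hBinv γ hγ)
    simpa [MulAut.conj_apply] using this
  · rcases hA.exists_generators h with h1 | h1
    · exact Or.inl h1.1
    · exact Or.inr h1.1


end HilbertGeometry

end

theorem mainTheorem11 (Ω : Set (HilbertGeometry.PSpace 3))
    (hΩ : HilbertGeometry.IsProperlyConvex Ω)
    (hstrict : HilbertGeometry.IsStrictlyConvex Ω)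
    (hC1 : HilbertGeometry.HasC1Boundary Ω) :
    (∀ (P : Subgroup (HilbertGeometry.SL 3)) (p : HilbertGeometry.PSpace 3),
      HilbertGeometry.IsParabolicSubgroup Ω P p →
        (∀ γ ∈ P, γ • p = p) ∧
        (∃ E : Set (HilbertGeometry.PSpace 3), HilbertGeometry.IsEllipsoid E ∧
          HilbertGeometry.AreTangentAt E Ω p ∧ P ≤ HilbertGeometry.Aut E) ∧
        (∃ g : HilbertGeometry.SL 3,
          P.map (MulAut.conj g).toMonoidHom ≤ HilbertGeometry.SOn1 3) ∧
        HilbertGeometry.IsVirtuallyZOrZ2 P) ∧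
    (∀ Γ : Subgroup (HilbertGeometry.SL 3), Γ ≤ HilbertGeometry.Aut Ω → DiscreteTopology Γ →
      (HilbertGeometry.GeomFiniteOnDomain Ω Γ ↔ HilbertGeometry.GeomFiniteOnBoundary Ω Γ)) := by
  exact ⟨fun P p hP => ⟨fun γ hγ => hP.smul_eq hΩ hstrict hC1 hγ,
      hP.exists_ellipsoid hΩ hstrict hC1⟩,
    fun Γ hΓ hd => HilbertGeometry.geomFiniteOnDomain_iff hΩ hstrict hC1 hΓ hd⟩
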